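/- For $N\ge 1$ let $A_N$, $B_N$ be random $N\times N$ matrices whose $2N^2$ entries are independent standard complex Gaussian random variables (density $\frac1\pi e^{-|z|^2}$ on $\mathbb C$). The spherical ensemble $\mathscr X_N^S$ is the random $N$-point configuration on $\mathbb S^2$ whose points are mapped by the stereographic projection $(x_1,x_2,x_3)\mapsto\frac{x_1+ix_2}{1-x_3}$ to the eigenvalues (with multiplicity) of $A_N^{-1}B_N$. Let $\sigma$ be the normalised surface area measure on $\mathbb S^2$, $C(\mathbf x,\phi)=\{\mathbf y\in\mathbb S^2:\langle\mathbf x,\mathbf y\rangle>\cos\phi\}$ the spherical cap with centre $\mathbf x$ and opening angle $\phi$, and $\sigma(C(\phi))$ its measure, which does not depend on $\mathbf x$. The number variance is $$V(\mathscr X_N^S,\phi)=\mathbb E\big(\mathscr X_N^S(C(\cdot,\phi))^2\big)-\big(\mathbb E\,\mathscr X_N^S(C(\cdot,\phi))\big)^2,$$ where $\mathscr X_N^S(C)$ is the number of points of the configuration in $C$ and the expectations include integration over the centre of the cap with respect to $\sigma$, independently of the configuration. **Theorem.** The spherical ensemble is hyperuniform in all three regimes: 1. (large caps) for every $\phi\in(0,\frac\pi2)$,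 $V(\mathscr X_N^S,\phi)=o(N)$ as $N\to\infty$; 2. (small caps) for every sequence $(\phi_N)_{N\in\mathbb N}$ of opening angles with $\lim_{N\to\infty}\phi_N=0$ and $\lim_{N\to\infty}N\sigma(C(\phi_N))=\infty$, $V(\mathscr X_N^S,\phi_N)=o\big(N\sigma(C(\phi_N))\big)$ as $N\to\infty$; 3. (caps at threshold order) $\limsup_{N\to\infty}V(\mathscr X_N^S,tN^{-1/2})=\mathcal O(t)$ as $t\to\infty$. -/

import Mathlib

open MeasureTheory ProbabilityTheory Filter Topology
open scoped Pointwise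

noncomputable section

/-- The unit sphere `S^d` in `ℝ^(d+1)`. -/
abbrev Sph (d : ℕ) : Type := Metric.sphere (0 : EuclideanSpace ℝ (Fin (d + 1))) 1

/-- The normalised surface area measure `σ` on `S^d`. -/
def sphMeasure (d : ℕ) : Measure (Sph d) :=
  ((volume : Measure (EuclideanSpace ℝ (Fin (d + 1)))).toSphere Set.univ)⁻¹ •
    (volume : Measure (EuclideanSpace ℝ (Fin (d + 1)))).toSphere

instance sphMeasure_isProbabilityMeasure (d : ℕ) : IsProbabilityMeasure (sphMeasure d) := by
  refine ⟨?_⟩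
  rw [sphMeasure, Measure.smul_apply, smul_eq_mul]
  refine ENNReal.inv_mul_cancel ?_ (measure_ne_top _ _)
  rw [Ne, Measure.measure_univ_eq_zero]
  exact Measure.toSphere_ne_zero _

/-- The open spherical cap `C(x, φ) = {y ∈ S^d : ⟨x, y⟩ > cos φ}`. -/
def cap {d : ℕ} (x : Sph d) (φ : ℝ) : Set (Sph d) :=
  {y | Real.cos φ < inner ℝ (x : EuclideanSpace ℝ (Fin (d + 1))) y}

/-- The north pole `(0, …, 0, 1)`. -/
def northPole (d : ℕ) : Sph d :=
  ⟨EuclideanSpace.single (Fin.last d) 1, by simp⟩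

/-- The normalised area `σ(C(φ))` of a cap of opening angle `φ`
(by `sphMeasure_cap` below it does not depend on the centre). -/
def capArea (d : ℕ) (φ : ℝ) : ℝ := (sphMeasure d).real (cap (northPole d) φ)

lemma measurableSet_cap {d : ℕ} (x : Sph d) (φ : ℝ) : MeasurableSet (cap x φ) := by
  apply IsOpen.measurableSet
  exact isOpen_lt continuous_const (by fun_prop)

/-- All caps of the same opening angle have the same area. -/
theorem sphMeasure_cap {d : ℕ} (x : Sph d) (φ : ℝ) :
    (sphMeasure d).real (cap x φ) = capArea d φ := by
  obtain ⟨f, hf⟩ : ∃ f : EuclideanSpace ℝ (Fin (d + 1)) ≃ₗᵢ[ℝ] EuclideanSpace ℝ (Fin (d + 1)),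
      f x = northPole d := by
    refine ⟨(ℝ ∙ ((x : EuclideanSpace ℝ (Fin (d + 1))) - northPole d))ᗮ.reflection, ?_⟩
    apply Submodule.reflection_sub
    rw [norm_eq_of_mem_sphere x, norm_eq_of_mem_sphere (northPole d)]
  have key : (Set.Ioo (0 : ℝ) 1 • ((↑) '' cap x φ : Set (EuclideanSpace ℝ (Fin (d + 1))))) =
      f ⁻¹' (Set.Ioo (0 : ℝ) 1 •
        ((↑) '' cap (northPole d) φ : Set (EuclideanSpace ℝ (Fin (d + 1))))) := by
    ext z
    simp only [Set.mem_smul, Set.mem_preimage, Set.mem_image]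
    constructor
    · rintro ⟨r, hr, _, ⟨y, hy, rfl⟩, rfl⟩
      refine ⟨r, hr, f y, ⟨⟨f y, by simp⟩, ?_, rfl⟩, by simp⟩
      simpa [cap, ← hf] using hy
    · rintro ⟨r, hr, _, ⟨y, hy, rfl⟩, h⟩
      refine ⟨r, hr, f.symm y, ⟨⟨f.symm y, by simp⟩, ?_, rfl⟩, ?_⟩
      · have : inner ℝ (x : EuclideanSpace ℝ (Fin (d + 1))) (f.symm y) =
            inner ℝ (f x) (y : EuclideanSpace ℝ (Fin (d + 1))) := by
          rw [← f.inner_map_map, f.apply_symm_apply]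
        simp only [cap, Set.mem_ofPred_eq] at hy ⊢
        rw [this, hf]
        exact hy
      · apply f.injective
        simp [← h]
  unfold capArea Measure.real sphMeasure
  rw [Measure.smul_apply, Measure.smul_apply, Measure.toSphere_apply' _ (measurableSet_cap _ _),
    Measure.toSphere_apply' _ (measurableSet_cap _ _), key,
    f.measurePreserving.measure_preimage_emb f.toHomeomorph.measurableEmbedding]

/-- The number of points of the finite configuration `s` (points counted with multiplicity)
that lie in `C`. -/
def numPoints {d : ℕ} (s : Multiset (Sph d)) (C : Set (Sph d)) : ℝ :=
  (s.map (C.indicator fun _ => (1 : ℝ))).sum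

/-- The number variance `V(X, φ)` of the random configuration `X : Ω → Multiset (S^d)`: the
variance of the number of points in the cap `C(·, φ)`, where the expectation is over the
configuration and over the centre of the cap, which is distributed according to `σ`. -/
def numberVariance {d : ℕ} {Ω : Type*} [MeasurableSpace Ω] (P : Measure Ω)
    (X : Ω → Multiset (Sph d)) (φ : ℝ) : ℝ :=
  variance (fun p : Ω × Sph d => numPoints (X p.1) (cap p.2 φ)) (P.prod (sphMeasure d))

section Hyperuniform

variable {d : ℕ} {Ω : ℕ → Type*} [∀ N, MeasurableSpace (Ω N)]

/-- Hyperuniformity for large caps. -/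
def HyperuniformLargeCaps (P : ∀ N, Measure (Ω N)) (X : ∀ N, Ω N → Multiset (Sph d)) : Prop :=
  ∀ φ ∈ Set.Ioo 0 (Real.pi / 2),
    (fun N => numberVariance (P N) (X N) φ) =o[atTop] fun N : ℕ => (N : ℝ)

/-- Hyperuniformity for small caps. -/
def HyperuniformSmallCaps (P : ∀ N, Measure (Ω N)) (X : ∀ N, Ω N → Multiset (Sph d)) : Prop :=
  ∀ φ : ℕ → ℝ, Tendsto φ atTop (𝓝 0) →
    Tendsto (fun N : ℕ => (N : ℝ) * capArea d (φ N)) atTop atTop →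
    (fun N => numberVariance (P N) (X N) (φ N)) =o[atTop] fun N : ℕ => (N : ℝ) * capArea d (φ N)

/-- Hyperuniformity for caps at threshold order:
`limsup_{N → ∞} V(X_N, t N^(-1/d)) = O(t^(d-1))` as `t → ∞`.
The `limsup` is taken in the extended reals, so the bound includes its finiteness. -/
def HyperuniformThreshold (P : ∀ N, Measure (Ω N)) (X : ∀ N, Ω N → Multiset (Sph d)) : Prop :=
  ∃ c : ℝ, ∀ᶠ t : ℝ in atTop,
    limsup (fun N : ℕ =>
      ((numberVariance (P N) (X N) (t * (N : ℝ) ^ (-(1 / (d : ℝ)))) : ℝ) : EReal)) atTop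
      ≤ ((c * t ^ (d - 1) : ℝ) : EReal)

end Hyperuniform

/-- The standard complex Gaussian distribution, with density `exp (-|z|²) / π`. -/
def complexGaussian : Measure ℂ :=
  volume.withDensity fun z => ENNReal.ofReal (Real.exp (-‖z‖ ^ 2) / Real.pi)

instance complexGaussian_isProbabilityMeasure : IsProbabilityMeasure complexGaussian := by
  have hI := GaussianFourier.integral_rexp_neg_mul_sq_norm (V := ℂ) one_pos
  simp only [Complex.finrank_real_complex, neg_mul, one_mul, div_one] at hI
  norm_num at hI
  have hint : Integrable (fun z : ℂ => Real.exp (-‖z‖ ^ 2)) := by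
    by_contra h
    rw [integral_undef h] at hI
    exact Real.pi_ne_zero hI.symm
  refine ⟨?_⟩
  rw [complexGaussian, withDensity_apply _ MeasurableSet.univ, Measure.restrict_univ,
    ← ofReal_integral_eq_lintegral_ofReal (hint.div_const _)
      (Eventually.of_forall fun z => by positivity), integral_div, hI,
    div_self Real.pi_ne_zero, ENNReal.ofReal_one]

/-- `A` and `B` are random `N × N` matrices, all of whose `2 N²` entries are independent
standard complex Gaussian random variables. -/
structure IsGaussianPair {N : ℕ} {Ω : Type*} [MeasurableSpace Ω] (P : Measure Ω)
    (A B : Ω → Matrix (Fin N) (Fin N) ℂ) : Prop where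
  hasLaw_left : ∀ i j, HasLaw (fun ω => A ω i j) complexGaussian P
  hasLaw_right : ∀ i j, HasLaw (fun ω => B ω i j) complexGaussian P
  indep : iIndepFun (Sum.elim (fun (ij : Fin N × Fin N) ω => A ω ij.1 ij.2)
    (fun (ij : Fin N × Fin N) ω => B ω ij.1 ij.2)) P

/-- The stereographic projection `x ↦ (x₁ + i x₂) / (1 - x₃)` of `S²` from the north pole. -/
def stereoProj (x : Sph 2) : ℂ :=
  (((x : EuclideanSpace ℝ (Fin 3)) 0 : ℂ) + Complex.I * ((x : EuclideanSpace ℝ (Fin 3)) 1 : ℂ)) /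
    (1 - ((x : EuclideanSpace ℝ (Fin 3)) 2 : ℂ))

/-- The inverse of the stereographic projection,
`z ↦ (2 Re z, 2 Im z, |z|² - 1) / (|z|² + 1)`. -/
def invStereo (z : ℂ) : Sph 2 :=
  ⟨!₂[2 * z.re / (‖z‖ ^ 2 + 1), 2 * z.im / (‖z‖ ^ 2 + 1), (‖z‖ ^ 2 - 1) / (‖z‖ ^ 2 + 1)], by
    have h : ‖z‖ ^ 2 = z.re ^ 2 + z.im ^ 2 := by
      rw [Complex.sq_norm, Complex.normSq_apply]; ring
    have h0 : ‖z‖ ^ 2 + 1 ≠ 0 := by positivity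
    rw [mem_sphere_zero_iff_norm, EuclideanSpace.norm_eq, Real.sqrt_eq_one]
    simp only [Fin.sum_univ_three, Real.norm_eq_abs, sq_abs,
      Matrix.cons_val_zero, Matrix.cons_val_one, Matrix.cons_val]
    field_simp
    rw [h]
    ring⟩

theorem stereoProj_invStereo (z : ℂ) : stereoProj (invStereo z) = z := by
  have h0 : ‖z‖ ^ 2 + 1 ≠ 0 := by positivity
  have h1 : (‖z‖ : ℂ) ^ 2 + 1 ≠ 0 := by exact_mod_cast h0
  simp only [stereoProj, invStereo, PiLp.toLp_apply, Matrix.cons_val_zero, Matrix.cons_val_one,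
    Matrix.cons_val]
  push_cast
  have h2 : (1 : ℂ) - ((‖z‖ : ℂ) ^ 2 - 1) / ((‖z‖ : ℂ) ^ 2 + 1) = 2 / ((‖z‖ : ℂ) ^ 2 + 1) := by
    field_simp
    ring
  rw [h2]
  field_simp
  conv_rhs => rw [← Complex.re_add_im z]
  ring

/-- The `N`-point configuration on `S²` that is obtained from the eigenvalues of `A⁻¹ B`
(with multiplicity) through the stereographic projection. -/
def sphericalConfig {N : ℕ} (A B : Matrix (Fin N) (Fin N) ℂ) : Multiset (Sph 2) :=
  (A⁻¹ * B).charpoly.roots.map invStereo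

end

/-! Everything follows from one explicit bound, `numberVariance_le`: for N ≥ 2 and |φ| ≤ π/2 the
number variance is at most √N · sin |φ|. For fixed φ this is o(N). Since sin² φ is at most four
times the cap area σ, it is at most 2√(Nσ), which is o(Nσ) when Nσ → ∞. For φ = t N^(-1/2) it is at
most t.

Let X be the number of points in the cap. For each fixed configuration, averaging over the centre
gives exactly Nσ, and X² = N X - X (N - X). Hence the variance equals N²σ(1 - σ) - E[X (N - X)], and
only a lower bound for the expected number of pairs separated by the cap is needed. Relative to the
uniform measure the pair density is N² (1 - ρ^(N-1)), where ρ is `overlap`, that is (1 + ⟨x, y⟩)/2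
on the sphere. The constant term cancels N²σ(1 - σ). In the other term the average over centres
becomes the area of a difference of two caps, at most sin φ · √(1 - ρ) by `sphMeasure_cap_diff_le`.
As ρ is uniform on (0, 1) for a uniform second point (`lintegral_stereoMeasure_overlap`), the error
is at most N² sin φ ∫ √(1 - r) r^(N-1) dr ≤ √N sin φ.

The pair density is bounded below by deflating twice (`deflation_le`), without the joint density of
all eigenvalues. Fix A and all rows of B but the first, and parametrise the first row by an
eigenvalue z and a left eigenvector (1, u) of the pencil zA - B. The Jacobian is the squared modulus
of a determinant. A unitary matrix on the left turns (1, u) to the first basis vector, and one on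
the right does the same for the first row of A. The pencil is then block triangular, with a Gaussian
pair one size smaller in the corner and weight |det(zA' - B')|². Only a lower bound is required, so
the area formula is used as the inequality `lintegral_det_mul_le`, and eigenvectors missed by the
chart do no harm.

After both deflations there remains |z - w|² E |det(zA - B)|² |det(wA - B)|². Unitary mixing of A
and B makes this a joint moment of det x and det(p x + q b) for independent Gaussian x and b. The
recursion `detCorr_succ` evaluates it, exchanging the mixed rows one at a time. -/

/-! ### Gaussian vectors and matrices -/

/-- Tonelli's theorem for one coordinate of a finite power of a measure. -/
theorem lintegral_pi_insertNth {α : Type*} [MeasurableSpace α] (μ : Measure α) [SigmaFinite μ]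
    {n : ℕ} (i : Fin (n + 1)) (f : (Fin (n + 1) → α) → ENNReal) (hf : Measurable f) :
    ∫⁻ x, f x ∂Measure.pi (fun _ => μ) =
      ∫⁻ a, ∫⁻ x, f (i.insertNth a x) ∂Measure.pi (fun _ => μ) ∂μ := by
  have hmp := (measurePreserving_piFinSuccAbove (fun _ : Fin (n + 1) => μ) i).symm
  rw [← hmp.lintegral_comp hf]
  exact lintegral_prod _ (hf.comp hmp.measurable).aemeasurable

theorem lintegral_pi_cons {α : Type*} [MeasurableSpace α] (μ : Measure α) [SigmaFinite μ]
    {n : ℕ} (f : (Fin (n + 1) → α) → ENNReal) (hf : Measurable f) :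
    ∫⁻ x, f x ∂Measure.pi (fun _ => μ) =
      ∫⁻ a, ∫⁻ x, f (Fin.cons a x) ∂Measure.pi (fun _ => μ) ∂μ := by
  rw [lintegral_pi_insertNth μ 0 f hf]
  simp_rw [Fin.insertNth_zero']

theorem lintegral_pi_prod {α : Type*} [MeasurableSpace α] (μ : Measure α) [SigmaFinite μ]
    {n : ℕ} (f : Fin n → α → ENNReal) (hf : ∀ i, Measurable (f i)) :
    ∫⁻ x, ∏ i, f i (x i) ∂Measure.pi (fun _ => μ) = ∏ i, ∫⁻ a, f i a ∂μ := by
  induction n with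
  | zero => simp
  | succ n ih =>
    have hm : ∀ {k : ℕ} (g : Fin k → α → ENNReal), (∀ i, Measurable (g i)) →
        Measurable fun x : Fin k → α => ∏ i, g i (x i) := fun g hg =>
      Finset.measurable_prod _ fun i _ => (hg i).comp (measurable_pi_apply i)
    rw [lintegral_pi_cons μ _ (hm f hf)]
    simp_rw [Fin.prod_univ_succ, Fin.cons_zero, Fin.cons_succ]
    simp_rw [lintegral_const_mul _ (hm (fun i => f i.succ) fun i => hf _),
      ih (fun i => f i.succ) fun i => hf _]
    rw [lintegral_mul_const _ (hf 0)]

theorem pi_withDensity {α : Type*} [MeasurableSpace α] {n : ℕ}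
    (μ : Measure α) [SigmaFinite μ] (f : α → ENNReal)
    (hf : Measurable f) [SigmaFinite (μ.withDensity f)] :
    Measure.pi (fun _ : Fin n => μ.withDensity f) =
      (Measure.pi fun _ => μ).withDensity fun x => ∏ i, f (x i) := by
  refine Measure.pi_eq fun s hs => ?_
  rw [withDensity_apply _ (MeasurableSet.univ_pi hs), ← lintegral_indicator (MeasurableSet.univ_pi hs)]
  have h : ∀ x : Fin n → α, (Set.univ.pi s).indicator (fun x => ∏ i, f (x i)) x =
      ∏ i, (s i).indicator f (x i) := by
    intro x
    by_cases hx : x ∈ Set.univ.pi s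
    · rw [Set.indicator_of_mem hx]
      exact Finset.prod_congr rfl fun i _ => (Set.indicator_of_mem (hx i trivial) _).symm
    · rw [Set.indicator_of_notMem hx]
      simp only [Set.mem_univ_pi, not_forall] at hx
      obtain ⟨i, hi⟩ := hx
      exact (Finset.prod_eq_zero (Finset.mem_univ i) (Set.indicator_of_notMem hi _)).symm
  simp_rw [h, withDensity_apply _ (hs _), ← lintegral_indicator (hs _)]
  exact lintegral_pi_prod _ _ fun i => hf.indicator (hs i)

/-- The sum of the squared absolute values of the entries. -/
noncomputable def nsq {ι : Type*} [Fintype ι] (x : ι → ℂ) : ℝ := ∑ i, ‖x i‖ ^ 2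

/-- The density of the standard complex Gaussian vector. -/
noncomputable def vecDensity {ι : Type*} [Fintype ι] (x : ι → ℂ) : ENNReal :=
  ENNReal.ofReal (Real.exp (-nsq x) / Real.pi ^ Fintype.card ι)

/-- The law of a vector of independent standard complex Gaussians. -/
noncomputable abbrev gaussVec (n : ℕ) : Measure (Fin n → ℂ) :=
  Measure.pi fun _ => complexGaussian

/-- The law of `m` independent Gaussian rows of length `n`. -/
noncomputable abbrev gaussMat (m n : ℕ) : Measure (Fin m → Fin n → ℂ) :=
  Measure.pi fun _ => gaussVec n

section
variable {ι : Type*} [Fintype ι]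

theorem nsq_nonneg (x : ι → ℂ) : 0 ≤ nsq x := Finset.sum_nonneg fun _ _ => by positivity

theorem nsq_eq_zero {x : ι → ℂ} : nsq x = 0 ↔ x = 0 := by
  unfold nsq
  rw [Finset.sum_eq_zero_iff_of_nonneg fun _ _ => by positivity]
  simp [funext_iff]

theorem continuous_nsq : Continuous (nsq : (ι → ℂ) → ℝ) := by unfold nsq; fun_prop

theorem nsq_smul (c : ℂ) (x : ι → ℂ) : nsq (c • x) = ‖c‖ ^ 2 * nsq x := by
  simp [nsq, mul_pow, Finset.mul_sum]

theorem nsq_eq_norm (x : ι → ℂ) : nsq x = ‖WithLp.toLp 2 x‖ ^ 2 := by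
  rw [EuclideanSpace.norm_sq_eq]; rfl

theorem ofReal_nsq (x : ι → ℂ) : (nsq x : ℂ) = dotProduct x (star x) := by
  simp [nsq, dotProduct, Complex.mul_conj, Complex.normSq_eq_norm_sq]

theorem continuous_vecDensity : Continuous (vecDensity : (ι → ℂ) → ENNReal) := by
  unfold vecDensity
  exact ENNReal.continuous_ofReal.comp
    ((Real.continuous_exp.comp continuous_nsq.neg).div_const _)

theorem prod_gaussianDensity (x : ι → ℂ) :
    ∏ i, ENNReal.ofReal (Real.exp (-‖x i‖ ^ 2) / Real.pi) = vecDensity x := by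
  rw [← ENNReal.ofReal_prod_of_nonneg fun _ _ => by positivity, vecDensity,
    Finset.prod_div_distrib, ← Real.exp_sum]
  simp [nsq]

end

theorem gaussVec_eq (n : ℕ) : gaussVec n = volume.withDensity vecDensity := by
  have : SigmaFinite ((volume : Measure ℂ).withDensity
      fun z => ENNReal.ofReal (Real.exp (-‖z‖ ^ 2) / Real.pi)) :=
    inferInstanceAs (SigmaFinite complexGaussian)
  rw [gaussVec]
  unfold complexGaussian
  rw [pi_withDensity _ _ (by fun_prop)]
  simp_rw [prod_gaussianDensity]
  rfl

theorem gaussMat_eq (m n : ℕ) :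
    gaussMat m n = volume.withDensity fun M => ∏ i, vecDensity (M i) := by
  have : SigmaFinite ((volume : Measure (Fin n → ℂ)).withDensity vecDensity) := by
    rw [← gaussVec_eq]; infer_instance
  rw [gaussMat]
  simp_rw [gaussVec_eq]
  rw [pi_withDensity _ _ continuous_vecDensity.measurable]
  rfl

theorem lintegral_gaussVec {n : ℕ} (f : (Fin n → ℂ) → ENNReal) :
    ∫⁻ x, f x ∂gaussVec n = ∫⁻ x, vecDensity x * f x := by
  rw [gaussVec_eq, lintegral_withDensity_eq_lintegral_mul_non_measurable _
    continuous_vecDensity.measurable (.of_forall fun _ => ENNReal.ofReal_lt_top)]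
  rfl

theorem measurable_prod_vecDensity (m n : ℕ) :
    Measurable fun M : Fin m → Fin n → ℂ => ∏ i, vecDensity (M i) :=
  Finset.measurable_prod _ fun i _ =>
    (continuous_vecDensity.comp (continuous_apply i)).measurable

theorem lintegral_gaussMat {m n : ℕ} (f : (Fin m → Fin n → ℂ) → ENNReal) :
    ∫⁻ x, f x ∂gaussMat m n = ∫⁻ x, (∏ i, vecDensity (x i)) * f x := by
  rw [gaussMat_eq, lintegral_withDensity_eq_lintegral_mul_non_measurable _
    (measurable_prod_vecDensity m n) 
    (.of_forall fun _ => ENNReal.prod_lt_top fun _ _ => ENNReal.ofReal_lt_top)]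
  rfl

theorem lintegral_complexGaussian (f : ℂ → ENNReal) :
    ∫⁻ x, f x ∂complexGaussian =
      ∫⁻ x, ENNReal.ofReal (Real.exp (-‖x‖ ^ 2) / Real.pi) * f x := by
  rw [complexGaussian, lintegral_withDensity_eq_lintegral_mul_non_measurable _
    (by fun_prop) (.of_forall fun _ => ENNReal.ofReal_lt_top)]
  rfl

/-! ### Invariance of Gaussian measures under unitary maps -/

instance isAddHaarMeasure_volume_rows (m n : ℕ) :
    (volume : Measure (Fin m → Fin n → ℂ)).IsAddHaarMeasure :=
  @Measure.pi.isAddHaarMeasure (Fin m) (fun _ => Fin n → ℂ) _ _ (fun _ => volume)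
    (fun _ => inferInstance) (fun _ => inferInstance) (fun _ => inferInstance)
    (fun _ => inferInstance) (fun _ => inferInstance)

instance measurableAdd_rows (m n : ℕ) : MeasurableAdd (Fin m → Fin n → ℂ) :=
  @Pi.measurableAdd (Fin m) (fun _ => Fin n → ℂ) _ _ fun _ => inferInstance

/-- A linear bijection that preserves the density of a probability measure preserves the
measure. -/
theorem measurePreserving_linear_of_density {E : Type*} [NormedAddCommGroup E] [NormedSpace ℝ E]
    [MeasurableSpace E] [BorelSpace E] [FiniteDimensional ℝ E] (μ : Measure E)
    [μ.IsAddHaarMeasure] (g : E → ENNReal) (hg : Measurable g)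
    [IsProbabilityMeasure (μ.withDensity g)] (T : E →ₗ[ℝ] E) (hT : LinearMap.det T ≠ 0)
    (hgT : ∀ x, g (T x) = g x) :
    MeasurePreserving T (μ.withDensity g) (μ.withDensity g) := by
  have hTm : Measurable T := T.continuous_of_finiteDimensional.measurable
  refine ⟨hTm, ?_⟩
  set c : ENNReal := ENNReal.ofReal |(LinearMap.det T)⁻¹|
  have h1 : Measure.map T (μ.withDensity g) = c • μ.withDensity g := by
    ext s hs
    rw [Measure.map_apply hTm hs, withDensity_apply _ (hTm hs), Measure.smul_apply,
      withDensity_apply _ hs, ← lintegral_indicator (hTm hs), ← lintegral_indicator hs]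
    have : ∀ x, (T ⁻¹' s).indicator g x = s.indicator g (T x) := fun x => by
      by_cases hx : T x ∈ s <;> simp [Set.indicator, hx, hgT]
    simp_rw [this]
    rw [← lintegral_map (hg.indicator hs) hTm, Measure.map_linearMap_addHaar_eq_smul_addHaar μ hT,
      lintegral_smul_measure]
  -- The Jacobian factor need not be computed: both sides are probability measures, which forces it
  -- to be 1.
  have h2 : c = 1 := by
    have : IsProbabilityMeasure (Measure.map T (μ.withDensity g)) :=
      Measure.isProbabilityMeasure_map hTm.aemeasurable
    have h3 := measure_univ (μ := Measure.map T (μ.withDensity g))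
    rw [h1, Measure.smul_apply, measure_univ, smul_eq_mul, mul_one] at h3
    exact h3
  rw [h1, h2, one_smul]

theorem det_restrictScalars_ne_zero {E : Type*} [NormedAddCommGroup E] [NormedSpace ℂ E]
    [FiniteDimensional ℂ E] (T : E →ₗ[ℂ] E) (hT : Function.Injective T) :
    LinearMap.det (T.restrictScalars ℝ) ≠ 0 := by
  have : FiniteDimensional ℝ E := FiniteDimensional.complexToReal E
  have := (LinearEquiv.ofInjectiveEndo (T.restrictScalars ℝ) hT).isUnit_det'
  exact this.ne_zero

/-- The real Jacobian of a complex linear map is the squared modulus of its complex determinant; all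
the weights |det|² below arise in this way. -/
theorem abs_det_restrictScalars {E : Type*} [AddCommGroup E] [Module ℂ E] [Module.Free ℂ E]
    (T : E →ₗ[ℂ] E) :
    |LinearMap.det (T.restrictScalars ℝ)| = ‖LinearMap.det T‖ ^ 2 := by
  have h := LinearMap.det_restrictScalars (R := ℝ) (f := T)
  rw [h, Algebra.norm_complex_eq]
  simp [Complex.normSq_eq_norm_sq]

open Matrix in
theorem nsq_vecMul_unitary {ι : Type*} [Fintype ι] [DecidableEq ι] {W : Matrix ι ι ℂ}
    (hW : W ∈ Matrix.unitaryGroup ι ℂ) (x : ι → ℂ) : nsq (x ᵥ* W) = nsq x := by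
  have : ((nsq (x ᵥ* W) : ℝ) : ℂ) = nsq x := by
    rw [ofReal_nsq, ofReal_nsq, Matrix.star_vecMul, ← Matrix.dotProduct_mulVec]
    rw [Matrix.mulVec_mulVec, ← Matrix.star_eq_conjTranspose, (Matrix.mem_unitaryGroup_iff).1 hW,
      Matrix.one_mulVec]
  exact_mod_cast this

open Matrix in
theorem nsq_mulVec_unitary {ι : Type*} [Fintype ι] [DecidableEq ι] {W : Matrix ι ι ℂ}
    (hW : W ∈ Matrix.unitaryGroup ι ℂ) (x : ι → ℂ) : nsq (W *ᵥ x) = nsq x := by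
  rw [← Matrix.vecMul_transpose]
  exact nsq_vecMul_unitary (by
    rw [Matrix.mem_unitaryGroup_iff, ← Matrix.transpose_one, ← (Matrix.mem_unitaryGroup_iff').1 hW]
    rw [Matrix.transpose_mul, Matrix.star_eq_conjTranspose, Matrix.star_eq_conjTranspose]
    rfl) x

open Matrix in
theorem measurePreserving_vecMul {n : ℕ} {W : Matrix (Fin n) (Fin n) ℂ}
    (hW : W ∈ Matrix.unitaryGroup (Fin n) ℂ) :
    MeasurePreserving (fun x => x ᵥ* W) (gaussVec n) (gaussVec n) := by
  have hp : IsProbabilityMeasure ((volume : Measure (Fin n → ℂ)).withDensity vecDensity) := by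
    rw [← gaussVec_eq]; infer_instance
  rw [gaussVec_eq]
  refine measurePreserving_linear_of_density volume vecDensity continuous_vecDensity.measurable
    (W.vecMulLinear.restrictScalars ℝ) (det_restrictScalars_ne_zero _ ?_) fun x => ?_
  · intro x y hxy
    have := nsq_vecMul_unitary hW (x - y)
    rw [Matrix.sub_vecMul, show x ᵥ* W = y ᵥ* W from hxy, sub_self] at this
    exact sub_eq_zero.1 (nsq_eq_zero.1 (this.symm.trans (nsq_eq_zero.2 rfl)))
  · simp [vecDensity, nsq_vecMul_unitary hW]

open Matrix in
theorem measurePreserving_rows_vecMul {m n : ℕ} {W : Matrix (Fin n) (Fin n) ℂ}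
    (hW : W ∈ Matrix.unitaryGroup (Fin n) ℂ) :
    MeasurePreserving (fun (M : Fin m → Fin n → ℂ) i => M i ᵥ* W) (gaussMat m n) (gaussMat m n) :=
  measurePreserving_pi _ _ fun _ => measurePreserving_vecMul hW

theorem prod_vecDensity {m n : ℕ} (M : Fin m → Fin n → ℂ) :
    ∏ i, vecDensity (M i) =
      ENNReal.ofReal (Real.exp (-∑ i, nsq (M i)) / Real.pi ^ (n * m)) := by
  unfold vecDensity
  rw [← ENNReal.ofReal_prod_of_nonneg fun _ _ => by positivity, Finset.prod_div_distrib,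
    ← Real.exp_sum]
  simp [pow_mul]

theorem sum_nsq_comm {m n : ℕ} (M : Fin m → Fin n → ℂ) :
    ∑ i, nsq (M i) = ∑ j, nsq fun i => M i j := by
  unfold nsq; exact Finset.sum_comm

/-- Left multiplication of a family of rows by a matrix. -/
def lmul {m n : ℕ} {l : Type*} (U : Matrix l (Fin m) ℂ) (M : Fin m → Fin n → ℂ) : l → Fin n → ℂ :=
  fun i => ∑ k, U i k • M k

theorem lmul_eq {m n : ℕ} {l : Type*} (U : Matrix l (Fin m) ℂ) (M : Fin m → Fin n → ℂ) :
    Matrix.of (lmul U M) = U * Matrix.of M := by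
  ext i j
  simp [lmul, Matrix.mul_apply]

open Matrix in
theorem lmul_col {m n : ℕ} {l : Type*} (U : Matrix l (Fin m) ℂ) (M : Fin m → Fin n → ℂ)
    (j : Fin n) : (fun i => lmul U M i j) = U *ᵥ fun i => M i j := by
  ext i
  simp [lmul, Matrix.mulVec, dotProduct]

theorem sum_nsq_lmul_unitary {m n : ℕ} {U : Matrix (Fin m) (Fin m) ℂ}
    (hU : U ∈ Matrix.unitaryGroup (Fin m) ℂ) (M : Fin m → Fin n → ℂ) :
    ∑ i, nsq (lmul U M i) = ∑ i, nsq (M i) := by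
  rw [sum_nsq_comm, sum_nsq_comm M]
  exact Finset.sum_congr rfl fun j _ => by rw [lmul_col, nsq_mulVec_unitary hU]

/-- `lmul` as a linear map. -/
def lmulLinear {m : ℕ} (n : ℕ) (U : Matrix (Fin m) (Fin m) ℂ) :
    (Fin m → Fin n → ℂ) →ₗ[ℂ] (Fin m → Fin n → ℂ) where
  toFun := lmul U
  map_add' A B := by ext i j; simp [lmul, Finset.sum_add_distrib]
  map_smul' c A := by ext i j; simp [lmul, Finset.mul_sum, mul_left_comm]

theorem measurePreserving_lmul {m n : ℕ} {U : Matrix (Fin m) (Fin m) ℂ}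
    (hU : U ∈ Matrix.unitaryGroup (Fin m) ℂ) :
    MeasurePreserving (lmul U) (gaussMat m n) (gaussMat m n) := by
  have hp : IsProbabilityMeasure ((volume : Measure (Fin m → Fin n → ℂ)).withDensity
      fun M => ∏ i, vecDensity (M i)) := by
    rw [← gaussMat_eq]; infer_instance
  rw [gaussMat_eq]
  refine measurePreserving_linear_of_density volume _
    (measurable_prod_vecDensity m n) ((lmulLinear n U).restrictScalars ℝ)
    (det_restrictScalars_ne_zero _ ?_) fun x => ?_
  · refine (injective_iff_map_eq_zero (lmulLinear n U)).2 fun x hx => ?_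
    have h := sum_nsq_lmul_unitary hU x
    rw [show lmul U x = 0 from hx] at h
    ext1 i
    have h0 : ∑ i, nsq (x i) = 0 := by rw [← h]; simp [nsq]
    exact nsq_eq_zero.1 ((Finset.sum_eq_zero_iff_of_nonneg fun i _ => nsq_nonneg (x i)).1 h0 i
      (Finset.mem_univ i))
  · rw [prod_vecDensity, prod_vecDensity]
    exact congrArg (fun t => ENNReal.ofReal (Real.exp (-t) / Real.pi ^ (n * m)))
      (sum_nsq_lmul_unitary hU x)

/-- A pair of independent Gaussian matrices is invariant under unitary mixing. -/
theorem measurePreserving_mix {m n : ℕ} {a b c d : ℂ}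
    (h : ∀ z w : ℂ, ‖a * z + b * w‖ ^ 2 + ‖c * z + d * w‖ ^ 2 = ‖z‖ ^ 2 + ‖w‖ ^ 2) :
    MeasurePreserving (fun p : (Fin m → Fin n → ℂ) × (Fin m → Fin n → ℂ) =>
      (a • p.1 + b • p.2, c • p.1 + d • p.2)) ((gaussMat m n).prod (gaussMat m n))
      ((gaussMat m n).prod (gaussMat m n)) := by
  have hm := measurable_prod_vecDensity m n
  have hE : (gaussMat m n).prod (gaussMat m n) = (volume.prod volume).withDensity
      fun p : (Fin m → Fin n → ℂ) × (Fin m → Fin n → ℂ) =>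
        (∏ i, vecDensity (p.1 i)) * ∏ i, vecDensity (p.2 i) := by
    rw [gaussMat_eq, prod_withDensity hm hm]
  have hp : IsProbabilityMeasure (((volume : Measure (Fin m → Fin n → ℂ)).prod
      (volume : Measure (Fin m → Fin n → ℂ))).withDensity
      fun p => (∏ i, vecDensity (p.1 i)) * ∏ i, vecDensity (p.2 i)) := by
    rw [← hE]; infer_instance
  have key : ∀ A B : Fin m → Fin n → ℂ, ∑ i, nsq ((a • A + b • B) i) +
      ∑ i, nsq ((c • A + d • B) i) = ∑ i, nsq (A i) + ∑ i, nsq (B i) := by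
    intro A B
    simp only [nsq, ← Finset.sum_add_distrib]
    exact Finset.sum_congr rfl fun i _ => Finset.sum_congr rfl fun j _ => h _ _
  rw [hE]
  have : ((volume : Measure (Fin m → Fin n → ℂ)).prod
      (volume : Measure (Fin m → Fin n → ℂ))).IsAddHaarMeasure :=
    Measure.prod.instIsAddHaarMeasure _ _
  let T : (Fin m → Fin n → ℂ) × (Fin m → Fin n → ℂ) →ₗ[ℂ]
      (Fin m → Fin n → ℂ) × (Fin m → Fin n → ℂ) :=
    LinearMap.prod (a • LinearMap.fst ℂ _ _ + b • LinearMap.snd ℂ _ _)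
      (c • LinearMap.fst ℂ _ _ + d • LinearMap.snd ℂ _ _)
  refine measurePreserving_linear_of_density ((volume : Measure (Fin m → Fin n → ℂ)).prod
      (volume : Measure (Fin m → Fin n → ℂ))) (fun p => (∏ i, vecDensity (p.1 i)) *
      ∏ i, vecDensity (p.2 i)) ((hm.comp measurable_fst).mul (hm.comp measurable_snd)) (T.restrictScalars ℝ)
    (det_restrictScalars_ne_zero _ ?_) fun x => ?_
  · refine (injective_iff_map_eq_zero T).2 fun x hx => ?_
    have h1 : a • x.1 + b • x.2 = 0 := congrArg Prod.fst hx
    have h2 : c • x.1 + d • x.2 = 0 := congrArg Prod.snd hx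
    have hz : ∀ i j, ‖x.1 i j‖ ^ 2 + ‖x.2 i j‖ ^ 2 = 0 := by
      intro i j
      rw [← h]
      have e1 := congrFun (congrFun h1 i) j
      have e2 := congrFun (congrFun h2 i) j
      simp only [Pi.add_apply, Pi.smul_apply, smul_eq_mul, Pi.zero_apply] at e1 e2
      simp [e1, e2]
    ext i j
    · have := hz i j
      have h3 : ‖x.1 i j‖ ^ 2 = 0 := by nlinarith [sq_nonneg ‖x.1 i j‖, sq_nonneg ‖x.2 i j‖]
      simpa using h3
    · have := hz i j
      have h3 : ‖x.2 i j‖ ^ 2 = 0 := by nlinarith [sq_nonneg ‖x.1 i j‖, sq_nonneg ‖x.2 i j‖]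
      simpa using h3
  · change (∏ i, vecDensity ((a • x.1 + b • x.2) i)) * (∏ i, vecDensity ((c • x.1 + d • x.2) i)) =
      (∏ i, vecDensity (x.1 i)) * ∏ i, vecDensity (x.2 i)
    simp_rw [prod_vecDensity]
    rw [← ENNReal.ofReal_mul (by positivity), ← ENNReal.ofReal_mul (by positivity),
      div_mul_div_comm, div_mul_div_comm, ← Real.exp_add, ← Real.exp_add, ← neg_add, ← neg_add,
      key]

open Matrix in
/-- Every vector is mapped by a unitary matrix to a multiple of the first basis vector. -/
theorem exists_unitary_vecMul {n : ℕ} (x : Fin (n + 1) → ℂ) :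
    ∃ W ∈ Matrix.unitaryGroup (Fin (n + 1)) ℂ,
      x ᵥ* W = Pi.single 0 ((Real.sqrt (nsq x) : ℝ) : ℂ) := by
  by_cases hx : x = 0
  · exact ⟨1, one_mem _, by simp [hx, nsq]⟩
  have hpos : 0 < nsq x := lt_of_le_of_ne (nsq_nonneg x) fun h => hx (nsq_eq_zero.1 h.symm)
  set r : ℝ := Real.sqrt (nsq x)
  have hr : 0 < r := Real.sqrt_pos.2 hpos
  have hr2 : r ^ 2 = nsq x := Real.sq_sqrt hpos.le
  -- The first column of W has to be the conjugate of x / |x|, because `vecMul` pairs x with the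
  -- columns without conjugation.
  let y : EuclideanSpace ℂ (Fin (n + 1)) := WithLp.toLp 2 ((r⁻¹ : ℂ) • star x)
  have hy : ‖y‖ = 1 := by
    have : nsq ((r⁻¹ : ℂ) • star x) = 1 := by
      rw [nsq_smul]
      have : nsq (star x) = nsq x := by simp [nsq]
      rw [this, ← hr2]
      simp [hr.ne']
    rw [nsq_eq_norm] at this
    exact (pow_eq_one_iff_of_nonneg (norm_nonneg _) two_ne_zero).1 this
  obtain ⟨b, hb⟩ := Orthonormal.exists_orthonormalBasis_extension_of_card_eq (𝕜 := ℂ)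
    (E := EuclideanSpace ℂ (Fin (n + 1))) (ι := Fin (n + 1)) (by simp)
    (v := fun _ => y) (s := {0}) (by
      rw [orthonormal_iff_ite]
      rintro ⟨i, hi⟩ ⟨j, hj⟩
      simp only [Set.mem_singleton_iff] at hi hj
      subst hi; subst hj
      simp [Set.domRestrict, inner_self_eq_norm_sq_to_K, hy])
  have hb0 : b 0 = y := hb 0 rfl
  let W : Matrix (Fin (n + 1)) (Fin (n + 1)) ℂ := Matrix.of fun i j => b j i
  have hxb : ∀ j, (x ᵥ* W) j = r * inner ℂ y (b j) := by
    intro j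
    simp only [Matrix.vecMul, dotProduct, W, Matrix.of_apply, y, PiLp.inner_apply,
      Finset.mul_sum]
    refine Finset.sum_congr rfl fun i _ => ?_
    have : (r : ℂ) ≠ 0 := by exact_mod_cast hr.ne'
    simp
    field_simp
  refine ⟨W, ?_, ?_⟩
  · rw [Matrix.mem_unitaryGroup_iff']
    ext i j
    have := (orthonormal_iff_ite.1 b.orthonormal) i j
    rw [PiLp.inner_apply] at this
    simp only [Matrix.mul_apply, Matrix.star_apply, W, Matrix.of_apply, Matrix.one_apply]
    rw [← this]
    exact Finset.sum_congr rfl fun k _ => by simp [mul_comm]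
  · ext j
    rw [hxb, ← hb0, (orthonormal_iff_ite.1 b.orthonormal)]
    by_cases hj : j = 0
    · subst hj; simp
    · simp [hj, Ne.symm hj]

/-! ### Radial integrals -/

/-- Polar coordinates followed by s = r²: since r dr = ds/2, the angle contributes 2π and the factor
is π. -/
theorem lintegral_normSq (g : ℝ → ENNReal) (hg : Measurable g) :
    ∫⁻ z : ℂ, g (‖z‖ ^ 2) = ENNReal.ofReal Real.pi * ∫⁻ s in Set.Ioi 0, g s := by
  have himg : (fun r : ℝ => r ^ 2) '' Set.Ioi 0 = Set.Ioi 0 := by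
    ext s
    constructor
    · rintro ⟨r, hr, rfl⟩
      exact pow_pos (Set.mem_Ioi.1 hr) 2
    · intro hs
      exact ⟨Real.sqrt s, Real.sqrt_pos.2 hs, Real.sq_sqrt (le_of_lt hs)⟩
  have h1 : ∫⁻ s in Set.Ioi (0 : ℝ), g s =
      ∫⁻ r in Set.Ioi (0 : ℝ), ENNReal.ofReal 2 * (ENNReal.ofReal r * g (r ^ 2)) := by
    conv_lhs => rw [← himg]
    rw [lintegral_image_eq_lintegral_abs_deriv_mul measurableSet_Ioi (f' := fun r => 2 * r)
      (fun r _ => by simpa using (hasDerivAt_pow 2 r).hasDerivWithinAt)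
      (fun a ha b hb hab => (pow_left_inj₀ (le_of_lt ha) (le_of_lt hb) two_ne_zero).1 hab)]
    refine setLIntegral_congr_fun measurableSet_Ioi fun r hr => ?_
    have hr0 : (0 : ℝ) ≤ r := le_of_lt hr
    rw [abs_of_nonneg (by positivity), ENNReal.ofReal_mul zero_le_two, mul_assoc]
  have hm : Measurable fun r : ℝ => ENNReal.ofReal r * g (r ^ 2) := by fun_prop
  rw [h1, lintegral_const_mul _ hm, ← Complex.lintegral_comp_polarCoord_symm]
  have h2 : ∀ p : ℝ × ℝ, ENNReal.ofReal p.1 • g (‖Complex.polarCoord.symm p‖ ^ 2) =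
      ENNReal.ofReal p.1 * g (p.1 ^ 2) * 1 := fun p => by simp
  simp_rw [h2]
  rw [polarCoord_target, Measure.volume_eq_prod, ← Measure.prod_restrict,
    lintegral_prod_mul hm.aemeasurable aemeasurable_const]
  simp only [lintegral_const, one_mul, Measure.restrict_apply MeasurableSet.univ, Set.univ_inter,
    Real.volume_Ioo]
  rw [← mul_assoc, mul_comm, ← ENNReal.ofReal_mul Real.pi_pos.le]
  congr 2
  ring

theorem lintegral_pow_mul_exp (j : ℕ) {t : ℝ} (ht : 0 < t) :
    ∫⁻ s in Set.Ioi (0 : ℝ), ENNReal.ofReal (s ^ j * Real.exp (-(t * s))) =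
      ENNReal.ofReal (j.factorial / t ^ (j + 1)) := by
  have h := Real.integral_rpow_mul_exp_neg_mul_Ioi (a := j + 1) (r := t) (by positivity) ht
  simp only [add_sub_cancel_right, Real.rpow_natCast] at h
  have hval : (1 / t) ^ ((j : ℝ) + 1) * Real.Gamma (j + 1) = j.factorial / t ^ (j + 1) := by
    rw [Real.Gamma_nat_eq_factorial, ← Nat.cast_succ, Real.rpow_natCast, one_div, inv_pow]
    field_simp
  rw [hval] at h
  rw [← h, ofReal_integral_eq_lintegral_ofReal]
  · by_contra hc
    rw [integral_undef hc] at h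
    exact absurd h (by positivity)
  · filter_upwards [self_mem_ae_restrict measurableSet_Ioi] with s hs
    have : (0 : ℝ) ≤ s := le_of_lt hs
    positivity

theorem lintegral_gaussian_radial (j : ℕ) {c : ℝ} (hc : 0 ≤ c) :
    ∫⁻ z, ENNReal.ofReal (Real.exp (-(c * ‖z‖ ^ 2)) * (‖z‖ ^ 2) ^ j) ∂complexGaussian =
      ENNReal.ofReal (j.factorial / (1 + c) ^ (j + 1)) := by
  rw [lintegral_complexGaussian]
  have h : ∀ z : ℂ, ENNReal.ofReal (Real.exp (-‖z‖ ^ 2) / Real.pi) *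
      ENNReal.ofReal (Real.exp (-(c * ‖z‖ ^ 2)) * (‖z‖ ^ 2) ^ j) =
      ENNReal.ofReal Real.pi⁻¹ *
        ENNReal.ofReal ((‖z‖ ^ 2) ^ j * Real.exp (-((1 + c) * ‖z‖ ^ 2))) := by
    intro z
    rw [← ENNReal.ofReal_mul (by positivity), ← ENNReal.ofReal_mul (by positivity)]
    congr 1
    rw [show -((1 + c) * ‖z‖ ^ 2) = -‖z‖ ^ 2 + -(c * ‖z‖ ^ 2) by ring, Real.exp_add]
    ring
  simp_rw [h]
  rw [lintegral_const_mul _ (by fun_prop), lintegral_normSq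
    (fun s => ENNReal.ofReal (s ^ j * Real.exp (-((1 + c) * s)))) (by fun_prop),
    lintegral_pow_mul_exp _ (by positivity), ← mul_assoc, ← ENNReal.ofReal_mul (by positivity),
    inv_mul_cancel₀ Real.pi_ne_zero, ENNReal.ofReal_one, one_mul]

theorem lintegral_exp_nsq (n : ℕ) {s : ℝ} (hs : 0 < s) :
    ∫⁻ u : Fin n → ℂ, ENNReal.ofReal (Real.exp (-(s * nsq u))) =
      ENNReal.ofReal ((Real.pi / s) ^ n) := by
  have h : ∀ u : Fin n → ℂ, ENNReal.ofReal (Real.exp (-(s * nsq u))) =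
      ∏ i, ENNReal.ofReal (Real.exp (-(s * ‖u i‖ ^ 2))) := by
    intro u
    rw [← ENNReal.ofReal_prod_of_nonneg fun _ _ => by positivity, ← Real.exp_sum, nsq,
      Finset.mul_sum, Finset.sum_neg_distrib]
  simp_rw [h]
  rw [volume_pi, lintegral_pi_prod _ (fun _ (z : ℂ) => ENNReal.ofReal (Real.exp (-(s * ‖z‖ ^ 2))))
    fun _ => by fun_prop, lintegral_normSq (fun t => ENNReal.ofReal (Real.exp (-(s * t))))
    (by fun_prop)]
  have := lintegral_pow_mul_exp 0 hs
  simp only [pow_zero, one_mul, Nat.factorial_zero, Nat.cast_one, zero_add, pow_one] at this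
  rw [this, ← ENNReal.ofReal_mul Real.pi_pos.le, Finset.prod_const, Finset.card_univ,
    Fintype.card_fin, ← ENNReal.ofReal_pow (by positivity)]
  congr 2
  ring

/-- The total mass of the eigenvector chart. -/
theorem lintegral_one_add_nsq (n : ℕ) :
    ∫⁻ u : Fin n → ℂ, ENNReal.ofReal (1 / (1 + nsq u) ^ (n + 1)) =
      ENNReal.ofReal (Real.pi ^ n / n.factorial) := by
  have hf : (0 : ℝ) < n.factorial := by exact_mod_cast n.factorial_pos
  -- The negative power is written as a Gamma integral over s. After exchanging the integrals, the
  -- one over u is Gaussian and its factor s^(-n) cancels s^n.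
  have h : ∀ u : Fin n → ℂ, ENNReal.ofReal (1 / (1 + nsq u) ^ (n + 1)) =
      ENNReal.ofReal (1 / n.factorial) * ∫⁻ s in Set.Ioi (0 : ℝ),
        ENNReal.ofReal (s ^ n * Real.exp (-((1 + nsq u) * s))) := by
    intro u
    have := nsq_nonneg u
    rw [lintegral_pow_mul_exp n (by linarith), ← ENNReal.ofReal_mul (by positivity)]
    congr 1
    field_simp
  simp_rw [h]
  have hns : Measurable (nsq : (Fin n → ℂ) → ℝ) := continuous_nsq.measurable
  have hm : Measurable (fun p : (Fin n → ℂ) × ℝ =>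
      ENNReal.ofReal (p.2 ^ n * Real.exp (-((1 + nsq p.1) * p.2)))) := by fun_prop
  rw [lintegral_const_mul _ (Measurable.lintegral_prod_right' hm),
    lintegral_lintegral_swap hm.aemeasurable]
  have h2 : ∀ s ∈ Set.Ioi (0 : ℝ), ∫⁻ u : Fin n → ℂ,
      ENNReal.ofReal (s ^ n * Real.exp (-((1 + nsq u) * s))) =
      ENNReal.ofReal (Real.pi ^ n) * ENNReal.ofReal (s ^ 0 * Real.exp (-(1 * s))) := by
    intro s hs
    have hs' : (0 : ℝ) < s := hs
    have : ∀ u : Fin n → ℂ, ENNReal.ofReal (s ^ n * Real.exp (-((1 + nsq u) * s))) =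
        ENNReal.ofReal (s ^ n * Real.exp (-s)) * ENNReal.ofReal (Real.exp (-(s * nsq u))) := by
      intro u
      rw [← ENNReal.ofReal_mul (by positivity), mul_assoc, ← Real.exp_add]
      congr 3
      ring
    simp_rw [this]
    rw [lintegral_const_mul _ (by fun_prop), lintegral_exp_nsq n hs',
      ← ENNReal.ofReal_mul (by positivity), ← ENNReal.ofReal_mul (by positivity)]
    congr 1
    field_simp
    rw [← mul_pow, mul_div_cancel₀ _ hs'.ne']
  rw [setLIntegral_congr_fun measurableSet_Ioi h2, lintegral_const_mul _ (by fun_prop),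
    lintegral_pow_mul_exp 0 one_pos, ← ENNReal.ofReal_mul (by positivity),
    ← ENNReal.ofReal_mul (by positivity)]
  congr 1
  simp
  field_simp

/-- Weighted moments of the squared length of a Gaussian vector. -/
theorem lintegral_gaussVec_nsq {c : ℝ} (hc : 0 ≤ c) (n : ℕ) :
    ∫⁻ x, ENNReal.ofReal (Real.exp (-(c * nsq x))) ∂gaussVec n =
      ENNReal.ofReal (1 / (1 + c) ^ n) ∧
    ∫⁻ x, ENNReal.ofReal (Real.exp (-(c * nsq x)) * nsq x) ∂gaussVec n =
      ENNReal.ofReal (n / (1 + c) ^ (n + 1)) ∧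
    ∫⁻ x, ENNReal.ofReal (Real.exp (-(c * nsq x)) * nsq x ^ 2) ∂gaussVec n =
      ENNReal.ofReal (n * (n + 1) / (1 + c) ^ (n + 2)) := by
  -- Splitting off one coordinate expands the powers of the squared length binomially, so the three
  -- moments have to be proved together. Later c = |z|², the exponent contributed by the density of
  -- a row z • a.
  induction n with
  | zero => simp [nsq]
  | succ n ih =>
    obtain ⟨i0, i1, i2⟩ := ih
    have hns : Measurable (nsq : (Fin n → ℂ) → ℝ) := continuous_nsq.measurable
    have hns' : Measurable (nsq : (Fin (n + 1) → ℂ) → ℝ) := continuous_nsq.measurable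
    have hcons : ∀ (a : ℂ) (x : Fin n → ℂ),
        nsq (Fin.cons a x : Fin (n + 1) → ℂ) = ‖a‖ ^ 2 + nsq x := by
      intro a x; simp [nsq, Fin.sum_univ_succ]
    have r0 := lintegral_gaussian_radial 0 hc
    have r1 := lintegral_gaussian_radial 1 hc
    have r2 := lintegral_gaussian_radial 2 hc
    simp only [pow_zero, mul_one, pow_one, Nat.factorial_zero, Nat.factorial_one, Nat.cast_one,
      zero_add, Nat.factorial_two, Nat.cast_ofNat] at r0 r1 r2
    have hexp : ∀ (a : ℂ) (x : Fin n → ℂ), Real.exp (-(c * (‖a‖ ^ 2 + nsq x))) =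
        Real.exp (-(c * ‖a‖ ^ 2)) * Real.exp (-(c * nsq x)) := by
      intro a x; rw [← Real.exp_add]; congr 1; ring
    refine ⟨?_, ?_, ?_⟩
    · rw [lintegral_pi_cons _ _ (by fun_prop)]
      simp_rw [hcons, hexp]
      have h : ∀ (a : ℂ) (x : Fin n → ℂ), ENNReal.ofReal (Real.exp (-(c * ‖a‖ ^ 2)) *
          Real.exp (-(c * nsq x))) = ENNReal.ofReal (Real.exp (-(c * ‖a‖ ^ 2))) *
          ENNReal.ofReal (Real.exp (-(c * nsq x))) := fun a x =>
        ENNReal.ofReal_mul (by positivity)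
      simp_rw [h]
      simp_rw [lintegral_const_mul _ (show Measurable fun x : Fin n → ℂ =>
        ENNReal.ofReal (Real.exp (-(c * nsq x))) by fun_prop), i0]
      rw [lintegral_mul_const _ (by fun_prop), r0, ← ENNReal.ofReal_mul (by positivity)]
      congr 1
      field_simp
      ring
    · rw [lintegral_pi_cons _ _ (by fun_prop)]
      simp_rw [hcons, hexp]
      have h : ∀ (a : ℂ) (x : Fin n → ℂ), ENNReal.ofReal (Real.exp (-(c * ‖a‖ ^ 2)) *
          Real.exp (-(c * nsq x)) * (‖a‖ ^ 2 + nsq x)) =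
          ENNReal.ofReal (Real.exp (-(c * ‖a‖ ^ 2)) * ‖a‖ ^ 2) *
            ENNReal.ofReal (Real.exp (-(c * nsq x))) +
          ENNReal.ofReal (Real.exp (-(c * ‖a‖ ^ 2))) *
            ENNReal.ofReal (Real.exp (-(c * nsq x)) * nsq x) := by
        intro a x
        have := nsq_nonneg x
        rw [← ENNReal.ofReal_mul (by positivity), ← ENNReal.ofReal_mul (by positivity),
          ← ENNReal.ofReal_add (by positivity) (by positivity)]
        congr 1; ring
      have hin : ∀ a : ℂ, ∫⁻ x, (ENNReal.ofReal (Real.exp (-(c * ‖a‖ ^ 2)) * ‖a‖ ^ 2) *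
            ENNReal.ofReal (Real.exp (-(c * nsq x))) +
          ENNReal.ofReal (Real.exp (-(c * ‖a‖ ^ 2))) *
            ENNReal.ofReal (Real.exp (-(c * nsq x)) * nsq x)) ∂gaussVec n =
          ENNReal.ofReal (Real.exp (-(c * ‖a‖ ^ 2)) * ‖a‖ ^ 2) *
            ENNReal.ofReal (1 / (1 + c) ^ n) + ENNReal.ofReal (Real.exp (-(c * ‖a‖ ^ 2))) *
            ENNReal.ofReal (n / (1 + c) ^ (n + 1)) := fun a => by
        rw [lintegral_add_left (by fun_prop), lintegral_const_mul _ (by fun_prop),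
          lintegral_const_mul _ (by fun_prop), i0, i1]
      simp_rw [h, hin]
      rw [lintegral_add_left (by fun_prop), lintegral_mul_const _ (by fun_prop),
        lintegral_mul_const _ (by fun_prop), r0, r1, ← ENNReal.ofReal_mul (by positivity),
        ← ENNReal.ofReal_mul (by positivity), ← ENNReal.ofReal_add (by positivity) (by positivity)]
      congr 1
      push_cast
      field_simp
      ring
    · rw [lintegral_pi_cons _ _ (by fun_prop)]
      simp_rw [hcons, hexp]
      have h : ∀ (a : ℂ) (x : Fin n → ℂ), ENNReal.ofReal (Real.exp (-(c * ‖a‖ ^ 2)) *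
          Real.exp (-(c * nsq x)) * (‖a‖ ^ 2 + nsq x) ^ 2) =
          ENNReal.ofReal (Real.exp (-(c * ‖a‖ ^ 2)) * (‖a‖ ^ 2) ^ 2) *
            ENNReal.ofReal (Real.exp (-(c * nsq x))) +
          (ENNReal.ofReal (2 * (Real.exp (-(c * ‖a‖ ^ 2)) * ‖a‖ ^ 2)) *
            ENNReal.ofReal (Real.exp (-(c * nsq x)) * nsq x) +
          ENNReal.ofReal (Real.exp (-(c * ‖a‖ ^ 2))) *
            ENNReal.ofReal (Real.exp (-(c * nsq x)) * nsq x ^ 2)) := by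
        intro a x
        have := nsq_nonneg x
        rw [← ENNReal.ofReal_mul (by positivity), ← ENNReal.ofReal_mul (by positivity),
          ← ENNReal.ofReal_mul (by positivity),
          ← ENNReal.ofReal_add (by positivity) (by positivity),
          ← ENNReal.ofReal_add (by positivity) (by positivity)]
        congr 1; ring
      simp_rw [h]
      have hin : ∀ a : ℂ, ∫⁻ x,
          (ENNReal.ofReal (Real.exp (-(c * ‖a‖ ^ 2)) * (‖a‖ ^ 2) ^ 2) *
            ENNReal.ofReal (Real.exp (-(c * nsq x))) +
          (ENNReal.ofReal (2 * (Real.exp (-(c * ‖a‖ ^ 2)) * ‖a‖ ^ 2)) *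
            ENNReal.ofReal (Real.exp (-(c * nsq x)) * nsq x) +
          ENNReal.ofReal (Real.exp (-(c * ‖a‖ ^ 2))) *
            ENNReal.ofReal (Real.exp (-(c * nsq x)) * nsq x ^ 2))) ∂gaussVec n =
          ENNReal.ofReal (Real.exp (-(c * ‖a‖ ^ 2)) * (‖a‖ ^ 2) ^ 2) *
            ENNReal.ofReal (1 / (1 + c) ^ n) +
          (ENNReal.ofReal (2 * (Real.exp (-(c * ‖a‖ ^ 2)) * ‖a‖ ^ 2)) *
            ENNReal.ofReal (n / (1 + c) ^ (n + 1)) +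
          ENNReal.ofReal (Real.exp (-(c * ‖a‖ ^ 2))) *
            ENNReal.ofReal (n * (n + 1) / (1 + c) ^ (n + 2))) := fun a => by
        rw [lintegral_add_left (by fun_prop), lintegral_add_left (by fun_prop),
          lintegral_const_mul _ (by fun_prop), lintegral_const_mul _ (by fun_prop),
          lintegral_const_mul _ (by fun_prop), i0, i1, i2]
      simp_rw [hin]
      have h2 : ∀ a : ℂ, ENNReal.ofReal (2 * (Real.exp (-(c * ‖a‖ ^ 2)) * ‖a‖ ^ 2)) =
          ENNReal.ofReal 2 * ENNReal.ofReal (Real.exp (-(c * ‖a‖ ^ 2)) * ‖a‖ ^ 2) := fun a =>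
        ENNReal.ofReal_mul zero_le_two
      simp_rw [h2]
      rw [lintegral_add_left (by fun_prop), lintegral_add_left (by fun_prop),
        lintegral_mul_const _ (by fun_prop), lintegral_mul_const _ (by fun_prop),
        lintegral_mul_const _ (by fun_prop), lintegral_const_mul _ (by fun_prop), r0, r1, r2,
        ← ENNReal.ofReal_mul (by positivity), ← ENNReal.ofReal_mul (by positivity),
        ← ENNReal.ofReal_mul (by positivity), ← ENNReal.ofReal_mul (by positivity),
        ← ENNReal.ofReal_add (by positivity) (by positivity),
        ← ENNReal.ofReal_add (by positivity) (by positivity)]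
      congr 1
      push_cast
      field_simp
      ring

/-! ### Moments of Gaussian determinants -/

/-- The squared absolute value of the determinant of the matrix with the given rows. -/
noncomputable def detSq {n : ℕ} (M : Fin n → Fin n → ℂ) : ENNReal :=
  ‖(Matrix.of M).det‖ₑ ^ 2

theorem continuous_det_of {n : ℕ} :
    Continuous fun M : Fin n → Fin n → ℂ => (Matrix.of M).det :=
  Continuous.matrix_det (A := fun M : Fin n → Fin n → ℂ => Matrix.of M) continuous_id

theorem measurable_detSq {n : ℕ} : Measurable (detSq : (Fin n → Fin n → ℂ) → ENNReal) :=
  (continuous_det_of.measurable.enorm).pow_const 2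

@[fun_prop]
theorem Measurable.detSq {α : Type*} [MeasurableSpace α] {n : ℕ} {f : α → Fin n → Fin n → ℂ}
    (hf : Measurable f) : Measurable fun x => detSq (f x) := measurable_detSq.comp hf

theorem enorm_det_unitary {n : ℕ} {W : Matrix (Fin n) (Fin n) ℂ}
    (hW : W ∈ Matrix.unitaryGroup (Fin n) ℂ) : ‖W.det‖ₑ = 1 := by
  have h := (Matrix.det_of_mem_unitary hW)
  rw [← ofReal_norm, CStarRing.norm_of_mem_unitary h, ENNReal.ofReal_one]

open Matrix in
theorem of_vecMul {m n : ℕ} (M : Fin m → Fin n → ℂ) (W : Matrix (Fin n) (Fin n) ℂ) :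
    Matrix.of (fun i => M i ᵥ* W) = Matrix.of M * W := by
  ext i j
  simp [Matrix.vecMul, Matrix.mul_apply, dotProduct]

open Matrix in
theorem detSq_vecMul {n : ℕ} {W : Matrix (Fin n) (Fin n) ℂ}
    (hW : W ∈ Matrix.unitaryGroup (Fin n) ℂ) (M : Fin n → Fin n → ℂ) :
    detSq (fun i => M i ᵥ* W) = detSq M := by
  rw [detSq, of_vecMul, Matrix.det_mul, enorm_mul, enorm_det_unitary hW, mul_one, detSq]

/-- Delete the first column. -/
def dropCol {m n : ℕ} (M : Fin m → Fin (n + 1) → ℂ) : Fin m → Fin n → ℂ := fun i j => M i j.succ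

/-- Insert a row into a family of rows. -/
def insRow {m n : ℕ} (i : Fin (m + 1)) (a : Fin n → ℂ) (X : Fin m → Fin n → ℂ) :
    Fin (m + 1) → Fin n → ℂ := i.insertNth a X

@[simp]
theorem insRow_same {m n : ℕ} (i : Fin (m + 1)) (a : Fin n → ℂ) (X : Fin m → Fin n → ℂ) :
    insRow i a X i = a := by simp [insRow]

@[simp]
theorem insRow_succAbove {m n : ℕ} (i : Fin (m + 1)) (a : Fin n → ℂ) (X : Fin m → Fin n → ℂ)
    (j : Fin m) : insRow i a X (i.succAbove j) = X j := by simp [insRow]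

theorem measurable_insRow {m n : ℕ} (i : Fin (m + 1)) :
    Measurable fun p : (Fin n → ℂ) × (Fin m → Fin n → ℂ) => insRow i p.1 p.2 :=
  (MeasurableEquiv.piFinSuccAbove (fun _ => Fin n → ℂ) i).symm.measurable

@[fun_prop]
theorem Measurable.insRow {α : Type*} [MeasurableSpace α] {m n : ℕ} {i : Fin (m + 1)}
    {f : α → Fin n → ℂ} {g : α → Fin m → Fin n → ℂ} (hf : Measurable f) (hg : Measurable g) :
    Measurable fun x => insRow i (f x) (g x) := (measurable_insRow i).comp (hf.prodMk hg)

theorem lintegral_gaussMat_insRow {m n : ℕ} (i : Fin (m + 1))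
    (f : (Fin (m + 1) → Fin n → ℂ) → ENNReal) (hf : Measurable f) :
    ∫⁻ x, f x ∂gaussMat (m + 1) n = ∫⁻ a, ∫⁻ x, f (insRow i a x) ∂gaussMat m n ∂gaussVec n :=
  lintegral_pi_insertNth _ i f hf

theorem det_insRow_single {n : ℕ} (i : Fin (n + 1)) (t : ℂ) (X : Fin n → Fin (n + 1) → ℂ) :
    (Matrix.of (insRow i (Pi.single 0 t) X)).det =
      (-1) ^ (i : ℕ) * t * (Matrix.of (dropCol X)).det := by
  rw [Matrix.det_succ_row _ i, Finset.sum_eq_single 0]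
  · congr 2
    · simp
    · ext j k
      simp [dropCol]
  · intro j _ hj
    simp [hj]
  · simp

theorem detSq_insRow_single {n : ℕ} (i : Fin (n + 1)) (t : ℂ) (X : Fin n → Fin (n + 1) → ℂ) :
    detSq (insRow i (Pi.single 0 t) X) =
      ‖t‖ₑ ^ 2 * detSq (dropCol X) := by
  rw [detSq, det_insRow_single, detSq]
  simp [enorm_mul, mul_pow, mul_comm]

theorem measurePreserving_dropCol (m n : ℕ) :
    MeasurePreserving dropCol (gaussMat m (n + 1)) (gaussMat m n) :=
  measurePreserving_pi (fun _ => gaussVec (n + 1)) (fun _ => gaussVec n)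
    (f := fun _ x j => x j.succ) fun _ =>
    measurePreserving_snd.comp (measurePreserving_piFinSuccAbove (fun _ => complexGaussian) 0)

@[fun_prop]
theorem Measurable.dropCol {α : Type*} [MeasurableSpace α] {m n : ℕ}
    {f : α → Fin m → Fin (n + 1) → ℂ} (hf : Measurable f) : Measurable fun x => dropCol (f x) :=
  (measurePreserving_dropCol m n).measurable.comp hf

theorem measurePreserving_neg_gaussVec (n : ℕ) :
    MeasurePreserving (fun x : Fin n → ℂ => -x) (gaussVec n) (gaussVec n) := by
  have h := measurePreserving_vecMul (n := n) (W := -1) (by simp [Matrix.mem_unitaryGroup_iff])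
  simpa [Matrix.vecMul_neg] using h

/-- Combined with the symmetry b ↦ -b, the parallelogram law removes the cross terms while all
integrals stay in `ENNReal`, so no integrability has to be checked. -/
theorem enorm_sq_parallelogram (c t : ℂ) :
    ‖c + t‖ₑ ^ 2 + ‖c - t‖ₑ ^ 2 = 2 * (‖c‖ₑ ^ 2 + ‖t‖ₑ ^ 2) := by
  simp_rw [← ofReal_norm, ← ENNReal.ofReal_pow (norm_nonneg _)]
  rw [← ENNReal.ofReal_add (by positivity) (by positivity),
    ← ENNReal.ofReal_add (by positivity) (by positivity), ← ENNReal.ofReal_ofNat 2,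
    ← ENNReal.ofReal_mul (by positivity)]
  congr 1
  have := parallelogram_law_with_norm ℝ c t
  nlinarith

theorem lintegral_enorm_sq_add {n : ℕ} (c : ℂ) (l : (Fin n → ℂ) →ₗ[ℂ] ℂ) :
    ∫⁻ b, ‖c + l b‖ₑ ^ 2 ∂gaussVec n = ‖c‖ₑ ^ 2 + ∫⁻ b, ‖l b‖ₑ ^ 2 ∂gaussVec n := by
  have hl : Measurable l := l.continuous_of_finiteDimensional.measurable
  have h1 : ∫⁻ b, ‖c - l b‖ₑ ^ 2 ∂gaussVec n = ∫⁻ b, ‖c + l b‖ₑ ^ 2 ∂gaussVec n := by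
    rw [← (measurePreserving_neg_gaussVec n).lintegral_comp (by fun_prop)]
    simp [sub_eq_add_neg]
  have h2 : 2 * ∫⁻ b, ‖c + l b‖ₑ ^ 2 ∂gaussVec n =
      2 * (‖c‖ₑ ^ 2 + ∫⁻ b, ‖l b‖ₑ ^ 2 ∂gaussVec n) := by
    calc 2 * ∫⁻ b, ‖c + l b‖ₑ ^ 2 ∂gaussVec n
        = ∫⁻ b, (‖c + l b‖ₑ ^ 2 + ‖c - l b‖ₑ ^ 2) ∂gaussVec n := by
          rw [lintegral_add_left (by fun_prop), h1, two_mul]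
      _ = _ := by
          simp_rw [enorm_sq_parallelogram]
          rw [lintegral_const_mul _ (by fun_prop), lintegral_add_left (by fun_prop)]
          simp
  exact (ENNReal.mul_right_inj two_ne_zero ENNReal.ofNat_ne_top).1 h2

open Matrix in
/-- A common row of two families can be rotated to a multiple of the first basis vector. -/
theorem lintegral_rotate {k l n : ℕ}
    (F : (Fin (n + 1) → ℂ) → (Fin k → Fin (n + 1) → ℂ) → (Fin l → Fin (n + 1) → ℂ) → ENNReal)
    (hFm : ∀ a, Measurable fun p : (Fin k → Fin (n + 1) → ℂ) × (Fin l → Fin (n + 1) → ℂ) =>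
      F a p.1 p.2)
    (hF : ∀ W ∈ Matrix.unitaryGroup (Fin (n + 1)) ℂ, ∀ a X Y,
      F (a ᵥ* W) (fun i => X i ᵥ* W) (fun i => Y i ᵥ* W) = F a X Y) (a : Fin (n + 1) → ℂ) :
    ∫⁻ X, ∫⁻ Y, F a X Y ∂gaussMat l (n + 1) ∂gaussMat k (n + 1) =
      ∫⁻ X, ∫⁻ Y, F (Pi.single 0 ((Real.sqrt (nsq a) : ℝ) : ℂ)) X Y
        ∂gaussMat l (n + 1) ∂gaussMat k (n + 1) := by
  obtain ⟨W, hW, haW⟩ := exists_unitary_vecMul a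
  have h := ((measurePreserving_rows_vecMul (m := k) hW).prod
      (measurePreserving_rows_vecMul (m := l) hW)).lintegral_comp
      (hFm (Pi.single 0 ((Real.sqrt (nsq a) : ℝ) : ℂ)))
  rw [lintegral_lintegral (hFm a).aemeasurable, lintegral_lintegral (hFm _).aemeasurable, ← h]
  refine lintegral_congr fun p => ?_
  rw [← hF W hW, haW]
  rfl

theorem enorm_sqrt_nsq_sq {n : ℕ} (a : Fin n → ℂ) :
    ‖((Real.sqrt (nsq a) : ℝ) : ℂ)‖ₑ ^ 2 = ENNReal.ofReal (nsq a) := by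
  rw [← ofReal_norm, Complex.norm_real, Real.norm_of_nonneg (Real.sqrt_nonneg _),
    ← ENNReal.ofReal_pow (Real.sqrt_nonneg _), Real.sq_sqrt (nsq_nonneg a)]

theorem lintegral_nsq_gaussVec (n : ℕ) :
    ∫⁻ a, ENNReal.ofReal (nsq a) ∂gaussVec n = n := by
  have := (lintegral_gaussVec_nsq le_rfl n).2.1
  simpa using this

theorem lintegral_nsq_sq_gaussVec (n : ℕ) :
    ∫⁻ a, ENNReal.ofReal (nsq a) ^ 2 ∂gaussVec n = n * (n + 1) := by
  have := (lintegral_gaussVec_nsq le_rfl n).2.2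
  simp only [zero_mul, neg_zero, Real.exp_zero, one_mul, add_zero, one_pow, div_one] at this
  simp_rw [← ENNReal.ofReal_pow (nsq_nonneg _), this]
  rw [ENNReal.ofReal_mul (by positivity), ENNReal.ofReal_add (by positivity) zero_le_one]
  simp

open Matrix in
theorem insRow_vecMul {n : ℕ} (i : Fin (n + 1)) (a : Fin (n + 1) → ℂ)
    (X : Fin n → Fin (n + 1) → ℂ) (W : Matrix (Fin (n + 1)) (Fin (n + 1)) ℂ) :
    (insRow i (a ᵥ* W) fun j => X j ᵥ* W) =
      fun j => (insRow i a X) j ᵥ* W := by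
  ext1 j
  refine i.succAboveCases ?_ (fun j => ?_) j <;> simp

/-- Rotate the first row a to a multiple of the first basis vector: the determinant splits off a
factor of modulus |a| and leaves a smaller Gaussian determinant, and E |a|² = n + 1. -/
theorem lintegral_detSq (n : ℕ) : ∫⁻ M, detSq M ∂gaussMat n n = n.factorial := by
  induction n with
  | zero => simp [detSq]
  | succ n ih =>
    have hm : Measurable fun p : (Fin (n + 1) → ℂ) × (Fin n → Fin (n + 1) → ℂ) =>
        detSq (insRow (0 : Fin (n + 1)) p.1 p.2) := by fun_prop
    have h : ∀ a : Fin (n + 1) → ℂ, ∫⁻ X, detSq (insRow (0 : Fin (n + 1)) a X)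
        ∂gaussMat n (n + 1) = ENNReal.ofReal (nsq a) * n.factorial := by
      intro a
      -- The second family of rows is not used here and is taken to be empty.
      have := lintegral_rotate (k := n) (l := 0) (n := n)
        (fun a X _ => detSq (insRow (0 : Fin (n + 1)) a X))
        (fun a => by fun_prop)
        (fun W hW a X _ => by rw [insRow_vecMul, detSq_vecMul hW]) a
      have hc : ∀ c : ENNReal, ∫⁻ _, c ∂gaussMat 0 (n + 1) = c := fun c => by
        rw [lintegral_const, measure_univ, mul_one]
      simp_rw [hc] at this
      rw [this]
      simp_rw [detSq_insRow_single, enorm_sqrt_nsq_sq]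
      rw [lintegral_const_mul _ (by fun_prop),
        (measurePreserving_dropCol n n).lintegral_comp measurable_detSq, ih]
    rw [lintegral_gaussMat_insRow 0 _ measurable_detSq]
    simp_rw [h]
    rw [lintegral_mul_const _ (continuous_nsq.measurable.ennreal_ofReal), lintegral_nsq_gaussVec,
      Nat.factorial_succ]
    push_cast
    rfl

theorem lintegral_const_mul_add {α : Type*} [MeasurableSpace α] {μ : Measure α} (c d : ENNReal)
    {f g : α → ENNReal} (hf : Measurable f) (hg : Measurable g) :
    ∫⁻ x, (c * f x + d * g x) ∂μ = c * ∫⁻ x, f x ∂μ + d * ∫⁻ x, g x ∂μ := by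
  rw [lintegral_add_left (hf.const_mul c), lintegral_const_mul _ hf, lintegral_const_mul _ hg]

theorem lintegral_triple_linear {α β δ : Type*} [MeasurableSpace α] [MeasurableSpace β]
    [MeasurableSpace δ] {μ : Measure α} {ν : Measure β} {ρ : Measure δ} [SFinite ν] [SFinite ρ]
    (c d : ENNReal) (f g : α → β → δ → ENNReal)
    (hf : Measurable fun r : (α × β) × δ => f r.1.1 r.1.2 r.2)
    (hg : Measurable fun r : (α × β) × δ => g r.1.1 r.1.2 r.2) :
    ∫⁻ a, ∫⁻ x, ∫⁻ b, (c * f a x b + d * g a x b) ∂ρ ∂ν ∂μ =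
      c * ∫⁻ a, ∫⁻ x, ∫⁻ b, f a x b ∂ρ ∂ν ∂μ + d * ∫⁻ a, ∫⁻ x, ∫⁻ b, g a x b ∂ρ ∂ν ∂μ := by
  have hf2 : Measurable fun r : α × β => ∫⁻ b, f r.1 r.2 b ∂ρ := hf.lintegral_prod_right'
  have hg2 : Measurable fun r : α × β => ∫⁻ b, g r.1 r.2 b ∂ρ := hg.lintegral_prod_right'
  have e1 : ∀ a x, ∫⁻ b, (c * f a x b + d * g a x b) ∂ρ =
      c * ∫⁻ b, f a x b ∂ρ + d * ∫⁻ b, g a x b ∂ρ := fun a x =>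
    lintegral_const_mul_add _ _ (hf.comp (measurable_prodMk_left (x := (a, x))))
      (hg.comp (measurable_prodMk_left (x := (a, x))))
  have e2 : ∀ a, ∫⁻ x, (c * ∫⁻ b, f a x b ∂ρ + d * ∫⁻ b, g a x b ∂ρ) ∂ν =
      c * ∫⁻ x, ∫⁻ b, f a x b ∂ρ ∂ν + d * ∫⁻ x, ∫⁻ b, g a x b ∂ρ ∂ν := fun a =>
    lintegral_const_mul_add _ _ (hf2.comp (measurable_prodMk_left (x := a)))
      (hg2.comp (measurable_prodMk_left (x := a)))
  simp_rw [e1, e2]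
  exact lintegral_const_mul_add _ _ hf2.lintegral_prod_right' hg2.lintegral_prod_right'

/-! ### Two Gaussian determinants with correlated rows -/

section correlated
variable (p q : ℂ)

/-- Rows of which the first `m` are the combinations `p x_i + q b_i`, the other ones `b_i`. -/
noncomputable def mixRows {k n : ℕ} (m : ℕ) (x b : Fin k → Fin n → ℂ) : Fin k → Fin n → ℂ :=
  fun i => if (i : ℕ) < m then p • x i + q • b i else b i

/-- The joint second moment of two determinants that share `m` correlated rows. -/
noncomputable def detCorr (n m : ℕ) : ENNReal :=
  ∫⁻ x, ∫⁻ b, detSq x * detSq (mixRows p q m x b) ∂gaussMat n n ∂gaussMat n n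

theorem continuous_mixRows {k n : ℕ} (m : ℕ) :
    Continuous fun r : (Fin k → Fin n → ℂ) × (Fin k → Fin n → ℂ) => mixRows p q m r.1 r.2 := by
  refine continuous_pi fun i => ?_
  unfold mixRows
  split_ifs <;> fun_prop

@[fun_prop]
theorem Measurable.mixRows {α : Type*} [MeasurableSpace α] {k n m : ℕ}
    {f g : α → Fin k → Fin n → ℂ} (hf : Measurable f) (hg : Measurable g) :
    Measurable fun x => mixRows p q m (f x) (g x) :=
  (continuous_mixRows p q m).measurable.comp (hf.prodMk hg)

/-- For a row inserted at position m, the other rows before it are exactly the first m of the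
remaining ones. The inserted row is mixed for m' = m + 1 and unmixed for m' = m, so both sides of
the recursion in `detCorr_succ` share the same smaller families. -/
theorem mixRows_insRow {n : ℕ} {m : ℕ} (i : Fin (n + 1)) (him : (i : ℕ) = m) {m' : ℕ}
    (hm' : m' = m ∨ m' = m + 1) (a β : Fin (n + 1) → ℂ) (x b : Fin n → Fin (n + 1) → ℂ) :
    mixRows p q m' (insRow i a x)
      (insRow i β b) =
      insRow i
        (if m < m' then p • a + q • β else β) (mixRows p q m x b) := by
  ext1 j
  refine i.succAboveCases ?_ (fun j => ?_) j
  · simp [mixRows, him]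
  · have : ((i.succAbove j : Fin (n + 1)) : ℕ) < m' ↔ (j : ℕ) < m := by
      rcases lt_or_ge (j : ℕ) m with h | h
      · rw [Fin.succAbove_of_castSucc_lt _ _ (by rw [Fin.lt_def, Fin.val_castSucc]; omega)]
        simp; omega
      · rw [Fin.succAbove_of_le_castSucc _ _ (by rw [Fin.le_def, Fin.val_castSucc]; omega)]
        simp; omega
    simp [mixRows, this]

/-- The determinant is linear in row i, and the cross term between a and β vanishes because β and -β
have the same law. -/
theorem lintegral_detSq_insRow {n : ℕ} (i : Fin (n + 1)) (a : Fin (n + 1) → ℂ)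
    (y : Fin n → Fin (n + 1) → ℂ) :
    ∫⁻ β, detSq (insRow i (p • a + q • β) y)
        ∂gaussVec (n + 1) =
      ‖p‖ₑ ^ 2 * detSq (insRow i a y) +
      ‖q‖ₑ ^ 2 * ∫⁻ β, detSq (insRow i β y)
        ∂gaussVec (n + 1) := by
  let l : (Fin (n + 1) → ℂ) →ₗ[ℂ] ℂ :=
    (Matrix.detRowAlternating (n := Fin (n + 1)) (R := ℂ)).toMultilinearMap.toLinearMap
      (insRow i 0 y) i
  have hl : ∀ v, (Matrix.of (insRow i v y)).det = l v := by
    intro v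
    change _ = Matrix.det (Matrix.of (Function.update (insRow i 0 y) i v))
    congr 2
    ext1 j
    refine i.succAboveCases ?_ (fun j => ?_) j <;> simp
  have hlm : Measurable l := l.continuous_of_finiteDimensional.measurable
  simp_rw [detSq, hl]
  simp_rw [map_add, map_smul l p]
  have := lintegral_enorm_sq_add (p • l a) (q • l)
  simp only [LinearMap.smul_apply] at this
  simp_rw [map_smul l q]
  rw [this]
  simp_rw [smul_eq_mul, enorm_mul, mul_pow]
  rw [lintegral_const_mul _ (by fun_prop)]

open Matrix in
theorem mixRows_vecMul {k n : ℕ} (m : ℕ) (x b : Fin k → Fin n → ℂ)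
    (W : Matrix (Fin n) (Fin n) ℂ) :
    mixRows p q m (fun i => x i ᵥ* W) (fun i => b i ᵥ* W) =
      fun i => mixRows p q m x b i ᵥ* W := by
  ext1 i
  unfold mixRows
  split_ifs <;> simp [Matrix.add_vecMul, Matrix.smul_vecMul]

theorem dropCol_mixRows {k n : ℕ} (m : ℕ) (x b : Fin k → Fin (n + 1) → ℂ) :
    dropCol (mixRows p q m x b) = mixRows p q m (dropCol x) (dropCol b) := by
  ext i j
  change mixRows p q m x b i j.succ = mixRows p q m (dropCol x) (dropCol b) i j
  unfold mixRows
  split_ifs <;> simp [dropCol]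

theorem measurable_detCorr_integrand (n m : ℕ) :
    Measurable fun r : (Fin n → Fin n → ℂ) × (Fin n → Fin n → ℂ) =>
      detSq r.1 * detSq (mixRows p q m r.1 r.2) := by
  fun_prop

theorem detCorr_expand {n m : ℕ} (i : Fin (n + 1)) (him : (i : ℕ) = m) {m' : ℕ}
    (hm' : m' = m ∨ m' = m + 1) :
    detCorr p q (n + 1) m' = ∫⁻ a, ∫⁻ x, ∫⁻ b,
      detSq (insRow i a x) *
      ∫⁻ β, detSq (insRow i
        (if m < m' then p • a + q • β else β) (mixRows p q m x b)) ∂gaussVec (n + 1)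
      ∂gaussMat n (n + 1) ∂gaussMat n (n + 1) ∂gaussVec (n + 1) := by
  have hM := measurable_detCorr_integrand p q (n + 1) m'
  rw [detCorr, lintegral_gaussMat_insRow i _ hM.lintegral_prod_right']
  refine lintegral_congr fun a => lintegral_congr fun x => ?_
  refine (lintegral_gaussMat_insRow i _
    (by fun_prop)).trans ?_
  have hins : Measurable fun r : (Fin (n + 1) → ℂ) × (Fin n → Fin (n + 1) → ℂ) =>
      detSq (insRow i a x) *
      detSq (mixRows p q m' (insRow i a x) (insRow i r.1 r.2)) := by fun_prop
  rw [lintegral_lintegral_swap hins.aemeasurable]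
  refine lintegral_congr fun b => ?_
  dsimp only
  rw [lintegral_const_mul]
  · simp_rw [mixRows_insRow p q i him hm']
  · fun_prop

/-- Expand in the last mixed row p a + q β. The |q|² part has that row unmixed. In the |p|² part
both determinants contain the row a; rotating it to the first basis vector gives |a|⁴ times the same
quantity in size n, and E |a|⁴ = (n + 1)(n + 2). -/
theorem detCorr_succ {n m : ℕ} (hm : m ≤ n) :
    detCorr p q (n + 1) (m + 1) =
      ‖p‖ₑ ^ 2 * ((n + 1) * (n + 2) * detCorr p q n m) + ‖q‖ₑ ^ 2 * detCorr p q (n + 1) m := by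
  let i : Fin (n + 1) := ⟨m, by omega⟩
  have hM := measurable_detCorr_integrand p q n m
  rw [detCorr_expand p q (m := m) i rfl (Or.inr rfl),
    detCorr_expand p q (m := m) i rfl (Or.inl rfl)]
  simp only [lt_add_iff_pos_right, zero_lt_one, if_true, lt_irrefl, if_false]
  have m1 : Measurable fun r : ((Fin (n + 1) → ℂ) × (Fin n → Fin (n + 1) → ℂ)) ×
      (Fin n → Fin (n + 1) → ℂ) =>
      detSq (insRow i r.1.1 r.1.2) * detSq (insRow i r.1.1 (mixRows p q m r.1.2 r.2)) := by
    fun_prop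
  have m2' : Measurable fun y : Fin n → Fin (n + 1) → ℂ =>
      ∫⁻ β, detSq (insRow i β y) ∂gaussVec (n + 1) :=
    Measurable.lintegral_prod_left' (f := fun r : (Fin (n + 1) → ℂ) × (Fin n → Fin (n + 1) → ℂ) =>
      detSq (insRow i r.1 r.2)) (by fun_prop)
  have m2 : Measurable fun r : ((Fin (n + 1) → ℂ) × (Fin n → Fin (n + 1) → ℂ)) ×
      (Fin n → Fin (n + 1) → ℂ) =>
      detSq (insRow i r.1.1 r.1.2) *
      ∫⁻ β, detSq (insRow i β (mixRows p q m r.1.2 r.2))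
        ∂gaussVec (n + 1) :=
    Measurable.mul (by fun_prop) (m2'.comp (by fun_prop))
  have e1 : ∀ (a : Fin (n + 1) → ℂ) (x b : Fin n → Fin (n + 1) → ℂ),
      detSq (insRow i a x) *
        ∫⁻ β, detSq (insRow i (p • a + q • β) (mixRows p q m x b)) ∂gaussVec (n + 1) =
      ‖p‖ₑ ^ 2 * (detSq (insRow i a x) *
        detSq (insRow i a (mixRows p q m x b))) +
      ‖q‖ₑ ^ 2 * (detSq (insRow i a x) *
        ∫⁻ β, detSq (insRow i β
          (mixRows p q m x b)) ∂gaussVec (n + 1)) := fun a x b => by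
    rw [lintegral_detSq_insRow]
    ring
  simp_rw [e1]
  have hns : Measurable fun a : Fin (n + 1) → ℂ => ENNReal.ofReal (nsq a) :=
    continuous_nsq.measurable.ennreal_ofReal
  have e2 : ∀ a : Fin (n + 1) → ℂ, ∫⁻ x, ∫⁻ b, detSq (insRow i a x) *
        detSq (insRow i a (mixRows p q m x b)) ∂gaussMat n (n + 1) ∂gaussMat n (n + 1) =
      ENNReal.ofReal (nsq a) ^ 2 * detCorr p q n m := by
    intro a
    rw [lintegral_rotate (fun a x b => detSq (insRow i a x) *
        detSq (insRow i a (mixRows p q m x b)))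
        (fun a => by fun_prop)
        (fun W hW a X Y => by
          rw [mixRows_vecMul, insRow_vecMul, insRow_vecMul, detSq_vecMul hW,
            detSq_vecMul hW]) a]
    simp_rw [detSq_insRow_single, enorm_sqrt_nsq_sq, dropCol_mixRows]
    have e4 : ∀ x b : Fin n → Fin (n + 1) → ℂ, ENNReal.ofReal (nsq a) * detSq (dropCol x) *
        (ENNReal.ofReal (nsq a) * detSq (mixRows p q m (dropCol x) (dropCol b))) =
        ENNReal.ofReal (nsq a) ^ 2 *
          (detSq (dropCol x) * detSq (mixRows p q m (dropCol x) (dropCol b))) :=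
      fun x b => by ring
    simp_rw [e4]
    have hd := measurePreserving_dropCol n n
    have hdm : Measurable fun r : (Fin n → Fin (n + 1) → ℂ) × (Fin n → Fin (n + 1) → ℂ) =>
        detSq (dropCol r.1) * detSq (mixRows p q m (dropCol r.1) (dropCol r.2)) := by
      fun_prop
    rw [lintegral_lintegral (hdm.const_mul _).aemeasurable, lintegral_const_mul _ hdm]
    congr 1
    exact ((hd.prod hd).lintegral_comp hM).trans (lintegral_prod _ hM.aemeasurable)
  rw [lintegral_triple_linear _ _ _ _ m1 m2]
  simp_rw [e2]
  rw [lintegral_mul_const _ (hns.pow_const 2), lintegral_nsq_sq_gaussVec]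
  congr 2
  push_cast
  rw [add_assoc, one_add_one_eq_two]

theorem detCorr_zero (n : ℕ) : detCorr p q n 0 = (n.factorial : ENNReal) ^ 2 := by
  have h0 : ∀ x b : Fin n → Fin n → ℂ, mixRows p q 0 x b = b := fun x b => by
    ext1 i; simp [mixRows]
  simp only [detCorr, h0]
  simp_rw [lintegral_const_mul _ measurable_detSq, lintegral_detSq]
  rw [lintegral_mul_const _ measurable_detSq, lintegral_detSq, sq]

/-- The integral solves the recursion `detCorr_succ`: splitting one factor |p|² + |q|² t of the
integrand yields the two terms, the second one with an additional power of t. -/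
theorem detCorr_eq (m : ℕ) : ∀ n, m ≤ n → detCorr p q n m =
    ENNReal.ofReal ((n.factorial : ℝ) ^ 2 * (n + 1) *
      ∫ t in (0 : ℝ)..1, t ^ (n - m) * (‖p‖ ^ 2 + ‖q‖ ^ 2 * t) ^ m) := by
  have hpos : ∀ k m : ℕ, 0 ≤ ∫ t in (0 : ℝ)..1, t ^ k * (‖p‖ ^ 2 + ‖q‖ ^ 2 * t) ^ m := fun k m =>
    intervalIntegral.integral_nonneg zero_le_one fun t ht => by
      have := ht.1
      positivity
  induction m with
  | zero =>
    intro n _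
    rw [detCorr_zero]
    simp only [tsub_zero, pow_zero, mul_one, integral_pow, one_pow]
    rw [zero_pow (Nat.succ_ne_zero n), sub_zero, mul_one_div, mul_div_assoc,
      div_self (by positivity), mul_one, ENNReal.ofReal_pow (by positivity), ENNReal.ofReal_natCast]
  | succ m ih =>
    intro n hn
    obtain ⟨n, rfl⟩ : ∃ k, n = k + 1 := ⟨n - 1, by omega⟩
    rw [detCorr_succ p q (by omega), ih n (by omega), ih (n + 1) (by omega)]
    have e : ∀ z : ℂ, ‖z‖ₑ ^ 2 = ENNReal.ofReal (‖z‖ ^ 2) := fun z => by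
      rw [← ofReal_norm, ENNReal.ofReal_pow (norm_nonneg _)]
    have e' : ((n : ENNReal) + 1) * (n + 2) = ENNReal.ofReal ((n + 1) * (n + 2)) := by
      rw [ENNReal.ofReal_mul (by positivity), ENNReal.ofReal_add (by positivity) zero_le_one,
        ENNReal.ofReal_add (by positivity) zero_le_two]
      simp
    have h1 := hpos (n - m) m
    have h2 := hpos (n + 1 - m) m
    rw [e, e, e', ← ENNReal.ofReal_mul (by positivity), ← ENNReal.ofReal_mul (by positivity),
      ← ENNReal.ofReal_mul (by positivity), ← ENNReal.ofReal_add (by positivity) (by positivity)]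
    congr 1
    have h3 : ∫ t in (0 : ℝ)..1, t ^ (n + 1 - (m + 1)) * (‖p‖ ^ 2 + ‖q‖ ^ 2 * t) ^ (m + 1) =
        ‖p‖ ^ 2 * (∫ t in (0 : ℝ)..1, t ^ (n - m) * (‖p‖ ^ 2 + ‖q‖ ^ 2 * t) ^ m) +
        ‖q‖ ^ 2 * ∫ t in (0 : ℝ)..1, t ^ (n + 1 - m) * (‖p‖ ^ 2 + ‖q‖ ^ 2 * t) ^ m := by
      rw [← intervalIntegral.integral_const_mul, ← intervalIntegral.integral_const_mul,
        ← intervalIntegral.integral_add (by apply Continuous.intervalIntegrable; fun_prop)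
          (by apply Continuous.intervalIntegrable; fun_prop)]
      congr 1
      ext t
      rw [Nat.add_sub_add_right, Nat.sub_add_comm (by omega : m ≤ n), pow_succ, pow_succ]
      ring
    rw [h3, Nat.factorial_succ]
    push_cast
    ring

/-- The joint second moment of the determinants of two correlated Gaussian matrices. -/
theorem enorm_sq_mul_detCorr (n : ℕ) :
    ‖q‖ₑ ^ 2 * ∫⁻ x, ∫⁻ b, detSq x * detSq (p • x + q • b) ∂gaussMat n n ∂gaussMat n n =
    ENNReal.ofReal ((n.factorial : ℝ) ^ 2 *
      ((‖p‖ ^ 2 + ‖q‖ ^ 2) ^ (n + 1) - (‖p‖ ^ 2) ^ (n + 1))) := by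
  have h0 : ∀ x b : Fin n → Fin n → ℂ, p • x + q • b = mixRows p q n x b := by
    intro x b
    ext1 i
    simp [mixRows]
  simp_rw [h0]
  change _ * detCorr p q n n = _
  rw [detCorr_eq p q n n le_rfl, ← ofReal_norm, ← ENNReal.ofReal_pow (norm_nonneg _),
    ← ENNReal.ofReal_mul (by positivity)]
  congr 1
  simp only [tsub_self, pow_zero, one_mul]
  -- For m = n the power of t disappears, and the prefactor |q|² (n + 1) makes the integrand an
  -- exact derivative. Keeping |q|² as a factor also covers q = 0.
  have hd : ∀ t ∈ Set.uIcc (0 : ℝ) 1, HasDerivAt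
      (fun t : ℝ => (‖p‖ ^ 2 + ‖q‖ ^ 2 * t) ^ (n + 1))
      ((‖q‖ ^ 2 * (n + 1)) * (‖p‖ ^ 2 + ‖q‖ ^ 2 * t) ^ n) t := by
    intro t _
    have := (((hasDerivAt_id t).const_mul (‖q‖ ^ 2)).const_add (‖p‖ ^ 2)).pow (n + 1)
    refine this.congr_deriv ?_
    push_cast
    simp
    ring
  have := intervalIntegral.integral_eq_sub_of_hasDerivAt hd
    (by apply Continuous.intervalIntegrable; fun_prop)
  rw [intervalIntegral.integral_const_mul] at this
  simp only [mul_one, mul_zero, add_zero] at this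
  rw [← this]
  ring

end correlated

/-! ### A change of variables inequality -/

/-- Lower integrals are superadditive, so no measurability of the summands is needed. This allows
integrands built from a choice of preimages. -/
theorem sum_lintegral_le_lintegral_sum {α ι : Type*} [MeasurableSpace α] (μ : Measure α)
    (s : Finset ι) (f : ι → α → ENNReal) :
    ∑ i ∈ s, ∫⁻ x, f i x ∂μ ≤ ∫⁻ x, ∑ i ∈ s, f i x ∂μ := by
  classical
  induction s using Finset.induction_on with
  | empty => simp
  | insert i s hi ih =>
    simp_rw [Finset.sum_insert hi]
    exact (add_le_add le_rfl ih).trans (le_lintegral_add _ _)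

theorem exists_nhds_injOn {E : Type*} [NormedAddCommGroup E] [NormedSpace ℂ E]
    [FiniteDimensional ℂ E] {ψ : E → E} {ψ' : E → E →L[ℂ] E}
    (hψ : ∀ x, HasStrictFDerivAt ψ (ψ' x) x) {x : E} (hx : (ψ' x).det ≠ 0) :
    ∃ V : Set E, IsOpen V ∧ x ∈ V ∧ Set.InjOn ψ V := by
  have : CompleteSpace E := FiniteDimensional.complete ℂ E
  have h : HasStrictFDerivAt ψ
      ((ContinuousLinearMap.toContinuousLinearEquivOfDetNeZero (ψ' x) hx : E ≃L[ℂ] E) :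
        E →L[ℂ] E) x := by
    simpa using hψ x
  exact ⟨(h.toOpenPartialHomeomorph ψ).source, (h.toOpenPartialHomeomorph ψ).open_source,
    h.mem_toOpenPartialHomeomorph_source, (h.toOpenPartialHomeomorph ψ).injOn⟩

section area

variable {E : Type*} [NormedAddCommGroup E] [NormedSpace ℂ E] [FiniteDimensional ℂ E]
  [MeasurableSpace E] [BorelSpace E] (μ : Measure E) [μ.IsAddHaarMeasure]

/-- Integrating over a set on which the map is injective. -/
theorem setLIntegral_det_mul {ψ : E → E} {ψ' : E → E →L[ℂ] E}
    (hψ : ∀ x, HasStrictFDerivAt ψ (ψ' x) x) {S : Set E} (hS : MeasurableSet S)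
    (hinj : Set.InjOn ψ S) (f : E → ENNReal) :
    ∫⁻ x in S, ‖(ψ' x).det‖ₑ ^ 2 * f x ∂μ =
      ∫⁻ y, (ψ '' S).indicator (fun y => f (Function.invFunOn ψ S y)) y ∂μ := by
  have : FiniteDimensional ℝ E := FiniteDimensional.complexToReal E
  have hd : ∀ x ∈ S, HasFDerivWithinAt ψ ((ψ' x).restrictScalars ℝ) S x := fun x _ =>
    ((hψ x).hasFDerivAt.restrictScalars ℝ).hasFDerivWithinAt
  have hc : Continuous ψ := continuous_iff_continuousAt.2 fun x => (hψ x).continuousAt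
  rw [lintegral_indicator (measurable_image_of_fderivWithin hS hd hinj),
    lintegral_image_eq_lintegral_abs_det_fderiv_mul μ hS hd hinj]
  refine setLIntegral_congr_fun hS fun x hx => ?_
  have h1 : |((ψ' x).restrictScalars ℝ).det| = ‖(ψ' x).det‖ ^ 2 :=
    abs_det_restrictScalars (ψ' x : E →ₗ[ℂ] E)
  rw [hinj.leftInvOn_invFunOn hx, h1, ← ofReal_norm, ENNReal.ofReal_pow (norm_nonneg _)]

/-- If the sum of `f` over finitely many noncritical preimages of `y` is at most `g y`, then the
integral of `f` against the Jacobian is at most the integral of `g`. -/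
theorem lintegral_det_mul_le {ψ : E → E} {ψ' : E → E →L[ℂ] E}
    (hψ : ∀ x, HasStrictFDerivAt ψ (ψ' x) x) (hψ' : Continuous ψ') (f g : E → ENNReal)
    (hfg : ∀ (y : E) (T : Finset E), (∀ x ∈ T, ψ x = y ∧ (ψ' x).det ≠ 0) →
      ∑ x ∈ T, f x ≤ g y) :
    ∫⁻ x, ‖(ψ' x).det‖ₑ ^ 2 * f x ∂μ ≤ ∫⁻ y, g y ∂μ := by
  classical
  have : ProperSpace E := FiniteDimensional.proper ℂ E
  set U : Set E := {x | (ψ' x).det ≠ 0}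
  have hU : IsOpen U :=
    isOpen_ne_fun (ContinuousLinearMap.continuous_det.comp hψ') continuous_const
  -- By the inverse function theorem and Lindelöf, countably many open sets on which ψ is injective
  -- cover the noncritical points. Made disjoint, they allow the exact change of variables on each
  -- piece.
  choose! V hVo hVm hVi using fun x (hx : x ∈ U) => exists_nhds_injOn hψ hx
  obtain ⟨t, htU, htc, htcov⟩ := TopologicalSpace.countable_cover_nhdsWithin
    (f := V) (s := U) fun x hx => mem_nhdsWithin_of_mem_nhds ((hVo x hx).mem_nhds (hVm x hx))
  -- The empty set ensures that the family can be enumerated even if there are no noncritical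
  -- points.
  have hC : (insert ∅ (V '' t)).Countable := (htc.image V).insert ∅
  obtain ⟨W, hW⟩ := hC.exists_eq_range (Set.insert_nonempty _ _)
  have hWp : ∀ k, IsOpen (W k) ∧ Set.InjOn ψ (W k) := by
    intro k
    have : W k ∈ insert ∅ (V '' t) := hW ▸ Set.mem_range_self k
    rcases this with h | ⟨x, hx, h⟩
    · rw [h]; exact ⟨isOpen_empty, Set.injOn_empty _⟩
    · rw [← h]; exact ⟨hVo x (htU hx), hVi x (htU hx)⟩
  have hcov : U ⊆ ⋃ k, W k := by
    intro x hx
    obtain ⟨z, hz, hxz⟩ := Set.mem_iUnion₂.1 (htcov hx)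
    have : V z ∈ Set.range W := hW ▸ Set.mem_insert_of_mem _ ⟨z, hz, rfl⟩
    obtain ⟨k, hk⟩ := this
    exact Set.mem_iUnion.2 ⟨k, hk ▸ hxz⟩
  set S : ℕ → Set E := fun k => disjointed W k ∩ U
  have hSm : ∀ k, MeasurableSet (S k) := fun k =>
    (MeasurableSet.disjointed (fun k => (hWp k).1.measurableSet) k).inter hU.measurableSet
  have hSd : Pairwise (Function.onFun Disjoint S) := fun i j hij =>
    (disjoint_disjointed W hij).mono Set.inter_subset_left Set.inter_subset_left
  have hSi : ∀ k, Set.InjOn ψ (S k) := fun k =>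
    (hWp k).2.mono (Set.inter_subset_left.trans (disjointed_subset W k))
  have hSu : ⋃ k, S k = U := by
    rw [← Set.iUnion_inter, iUnion_disjointed]
    exact Set.inter_eq_right.2 hcov
  have h1 : ∫⁻ x, ‖(ψ' x).det‖ₑ ^ 2 * f x ∂μ = ∫⁻ x in U, ‖(ψ' x).det‖ₑ ^ 2 * f x ∂μ := by
    rw [← lintegral_indicator hU.measurableSet]
    refine lintegral_congr fun x => ?_
    by_cases hx : x ∈ U
    · rw [Set.indicator_of_mem hx]
    · have : (ψ' x).det = 0 := not_not.1 hx
      rw [Set.indicator_of_notMem hx, this]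
      simp
  rw [h1, ← hSu, lintegral_iUnion hSm hSd]
  simp_rw [setLIntegral_det_mul μ hψ (hSm _) (hSi _)]
  refine ENNReal.tsum_le_of_sum_range_le fun m => ?_
  refine (sum_lintegral_le_lintegral_sum μ _ _).trans (lintegral_mono fun y => ?_)
  -- The pieces whose image contains y; being disjoint, they give distinct noncritical preimages, to
  -- which the hypothesis on finite sets applies.
  set I := (Finset.range m).filter fun k => y ∈ ψ '' S k
  have hI : ∀ k ∈ I, Function.invFunOn ψ (S k) y ∈ S k ∧ ψ (Function.invFunOn ψ (S k) y) = y :=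
    fun k hk => ⟨Function.invFunOn_mem (Finset.mem_filter.1 hk).2,
      Function.invFunOn_eq (Finset.mem_filter.1 hk).2⟩
  have hinj : Set.InjOn (fun k => Function.invFunOn ψ (S k) y) I := by
    intro i hi j hj hij
    by_contra hne
    have h2 := (hI j hj).1
    rw [← show Function.invFunOn ψ (S i) y = Function.invFunOn ψ (S j) y from hij] at h2
    exact Set.disjoint_left.1 (hSd hne) (hI i hi).1 h2
  calc ∑ k ∈ Finset.range m, (ψ '' S k).indicator (fun y => f (Function.invFunOn ψ (S k) y)) y
      = ∑ k ∈ I, f (Function.invFunOn ψ (S k) y) := by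
        rw [Finset.sum_filter]
        exact Finset.sum_congr rfl fun k _ => by rw [Set.indicator_apply]
    _ = ∑ x ∈ I.image fun k => Function.invFunOn ψ (S k) y, f x := by
        rw [Finset.sum_image hinj]
    _ ≤ g y := by
        refine hfg y _ fun x hx => ?_
        obtain ⟨k, hk, rfl⟩ := Finset.mem_image.1 hx
        exact ⟨(hI k hk).2, (hI k hk).1.2⟩

/-- A linear change of variables, combined with a translation. -/
theorem lintegral_linear_add (T : E →ₗ[ℂ] E) (hT : LinearMap.det T ≠ 0) (c : E)
    (f : E → ENNReal) :
    ∫⁻ x, f (T x + c) ∂μ = (‖LinearMap.det T‖ₑ ^ 2)⁻¹ * ∫⁻ x, f x ∂μ := by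
  have : FiniteDimensional ℝ E := FiniteDimensional.complexToReal E
  let e : E ≃ₗ[ℂ] E := LinearMap.equivOfDetNeZero T hT
  have hsurj : Function.Surjective fun x => T x + c := fun y =>
    ⟨e.symm (y - c), by
      have : T (e.symm (y - c)) = y - c := e.apply_symm_apply (y - c)
      change T (e.symm (y - c)) + c = y
      rw [this, sub_add_cancel]⟩
  have hinj : Set.InjOn (fun x => T x + c) Set.univ := by
    intro x _ y _ hxy
    exact e.injective (add_right_cancel hxy)
  have hd : ∀ x ∈ Set.univ, HasFDerivWithinAt (fun x => T x + c)
      ((LinearMap.toContinuousLinearMap (T.restrictScalars ℝ))) Set.univ x := fun x _ =>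
    ((LinearMap.toContinuousLinearMap (T.restrictScalars ℝ)).hasFDerivAt.add_const c).hasFDerivWithinAt
  have h := lintegral_image_eq_lintegral_abs_det_fderiv_mul μ MeasurableSet.univ hd hinj f
  have hdet : |(LinearMap.toContinuousLinearMap (T.restrictScalars ℝ)).det| =
      ‖LinearMap.det T‖ ^ 2 := abs_det_restrictScalars T
  rw [Set.image_univ, hsurj.range_eq, Measure.restrict_univ, hdet,
    lintegral_const_mul' _ _ ENNReal.ofReal_ne_top, ENNReal.ofReal_pow (norm_nonneg _),
    ofReal_norm] at h
  rw [h, ← mul_assoc, ENNReal.inv_mul_cancel (by simpa using hT) (by simp), one_mul]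

end area

/-! ### Deflation -/

/-- The eigenvalues of `A⁻¹ B`, with multiplicity. -/
noncomputable def eigs {n : ℕ} (A B : Fin n → Fin n → ℂ) : Multiset ℂ :=
  ((Matrix.of A)⁻¹ * Matrix.of B).charpoly.roots

/-! ### One row parametrised by an eigenvalue and a left eigenvector -/

section fiber
variable {n : ℕ} (A : Fin (n + 1) → Fin (n + 1) → ℂ) (C : Fin n → Fin (n + 1) → ℂ)

/-- The combination of the rows of `A` with coefficients `(1, u)`, where `x = (z, u)`. -/
def combRow (x : Fin (n + 1) → ℂ) : Fin (n + 1) → ℂ := A 0 + ∑ i : Fin n, x i.succ • A i.succ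

/-- The first row of a matrix `B` with remaining rows `C` such that `(1, u)` is a left
eigenvector of the pencil `z A - B`, where `x = (z, u)`. -/
def pencilRow (x : Fin (n + 1) → ℂ) : Fin (n + 1) → ℂ :=
  x 0 • combRow A x - ∑ i : Fin n, x i.succ • C i

/-- The Jacobian matrix of `pencilRow`. -/
def pencilJac (x : Fin (n + 1) → ℂ) : Fin (n + 1) → Fin (n + 1) → ℂ :=
  insRow 0 (combRow A x) fun i => x 0 • A i.succ - C i

theorem insRow_zero_zero {m n : ℕ} (a : Fin n → ℂ) (X : Fin m → Fin n → ℂ) :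
    insRow 0 a X 0 = a := insRow_same 0 a X

theorem insRow_zero_succ {m n : ℕ} (a : Fin n → ℂ) (X : Fin m → Fin n → ℂ) (i : Fin m) :
    insRow 0 a X i.succ = X i := by
  rw [← Fin.zero_succAbove, insRow_succAbove]

/-- The derivative of `pencilRow`. -/
noncomputable def pencilDeriv (x : Fin (n + 1) → ℂ) : (Fin (n + 1) → ℂ) →L[ℂ] (Fin (n + 1) → ℂ) :=
  LinearMap.toContinuousLinearMap (Matrix.toLin' (Matrix.of (pencilJac A C x)).transpose)

theorem pencilDeriv_det (x : Fin (n + 1) → ℂ) :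
    (pencilDeriv A C x).det = (Matrix.of (pencilJac A C x)).det := by
  rw [← Matrix.det_transpose, ← LinearMap.det_toLin']
  rfl

theorem pencilDeriv_apply (x h : Fin (n + 1) → ℂ) :
    pencilDeriv A C x h = h 0 • combRow A x + ∑ i : Fin n, h i.succ • (x 0 • A i.succ - C i) := by
  ext j
  simp only [pencilDeriv, LinearMap.coe_toContinuousLinearMap', Matrix.toLin'_apply,
    Matrix.mulVec, dotProduct, Matrix.transpose_apply, Matrix.of_apply, Fin.sum_univ_succ,
    pencilJac, insRow_zero_zero, insRow_zero_succ, Pi.add_apply, Pi.smul_apply, Finset.sum_apply,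
    smul_eq_mul, Pi.sub_apply]
  simp_rw [mul_comm]

theorem hasStrictFDerivAt_pencilRow (x : Fin (n + 1) → ℂ) :
    HasStrictFDerivAt (pencilRow A C) (pencilDeriv A C x) x := by
  have hp : ∀ i : Fin (n + 1), HasStrictFDerivAt (fun x : Fin (n + 1) → ℂ => x i)
      (ContinuousLinearMap.proj (R := ℂ) (φ := fun _ => ℂ) i) x := fun i =>
    hasStrictFDerivAt_apply i x
  have h1 : ∀ M : Fin n → Fin (n + 1) → ℂ,
      HasStrictFDerivAt (fun x : Fin (n + 1) → ℂ => ∑ i : Fin n, x i.succ • M i)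
      (∑ i : Fin n, (ContinuousLinearMap.proj (R := ℂ) (φ := fun _ => ℂ) i.succ :
        (Fin (n + 1) → ℂ) →L[ℂ] ℂ).smulRight (M i)) x := fun M =>
    HasStrictFDerivAt.fun_sum fun i _ => (hp i.succ).smul_const (M i)
  have h2 := ((hp 0).smul ((h1 fun i => A i.succ).const_add (A 0))).sub (h1 C)
  refine h2.congr_fderiv ?_
  ext1 h
  rw [pencilDeriv_apply]
  simp only [_root_.sub_apply, _root_.add_apply,
    _root_.smul_apply, _root_.sum_apply,
    ContinuousLinearMap.smulRight_apply, ContinuousLinearMap.proj_apply, combRow, smul_sub,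
    Finset.sum_sub_distrib, Finset.smul_sum]
  simp_rw [smul_comm (x 0)]
  abel

theorem continuous_pencilDeriv : Continuous (pencilDeriv A C) := by
  refine continuous_clm_apply.2 fun h => ?_
  simp_rw [pencilDeriv_apply]
  unfold combRow
  fun_prop

theorem pencil_combination (x : Fin (n + 1) → ℂ) :
    (x 0 • A 0 - pencilRow A C x) + ∑ i : Fin n, x i.succ • (x 0 • A i.succ - C i) = 0 := by
  simp only [pencilRow, combRow, smul_add, smul_sub, Finset.sum_sub_distrib, Finset.smul_sum]
  simp_rw [smul_comm (x 0)]
  abel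

open Matrix in
-- The first row of B is chosen so that (1, u) annihilates the pencil zA - B from the left; the
-- pencil is therefore singular at z.
theorem mem_eigs_of_pencilRow (hA : (Matrix.of A).det ≠ 0) (x : Fin (n + 1) → ℂ) :
    x 0 ∈ eigs A (insRow 0 (pencilRow A C x) C) := by
  set B := insRow 0 (pencilRow A C x) C
  have h1 : (x 0 • Matrix.of A - Matrix.of B).det = 0 := by
    refine Matrix.exists_vecMul_eq_zero_iff.1 ⟨Fin.cons 1 fun i => x i.succ, ?_, ?_⟩
    · intro h
      have := congrFun h 0
      simp at this
    · have h2 := pencil_combination A C x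
      ext j
      have h3 := congrFun h2 j
      simp only [Pi.add_apply, Pi.sub_apply, Pi.smul_apply, Finset.sum_apply, smul_eq_mul,
        Pi.zero_apply] at h3
      simp only [Matrix.vecMul, dotProduct, Fin.sum_univ_succ, Fin.cons_zero, Fin.cons_succ,
        Matrix.sub_apply, Matrix.smul_apply, Matrix.of_apply, B, insRow_zero_zero,
        insRow_zero_succ, smul_eq_mul, one_mul, Pi.zero_apply]
      exact h3
  rw [eigs, Polynomial.mem_roots (Matrix.charpoly_monic _).ne_zero, Polynomial.IsRoot,
    Matrix.eval_charpoly]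
  have h4 : Matrix.scalar (Fin (n + 1)) (x 0) - (Matrix.of A)⁻¹ * Matrix.of B =
      (Matrix.of A)⁻¹ * (x 0 • Matrix.of A - Matrix.of B) := by
    rw [Matrix.mul_sub, Matrix.mul_smul, Matrix.nonsing_inv_mul _ (isUnit_iff_ne_zero.2 hA)]
    simp [Matrix.smul_one_eq_diagonal]
  rw [h4, Matrix.det_mul, h1, mul_zero]

/-- Two left eigenvectors (1, u), (1, u') for the same z differ by a vector with first entry 0. Such
a vector annihilates the rows z a_i - c_i of the Jacobian matrix, so it vanishes at a noncritical
point. -/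
theorem pencilRow_injOn {x y : Fin (n + 1) → ℂ} (h : pencilRow A C x = pencilRow A C y)
    (h0 : x 0 = y 0) (hJ : (Matrix.of (pencilJac A C x)).det ≠ 0) : x = y := by
  have hx := pencil_combination A C x
  have hy := pencil_combination A C y
  rw [← h, ← h0] at hy
  have hxy : ∑ i : Fin n, (x i.succ - y i.succ) • (x 0 • A i.succ - C i) = 0 := by
    have : ∑ i : Fin n, x i.succ • (x 0 • A i.succ - C i) =
        ∑ i : Fin n, y i.succ • (x 0 • A i.succ - C i) := add_left_cancel (hx.trans hy.symm)
    simp_rw [sub_smul]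
    rw [Finset.sum_sub_distrib, this, sub_self]
  have hz : (Fin.cons 0 fun i => x i.succ - y i.succ : Fin (n + 1) → ℂ) = 0 := by
    by_contra hne
    refine hJ (Matrix.exists_vecMul_eq_zero_iff.1 ⟨_, hne, ?_⟩)
    ext j
    have := congrFun hxy j
    simp only [Finset.sum_apply, Pi.smul_apply, smul_eq_mul, Pi.sub_apply, Pi.zero_apply] at this
    simp only [Matrix.vecMul, dotProduct, Fin.sum_univ_succ, Fin.cons_zero, Fin.cons_succ,
      Matrix.of_apply, pencilJac, insRow_zero_succ, zero_mul, zero_add, Pi.zero_apply,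
      Pi.sub_apply, Pi.smul_apply, smul_eq_mul]
    exact this
  ext j
  refine Fin.cases h0 (fun i => ?_) j
  have := congrFun hz i.succ
  exact sub_eq_zero.1 (by simpa using this)

theorem sum_le_multiset_sum {α : Type*} (s : Multiset α) (T : Finset α)
    (hT : ∀ x ∈ T, x ∈ s) (f : α → ENNReal) : ∑ x ∈ T, f x ≤ (s.map f).sum := by
  have h : T.val ≤ s := (Multiset.le_iff_subset T.nodup).2 fun x hx => hT x hx
  obtain ⟨t, rfl⟩ := Multiset.le_iff_exists_add.1 h
  rw [Multiset.map_add, Multiset.sum_add]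
  exact le_self_add

/-- The Jacobian formula for one row. -/
theorem lintegral_pencil_le (hA : (Matrix.of A).det ≠ 0)
    (F : (Fin (n + 1) → Fin (n + 1) → ℂ) → (Fin (n + 1) → Fin (n + 1) → ℂ) → ℂ → ENNReal) :
    ∫⁻ x, detSq (pencilJac A C x) * (vecDensity (pencilRow A C x) *
        F A (insRow 0 (pencilRow A C x) C) (x 0)) ≤
      ∫⁻ y, ((eigs A (insRow 0 y C)).map (F A (insRow 0 y C))).sum ∂gaussVec (n + 1) := by
  classical
  rw [lintegral_gaussVec]
  have h := lintegral_det_mul_le (volume : Measure (Fin (n + 1) → ℂ))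
    (hasStrictFDerivAt_pencilRow A C) (continuous_pencilDeriv A C)
    (fun x => vecDensity (pencilRow A C x) * F A (insRow 0 (pencilRow A C x) C) (x 0))
    (fun y => vecDensity y * ((eigs A (insRow 0 y C)).map (F A (insRow 0 y C))).sum) ?_
  · simpa only [pencilDeriv_det, detSq] using h
  · intro y T hT
    have e1 : ∑ x ∈ T, vecDensity (pencilRow A C x) * F A (insRow 0 (pencilRow A C x) C) (x 0) =
        vecDensity y * ∑ x ∈ T, F A (insRow 0 y C) (x 0) := by
      rw [Finset.mul_sum]
      exact Finset.sum_congr rfl fun x hx => by rw [(hT x hx).1]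
    rw [e1]
    gcongr
    -- Distinct noncritical preimages have distinct eigenvalues, so summing over them counts each
    -- element of the spectrum at most once.
    have hinj : Set.InjOn (fun x : Fin (n + 1) → ℂ => x 0) T := fun x hx x' hx' hxx' =>
      pencilRow_injOn A C ((hT x hx).1.trans (hT x' hx').1.symm) hxx'
        (by rw [← pencilDeriv_det]; exact (hT x hx).2)
    rw [← Finset.sum_image (f := F A (insRow 0 y C)) hinj]
    refine sum_le_multiset_sum _ _ (fun z hz => ?_) _
    obtain ⟨x, hx, rfl⟩ := Finset.mem_image.1 hz
    rw [← (hT x hx).1]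
    exact mem_eigs_of_pencilRow A C hA x

end fiber

/-! ### Rotating the left eigenvector to the first basis vector -/

theorem det_lmulLinear {m : ℕ} (k : ℕ) (L : Matrix (Fin m) (Fin m) ℂ) :
    LinearMap.det (lmulLinear k L) = L.det ^ k := by
  let e : (Fin m → Fin k → ℂ) ≃ₗ[ℂ] (Fin k → Fin m → ℂ) :=
    { toFun := fun M j i => M i j
      invFun := fun M i j => M j i
      map_add' := fun _ _ => rfl
      map_smul' := fun _ _ => rfl
      left_inv := fun _ => rfl
      right_inv := fun _ => rfl }
  have h : e.toLinearMap ∘ₗ lmulLinear k L ∘ₗ e.symm.toLinearMap =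
      LinearMap.pi fun j => Matrix.toLin' L ∘ₗ LinearMap.proj j := by
    refine LinearMap.ext fun M => funext fun j => ?_
    exact lmul_col L (fun i j => M j i) j
  rw [← LinearMap.det_conj (lmulLinear k L) e, h, LinearMap.det_pi]
  simp

open Matrix in
-- The adjoint of the unitary matrix that sends (1, u) to a multiple of the first basis vector has
-- the normalised (1, u) as its first row.
theorem exists_unitary_row {n : ℕ} (u : Fin n → ℂ) :
    ∃ U ∈ Matrix.unitaryGroup (Fin (n + 1)) ℂ,
      U 0 0 = ((Real.sqrt (1 + nsq u))⁻¹ : ℝ) ∧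
      ∀ i : Fin n, U 0 i.succ = ((Real.sqrt (1 + nsq u))⁻¹ : ℝ) * u i := by
  obtain ⟨W, hW, hv⟩ := exists_unitary_vecMul (Fin.cons 1 u : Fin (n + 1) → ℂ)
  have hn : nsq (Fin.cons 1 u : Fin (n + 1) → ℂ) = 1 + nsq u := by
    simp [nsq, Fin.sum_univ_succ]
  rw [hn] at hv
  have hpos : 0 < Real.sqrt (1 + nsq u) := Real.sqrt_pos.2 (by linarith [nsq_nonneg u])
  have hne : ((Real.sqrt (1 + nsq u) : ℝ) : ℂ) ≠ 0 := by exact_mod_cast hpos.ne'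
  have h2 := congrArg (fun w => w ᵥ* star W) hv
  simp only [Matrix.vecMul_vecMul, (Matrix.mem_unitaryGroup_iff).1 hW, Matrix.vecMul_one] at h2
  have h3 : ∀ j, (Fin.cons 1 u : Fin (n + 1) → ℂ) j =
      ((Real.sqrt (1 + nsq u) : ℝ) : ℂ) * star W 0 j := by
    intro j
    rw [h2]
    simp
  refine ⟨star W, Unitary.star_mem hW, ?_, fun i => ?_⟩
  · have := h3 0
    simp only [Fin.cons_zero] at this
    push_cast
    rw [mul_comm] at this
    field_simp
    exact this.symm
  · have := h3 i.succ
    simp only [Fin.cons_succ] at this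
    push_cast
    rw [this]
    field_simp

theorem det_eq_of_first_row {n : ℕ} (M : Matrix (Fin (n + 1)) (Fin (n + 1)) ℂ)
    (h : ∀ i : Fin n, M 0 i.succ = 0) :
    M.det = M 0 0 * (M.submatrix Fin.succ Fin.succ).det := by
  rw [Matrix.det_succ_row_zero, Fin.sum_univ_succ]
  simp [h]

section fixed
variable {n : ℕ} (U : Matrix (Fin (n + 1)) (Fin (n + 1)) ℂ) (u : Fin n → ℂ)

/-- The action of `U` on the last rows of a matrix whose first row is determined by them. -/
def reducedMat : Matrix (Fin n) (Fin n) ℂ :=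
  Matrix.of fun j i => U j.succ i.succ - U j.succ 0 * u i

/-- Subtracting u_k times the first column of U from column k + 1 clears the first row and leaves
the reduced matrix in the corner, while |det U| = 1. -/
theorem enorm_det_reducedMat (hU : U ∈ Matrix.unitaryGroup (Fin (n + 1)) ℂ)
    (h0 : U 0 0 = ((Real.sqrt (1 + nsq u))⁻¹ : ℝ))
    (h1 : ∀ i : Fin n, U 0 i.succ = ((Real.sqrt (1 + nsq u))⁻¹ : ℝ) * u i) :
    ‖U 0 0‖ₑ * ‖(reducedMat U u).det‖ₑ = 1 := by
  let M : Matrix (Fin (n + 1)) (Fin (n + 1)) ℂ := Matrix.of fun i j =>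
    U i j + (Fin.cons 0 (fun k => -u k) : Fin (n + 1) → ℂ) j * U i 0
  have hM : M.det = U.det := by
    rw [← Matrix.det_transpose, ← Matrix.det_transpose U]
    exact Matrix.det_eq_of_forall_row_eq_smul_add_const
      (Fin.cons 0 (fun k => -u k) : Fin (n + 1) → ℂ) 0 (by simp) fun i j => rfl
  have hM2 : M.det = U 0 0 * (reducedMat U u).det := by
    rw [det_eq_of_first_row]
    · congr 2
      · simp [M]
      · ext i j
        simp [M, reducedMat]
        ring
    · intro i
      simp only [M, Matrix.of_apply, Fin.cons_succ, h0, h1]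
      ring
  rw [← enorm_mul, ← hM2, hM, enorm_det_unitary hU]

/-- The translation part of the action of `U` on the last rows. -/
def pencilShift (A : Fin (n + 1) → Fin (n + 1) → ℂ) (x : Fin (n + 1) → ℂ) :
    Fin n → Fin (n + 1) → ℂ := fun j => U j.succ 0 • x 0 • combRow A x

variable (A : Fin (n + 1) → Fin (n + 1) → ℂ) (C : Fin n → Fin (n + 1) → ℂ)

theorem lmul_zero_row (x : Fin (n + 1) → ℂ)
    (h1 : ∀ i : Fin n, U 0 i.succ = U 0 0 * x i.succ) :
    lmul U A 0 = U 0 0 • combRow A x := by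
  simp only [lmul, Fin.sum_univ_succ, combRow, smul_add, Finset.smul_sum, smul_smul, h1]

/-- After left multiplication by U the eigenvector is the first basis vector, so the first row of UB
is z times that of UA. The dependence of the first row of B on C makes the action on the remaining
rows affine, with linear part `reducedMat`. -/
theorem lmul_pencil (x : Fin (n + 1) → ℂ)
    (h1 : ∀ i : Fin n, U 0 i.succ = U 0 0 * x i.succ) :
    lmul U (insRow 0 (pencilRow A C x) C) = insRow 0 (x 0 • lmul U A 0)
      (lmul (reducedMat U fun i => x i.succ) C + pencilShift U A x) := by
  ext1 j
  refine Fin.cases ?_ (fun j => ?_) j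
  · rw [lmul_zero_row U A x h1, insRow_zero_zero]
    simp only [lmul, Fin.sum_univ_succ, insRow_zero_zero, insRow_zero_succ, h1, pencilRow,
      smul_sub, Finset.smul_sum, smul_smul, sub_add_cancel]
    rw [mul_comm]
  · rw [insRow_zero_succ]
    simp only [lmul, Fin.sum_univ_succ, insRow_zero_zero, insRow_zero_succ, pencilRow,
      pencilShift, smul_sub, Finset.smul_sum, smul_smul, Pi.add_apply, reducedMat, Matrix.of_apply, sub_smul,
      Finset.sum_sub_distrib]
    abel

/-- In the rotated coordinates the Jacobian matrix is multiplied on the left by a block diagonal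
matrix with blocks U 0 0 and the reduced matrix, whose determinant has modulus 1. -/
theorem detSq_lmul_pencil (x : Fin (n + 1) → ℂ)
    (h1 : ∀ i : Fin n, U 0 i.succ = U 0 0 * x i.succ)
    (hdet : ‖U 0 0‖ₑ * ‖(reducedMat U fun i => x i.succ).det‖ₑ = 1) :
    detSq (insRow 0 (lmul U A 0) fun j => x 0 • lmul U A j.succ -
      (lmul (reducedMat U fun i => x i.succ) C + pencilShift U A x) j) =
      detSq (pencilJac A C x) := by
  set L := reducedMat U fun i => x i.succ
  let K : Matrix (Fin (n + 1)) (Fin (n + 1)) ℂ :=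
    Matrix.of (Fin.cons (Fin.cons (U 0 0) 0) fun j => Fin.cons 0 (L j))
  have hK : K.det = U 0 0 * L.det := by
    rw [det_eq_of_first_row]
    · rfl
    · intro i; rfl
  have hE : Matrix.of (insRow 0 (lmul U A 0) fun j => x 0 • lmul U A j.succ -
      (lmul L C + pencilShift U A x) j) =
      K * Matrix.of (pencilJac A C x) := by
    rw [← lmul_eq]
    congr 1
    ext1 j
    refine Fin.cases ?_ (fun j => ?_) j
    · rw [lmul_zero_row U A x h1, insRow_zero_zero]
      simp [lmul, Fin.sum_univ_succ, K, pencilJac]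
    · rw [insRow_zero_succ]
      simp only [lmul, Fin.sum_univ_succ, K, pencilJac, insRow_zero_succ, Matrix.of_apply,
        Fin.cons_succ, Fin.cons_zero, zero_smul, zero_add, L, reducedMat, pencilShift, Pi.add_apply, sub_smul,
        smul_sub, Finset.sum_sub_distrib, combRow, smul_add, Finset.smul_sum, smul_smul]
      have e' : ∀ i : Fin n, U j.succ 0 * x i.succ * x 0 = U j.succ 0 * (x 0 * x i.succ) :=
        fun i => by ring
      simp only [mul_comm (x 0) (U _ _), sub_mul, e', sub_smul, Finset.sum_sub_distrib]
      abel
  rw [detSq, hE, Matrix.det_mul, hK, enorm_mul, enorm_mul, hdet, one_mul, detSq]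

end fixed

/-- The integrand of the deflation formula. -/
noncomputable def deflIntegrand {n : ℕ}
    (F : (Fin (n + 1) → Fin (n + 1) → ℂ) → (Fin (n + 1) → Fin (n + 1) → ℂ) → ℂ → ENNReal)
    (z : ℂ) (A : Fin (n + 1) → Fin (n + 1) → ℂ) (C : Fin n → Fin (n + 1) → ℂ) : ENNReal :=
  detSq (insRow 0 (A 0) fun j => z • A j.succ - C j) *
    (vecDensity (z • A 0) * F A (insRow 0 (z • A 0) C) z)

@[fun_prop]
theorem Measurable.vecDensity {α ι : Type*} [Fintype ι] [MeasurableSpace α] {f : α → ι → ℂ}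
    (hf : Measurable f) : Measurable fun x => vecDensity (f x) :=
  continuous_vecDensity.measurable.comp hf

theorem Measurable.apply_three {α β γ δ : Type*} [MeasurableSpace α] [MeasurableSpace β]
    [MeasurableSpace γ] [MeasurableSpace δ] {F : α → β → γ → ENNReal}
    (hF : Measurable fun r : (α × β) × γ => F r.1.1 r.1.2 r.2) {f : δ → α} {g : δ → β} {h : δ → γ}
    (hf : Measurable f) (hg : Measurable g) (hh : Measurable h) :
    Measurable fun x => F (f x) (g x) (h x) :=
  hF.comp ((hf.prodMk hg).prodMk hh)

theorem measurable_deflIntegrand {n : ℕ}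
    {F : (Fin (n + 1) → Fin (n + 1) → ℂ) → (Fin (n + 1) → Fin (n + 1) → ℂ) → ℂ → ENNReal}
    (hFm : Measurable fun r : ((Fin (n + 1) → Fin (n + 1) → ℂ) ×
      (Fin (n + 1) → Fin (n + 1) → ℂ)) × ℂ => F r.1.1 r.1.2 r.2) :
    Measurable fun r : ℂ × (Fin (n + 1) → Fin (n + 1) → ℂ) ×
      (Fin n → Fin (n + 1) → ℂ) => deflIntegrand F r.1 r.2.1 r.2.2 := by
  unfold deflIntegrand
  refine Measurable.mul (by fun_prop) (Measurable.mul (by fun_prop) ?_)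
  exact hFm.apply_three (by fun_prop) (by fun_prop) (by fun_prop)

theorem lintegral_gaussMat_eq_insRow {n : ℕ} (y : Fin (n + 1) → ℂ)
    (G : (Fin n → Fin (n + 1) → ℂ) → ENNReal) :
    ∫⁻ C, vecDensity y * G C ∂gaussMat n (n + 1) =
      ∫⁻ C, (∏ i, vecDensity (insRow 0 y C i)) * G C := by
  rw [lintegral_gaussMat]
  refine lintegral_congr fun C => ?_
  rw [Fin.prod_univ_succ, insRow_zero_zero]
  simp_rw [insRow_zero_succ]
  ring

/-- The integral over all pairs with a given eigenvalue and a given left eigenvector. -/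
theorem lintegral_pencil_fixed {n : ℕ}
    (F : (Fin (n + 1) → Fin (n + 1) → ℂ) → (Fin (n + 1) → Fin (n + 1) → ℂ) → ℂ → ENNReal)
    (hFm : Measurable fun r : ((Fin (n + 1) → Fin (n + 1) → ℂ) ×
      (Fin (n + 1) → Fin (n + 1) → ℂ)) × ℂ => F r.1.1 r.1.2 r.2)
    (hFl : ∀ U ∈ Matrix.unitaryGroup (Fin (n + 1)) ℂ, ∀ A B z,
      F (lmul U A) (lmul U B) z = F A B z) (x : Fin (n + 1) → ℂ) :
    ∫⁻ A, ∫⁻ C, detSq (pencilJac A C x) * (vecDensity (pencilRow A C x) *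
      F A (insRow 0 (pencilRow A C x) C) (x 0)) ∂gaussMat n (n + 1) ∂gaussMat (n + 1) (n + 1) =
    ENNReal.ofReal (1 / (1 + nsq fun i : Fin n => x i.succ) ^ (n + 1)) *
      ∫⁻ A, ∫⁻ C, deflIntegrand F (x 0) A C ∂gaussMat n (n + 1) ∂gaussMat (n + 1) (n + 1) := by
  set u : Fin n → ℂ := fun i => x i.succ
  obtain ⟨U, hU, h0, h1'⟩ := exists_unitary_row u
  have h1 : ∀ i : Fin n, U 0 i.succ = U 0 0 * x i.succ := fun i => by rw [h1', h0]
  have hdet := enorm_det_reducedMat U u hU h0 h1'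
  have hpos : 0 < 1 + nsq u := by linarith [nsq_nonneg u]
  set L := reducedMat U u
  have hL0 : L.det ≠ 0 := by
    intro h
    rw [h, enorm_zero, mul_zero] at hdet
    exact zero_ne_one hdet
  have hL : (‖LinearMap.det (lmulLinear (n + 1) L)‖ₑ ^ 2)⁻¹ =
      ENNReal.ofReal (1 / (1 + nsq u) ^ (n + 1)) := by
    have e1 : ‖U 0 0‖ₑ = ENNReal.ofReal (Real.sqrt (1 + nsq u))⁻¹ := by
      rw [h0, ← ofReal_norm, Complex.norm_real, Real.norm_of_nonneg (by positivity)]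
    have e2 : ‖L.det‖ₑ⁻¹ = ‖U 0 0‖ₑ := (ENNReal.eq_inv_of_mul_eq_one_left hdet).symm
    rw [det_lmulLinear, enorm_pow, ← pow_mul, mul_comm, pow_mul, ENNReal.inv_pow,
      ENNReal.inv_pow, e2, e1, ← ENNReal.ofReal_pow (by positivity),
      ← ENNReal.ofReal_pow (by positivity), inv_pow, Real.sq_sqrt hpos.le, one_div, inv_pow]
  -- The Gaussian densities of all rows of B are collected first, because U preserves only the sum
  -- of their squared lengths. The remaining integral over C is then with respect to Lebesgue
  -- measure and the affine substitution applies.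
  let H : (Fin (n + 1) → Fin (n + 1) → ℂ) → (Fin n → Fin (n + 1) → ℂ) → ENNReal := fun A C =>
    (∏ i, vecDensity (insRow 0 (x 0 • A 0) C i)) *
      (detSq (insRow 0 (A 0) fun j => x 0 • A j.succ - C j) * F A (insRow 0 (x 0 • A 0) C) (x 0))
  have hHm : Measurable fun r : (Fin (n + 1) → Fin (n + 1) → ℂ) × (Fin n → Fin (n + 1) → ℂ) =>
      H r.1 r.2 := by
    refine Measurable.mul (Finset.measurable_prod _ fun i _ => ?_) (Measurable.mul ?_ ?_)
    · fun_prop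
    · fun_prop
    · exact hFm.apply_three (by fun_prop) (by fun_prop) (by fun_prop)
  have hH : ∀ A C, (∏ i, vecDensity (insRow 0 (pencilRow A C x) C i)) *
      (detSq (pencilJac A C x) * F A (insRow 0 (pencilRow A C x) C) (x 0)) =
      H (lmul U A) (lmulLinear (n + 1) L C + pencilShift U A x) := by
    intro A C
    have hp := lmul_pencil U A C x h1
    have hd := detSq_lmul_pencil U A C x h1 hdet
    change _ = (∏ i, vecDensity (insRow 0 (x 0 • lmul U A 0) (lmul L C + pencilShift U A x) i)) *
      (detSq (insRow 0 (lmul U A 0) fun j => x 0 • lmul U A j.succ -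
        (lmul L C + pencilShift U A x) j) *
        F (lmul U A) (insRow 0 (x 0 • lmul U A 0) (lmul L C + pencilShift U A x)) (x 0))
    rw [hd, ← hp, hFl U hU, prod_vecDensity, prod_vecDensity, sum_nsq_lmul_unitary hU]
  have e1 : ∀ A, ∫⁻ C, detSq (pencilJac A C x) * (vecDensity (pencilRow A C x) *
      F A (insRow 0 (pencilRow A C x) C) (x 0)) ∂gaussMat n (n + 1) =
      ENNReal.ofReal (1 / (1 + nsq u) ^ (n + 1)) * ∫⁻ C, H (lmul U A) C := by
    intro A
    rw [← hL, ← lintegral_linear_add _ _ (by rw [det_lmulLinear]; exact pow_ne_zero _ hL0)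
      (pencilShift U A x), lintegral_gaussMat]
    refine lintegral_congr fun C => ?_
    rw [← hH, Fin.prod_univ_succ, insRow_zero_zero]
    simp_rw [insRow_zero_succ]
    ring
  simp_rw [e1]
  have hH2 : Measurable fun A => ∫⁻ C, H A C := hHm.lintegral_prod_right'
  have hmp := measurePreserving_lmul (n := n + 1) hU
  have hc : ∫⁻ A, ENNReal.ofReal (1 / (1 + nsq u) ^ (n + 1)) * (∫⁻ C, H (lmul U A) C)
      ∂gaussMat (n + 1) (n + 1) = ENNReal.ofReal (1 / (1 + nsq u) ^ (n + 1)) *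
      ∫⁻ A, (∫⁻ C, H (lmul U A) C) ∂gaussMat (n + 1) (n + 1) :=
    lintegral_const_mul _ (hH2.comp hmp.measurable)
  have hd : ∫⁻ A, (∫⁻ C, H (lmul U A) C) ∂gaussMat (n + 1) (n + 1) =
      ∫⁻ A, (∫⁻ C, H A C) ∂gaussMat (n + 1) (n + 1) := hmp.lintegral_comp hH2
  rw [hc, hd]
  congr 1
  refine lintegral_congr fun A => ?_
  rw [← lintegral_gaussMat_eq_insRow]
  refine lintegral_congr fun C => ?_
  unfold deflIntegrand
  ring

/-! ### Order of integration and null sets -/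

section tonelli
variable {α β γ : Type*} [MeasurableSpace α] [MeasurableSpace β] [MeasurableSpace γ]

theorem measurable_apply_left (F : α → β → γ) (hF : Measurable fun r : α × β => F r.1 r.2)
    (a : α) : Measurable (F a) := hF.comp (measurable_const.prodMk measurable_id)

theorem measurable_apply_comp {δ : Type*} [MeasurableSpace δ] (F : α → β → γ)
    (hF : Measurable fun r : α × β => F r.1 r.2) {f : δ → α} {g : δ → β} (hf : Measurable f)
    (hg : Measurable g) : Measurable fun x => F (f x) (g x) := hF.comp (hf.prodMk hg)

theorem measurable_lintegral_lintegral (F : α → β → γ → ENNReal)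
    (hF : Measurable fun r : α × β × γ => F r.1 r.2.1 r.2.2) (ν : Measure β) (ρ : Measure γ)
    [SFinite ν] [SFinite ρ] : Measurable fun a => ∫⁻ b, ∫⁻ c, F a b c ∂ρ ∂ν := by
  have h1 : Measurable fun p : α × β => ∫⁻ c, F p.1 p.2 c ∂ρ :=
    Measurable.lintegral_prod_right' (f := fun q : (α × β) × γ => F q.1.1 q.1.2 q.2)
      (hF.comp (by fun_prop : Measurable fun q : (α × β) × γ => (q.1.1, q.1.2, q.2)))
  exact h1.lintegral_prod_right'

theorem lintegral_rotate_three (F : α → β → γ → ENNReal)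
    (hF : Measurable fun r : α × β × γ => F r.1 r.2.1 r.2.2) (μ : Measure α) (ν : Measure β)
    (ρ : Measure γ) [SFinite μ] [SFinite ν] [SFinite ρ] :
    ∫⁻ c, ∫⁻ a, ∫⁻ b, F a b c ∂ν ∂μ ∂ρ = ∫⁻ a, ∫⁻ b, ∫⁻ c, F a b c ∂ρ ∂ν ∂μ := by
  have h1 : Measurable fun p : γ × α => ∫⁻ b, F p.2 b p.1 ∂ν :=
    Measurable.lintegral_prod_right' (f := fun q : (γ × α) × β => F q.1.2 q.2 q.1.1)
      (hF.comp (by fun_prop : Measurable fun q : (γ × α) × β => (q.1.2, q.2, q.1.1)))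
  rw [lintegral_lintegral_swap h1.aemeasurable]
  refine lintegral_congr fun a => lintegral_lintegral_swap ?_
  exact (hF.comp (by fun_prop : Measurable fun q : γ × β => (a, q.2, q.1))).aemeasurable

/-- Serves to pass from rows of length n + 1 to rows with the first entry dropped, with a pointwise
bound that is needed only for almost every first argument. -/
theorem mul_lintegral_le_of_measurePreserving {μ : Measure α} {ν : Measure β} [SFinite ν]
    {f : α → β} (hf : MeasurePreserving f μ ν) (G : β → β → ENNReal)
    (hG : Measurable fun r : β × β => G r.1 r.2) (c : ENNReal) (H : α → α → ENNReal)
    (h : ∀ᵐ x ∂μ, ∀ y, c * G (f x) (f y) ≤ H x y) :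
    c * ∫⁻ a, ∫⁻ b, G a b ∂ν ∂ν ≤ ∫⁻ x, ∫⁻ y, H x y ∂μ ∂μ := by
  have hG2 : Measurable fun a => ∫⁻ b, G a b ∂ν := hG.lintegral_prod_right'
  rw [← hf.lintegral_comp hG2]
  refine (lintegral_const_mul c (hG2.comp hf.measurable)).symm.trans_le ?_
  refine lintegral_mono_ae (h.mono fun x hx => ?_)
  have hGx : Measurable fun b => G (f x) b := hG.comp (measurable_const.prodMk measurable_id)
  change c * ∫⁻ b, G (f x) b ∂ν ≤ _
  rw [← hf.lintegral_comp hGx]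
  exact (lintegral_const_mul c (hGx.comp hf.measurable)).symm.trans_le (lintegral_mono hx)

end tonelli

theorem ae_gaussVec_ne_zero (n : ℕ) : ∀ᵐ a ∂gaussVec (n + 1), a ≠ 0 := by
  have h : ∀ᵐ a : Fin (n + 1) → ℂ, a ≠ 0 := by
    rw [ae_iff]
    simp
  rw [gaussVec_eq]
  exact (withDensity_absolutelyContinuous _ _).ae_le h

/-- Same row rotation as for the second moment, applied to the indicator of {0}: up to a nonzero
factor the determinant becomes a Gaussian determinant of smaller size. -/
theorem ae_det_ne_zero (n : ℕ) : ∀ᵐ M ∂gaussMat n n, (Matrix.of M).det ≠ 0 := by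
  obtain ⟨f, hf, hfz, hf0⟩ : ∃ f : ENNReal → ENNReal, Measurable f ∧ f 0 = 1 ∧
      ∀ x, x ≠ 0 → f x = 0 :=
    ⟨Set.indicator {0} 1, measurable_one.indicator (measurableSet_singleton 0), by simp,
      fun x hx => by simp [hx]⟩
  have hmul : ∀ x y, x ≠ 0 → f (x * y) = f y := fun x y hx => by
    by_cases hy : y = 0
    · simp [hy]
    · rw [hf0 _ hy, hf0 _ (mul_ne_zero hx hy)]
  have key : ∫⁻ M, f (detSq M) ∂gaussMat n n = 0 := by
    induction n with
    | zero => simp [detSq, hf0]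
    | succ n ih =>
      refine (lintegral_gaussMat_insRow (0 : Fin (n + 1)) _ (hf.comp measurable_detSq)).trans ?_
      rw [← lintegral_zero (μ := gaussVec (n + 1))]
      refine lintegral_congr_ae ((ae_gaussVec_ne_zero n).mono fun a ha => ?_)
      have h := lintegral_rotate (k := n) (l := 0)
        (fun a X _ => f (detSq (insRow (0 : Fin (n + 1)) a X)))
        (fun a => by fun_prop) (fun W hW a X Y => by
          rw [insRow_vecMul, detSq_vecMul hW]) a
      simp only [lintegral_const, measure_univ, mul_one, detSq_insRow_single,
        enorm_sqrt_nsq_sq] at h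
      have hn : ENNReal.ofReal (nsq a) ≠ 0 := by
        rw [Ne, ENNReal.ofReal_eq_zero, not_le]
        exact lt_of_le_of_ne (nsq_nonneg a) fun h => ha (nsq_eq_zero.1 h.symm)
      simp only [hmul _ _ hn] at h
      refine h.trans ?_
      rw [← ih]
      exact (measurePreserving_dropCol n n).lintegral_comp (hf.comp measurable_detSq)
  replace key := (lintegral_eq_zero_iff (hf.comp measurable_detSq)).1 key
  filter_upwards [key] with M hM h0
  have h1 : detSq M = 0 := by simp [detSq, h0]
  simp [h1, hfz] at hM

/-! ### Integration over all eigenvalues and eigenvectors -/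

theorem measurable_pencil_integrand {n : ℕ}
    {F : (Fin (n + 1) → Fin (n + 1) → ℂ) → (Fin (n + 1) → Fin (n + 1) → ℂ) → ℂ → ENNReal}
    (hFm : Measurable fun r : ((Fin (n + 1) → Fin (n + 1) → ℂ) ×
      (Fin (n + 1) → Fin (n + 1) → ℂ)) × ℂ => F r.1.1 r.1.2 r.2) :
    Measurable fun r : (Fin (n + 1) → Fin (n + 1) → ℂ) × (Fin n → Fin (n + 1) → ℂ) ×
      (Fin (n + 1) → ℂ) => detSq (pencilJac r.1 r.2.1 r.2.2) *
        (vecDensity (pencilRow r.1 r.2.1 r.2.2) *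
          F r.1 (insRow 0 (pencilRow r.1 r.2.1 r.2.2) r.2.1) (r.2.2 0)) := by
  have h1 : Measurable fun r : (Fin (n + 1) → Fin (n + 1) → ℂ) × (Fin n → Fin (n + 1) → ℂ) ×
      (Fin (n + 1) → ℂ) => combRow r.1 r.2.2 := by
    unfold combRow
    fun_prop
  have h2 : Measurable fun r : (Fin (n + 1) → Fin (n + 1) → ℂ) × (Fin n → Fin (n + 1) → ℂ) ×
      (Fin (n + 1) → ℂ) => pencilRow r.1 r.2.1 r.2.2 := by
    unfold pencilRow
    fun_prop
  refine Measurable.mul ?_ (Measurable.mul (by fun_prop) ?_)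
  · unfold pencilJac
    fun_prop
  · exact hFm.apply_three (by fun_prop) (by fun_prop) (by fun_prop)

/-- A lower bound for the expectation of a sum over the eigenvalues. -/
theorem lintegral_deflIntegrand_le {n : ℕ}
    (F : (Fin (n + 1) → Fin (n + 1) → ℂ) → (Fin (n + 1) → Fin (n + 1) → ℂ) → ℂ → ENNReal)
    (hFm : Measurable fun r : ((Fin (n + 1) → Fin (n + 1) → ℂ) ×
      (Fin (n + 1) → Fin (n + 1) → ℂ)) × ℂ => F r.1.1 r.1.2 r.2)
    (hFl : ∀ U ∈ Matrix.unitaryGroup (Fin (n + 1)) ℂ, ∀ A B z,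
      F (lmul U A) (lmul U B) z = F A B z)
    (hR : Measurable fun r : (Fin (n + 1) → Fin (n + 1) → ℂ) × (Fin (n + 1) → Fin (n + 1) → ℂ) =>
      ((eigs r.1 r.2).map (F r.1 r.2)).sum) :
    ENNReal.ofReal (Real.pi ^ n / n.factorial) *
      ∫⁻ z, ∫⁻ A, ∫⁻ C, deflIntegrand F z A C
        ∂gaussMat n (n + 1) ∂gaussMat (n + 1) (n + 1) ≤
      ∫⁻ A, ∫⁻ B, ((eigs A B).map (F A B)).sum
        ∂gaussMat (n + 1) (n + 1) ∂gaussMat (n + 1) (n + 1) := by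
  let J : (Fin (n + 1) → Fin (n + 1) → ℂ) → (Fin n → Fin (n + 1) → ℂ) → (Fin (n + 1) → ℂ) →
      ENNReal := fun A C x => detSq (pencilJac A C x) *
        (vecDensity (pencilRow A C x) * F A (insRow 0 (pencilRow A C x) C) (x 0))
  have hJ : Measurable fun r : (Fin (n + 1) → Fin (n + 1) → ℂ) × (Fin n → Fin (n + 1) → ℂ) ×
      (Fin (n + 1) → ℂ) => J r.1 r.2.1 r.2.2 := measurable_pencil_integrand hFm
  let G : ℂ → ENNReal := fun z => ∫⁻ A, ∫⁻ C, deflIntegrand F z A C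
        ∂gaussMat n (n + 1) ∂gaussMat (n + 1) (n + 1)
  have hG : Measurable G :=
    measurable_lintegral_lintegral (deflIntegrand F) (measurable_deflIntegrand hFm) _ _
  have hw : Measurable fun u : Fin n → ℂ => ENNReal.ofReal (1 / (1 + nsq u) ^ (n + 1)) := by
    have := (continuous_nsq (ι := Fin n)).measurable
    fun_prop
  -- For fixed x the integrals over A and C depend on u only through (1 + |u|²)^(-(n+1));
  -- integrating this over u gives the constant π^n / n!.
  have e1 : ∫⁻ x, ∫⁻ A, ∫⁻ C, J A C x ∂gaussMat n (n + 1) ∂gaussMat (n + 1) (n + 1) =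
      ENNReal.ofReal (Real.pi ^ n / n.factorial) * ∫⁻ z, G z := by
    have e2 : ∀ x : Fin (n + 1) → ℂ, ∫⁻ A, ∫⁻ C, J A C x ∂gaussMat n (n + 1)
        ∂gaussMat (n + 1) (n + 1) =
        ENNReal.ofReal (1 / (1 + nsq fun i : Fin n => x i.succ) ^ (n + 1)) * G (x 0) := fun x =>
      lintegral_pencil_fixed F hFm hFl x
    simp_rw [e2]
    have hm : Measurable fun x : Fin (n + 1) → ℂ =>
        ENNReal.ofReal (1 / (1 + nsq fun i : Fin n => x i.succ) ^ (n + 1)) * G (x 0) :=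
      (hw.comp (f := fun (x : Fin (n + 1) → ℂ) (i : Fin n) => x i.succ) (by fun_prop)).mul
        (hG.comp (measurable_pi_apply 0))
    refine (lintegral_pi_cons (volume : Measure ℂ) _ hm).trans ?_
    simp only [Fin.cons_succ, Fin.cons_zero]
    have e3 : ∀ z : ℂ, ∫⁻ u : Fin n → ℂ, ENNReal.ofReal (1 / (1 + nsq fun i => u i) ^ (n + 1)) *
        G z ∂Measure.pi (fun _ => volume) =
        ENNReal.ofReal (Real.pi ^ n / n.factorial) * G z := by
      intro z
      rw [lintegral_mul_const _ hw]
      congr 1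
      exact lintegral_one_add_nsq n
    simp_rw [e3]
    rw [lintegral_const_mul _ hG]
  change _ * ∫⁻ z, G z ≤ _
  rw [← e1, lintegral_rotate_three J hJ]
  refine lintegral_mono_ae ((ae_det_ne_zero (n + 1)).mono fun A hA => ?_)
  have hRA : Measurable fun B => ((eigs A B).map (F A B)).sum :=
    measurable_apply_left (fun A B => ((eigs A B).map (F A B)).sum) hR A
  rw [lintegral_gaussMat_insRow 0 _ hRA]
  refine (lintegral_mono fun C => lintegral_pencil_le A C hA F).trans_eq
    (lintegral_lintegral_swap ?_)
  exact (hRA.comp ((measurable_insRow 0).comp measurable_swap)).aemeasurable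

open Matrix in
/-- The conditional form of the deflation bound for a fixed eigenvalue. -/
theorem lintegral_deflIntegrand_ge {n : ℕ}
    (F : (Fin (n + 1) → Fin (n + 1) → ℂ) → (Fin (n + 1) → Fin (n + 1) → ℂ) → ℂ → ENNReal)
    (hFm : Measurable fun r : ((Fin (n + 1) → Fin (n + 1) → ℂ) ×
      (Fin (n + 1) → Fin (n + 1) → ℂ)) × ℂ => F r.1.1 r.1.2 r.2)
    (hFr : ∀ W ∈ Matrix.unitaryGroup (Fin (n + 1)) ℂ, ∀ A B z,
      F (fun i => A i ᵥ* W) (fun i => B i ᵥ* W) z = F A B z)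
    (k : ℕ) (Ψ : (Fin n → Fin n → ℂ) → (Fin n → Fin n → ℂ) → ℂ → ENNReal)
    (hΨm : Measurable fun r : ((Fin n → Fin n → ℂ) × (Fin n → Fin n → ℂ)) × ℂ =>
      Ψ r.1.1 r.1.2 r.2)
    (hΨ : ∀ t : ℝ, 0 < t → ∀ (X Y : Fin n → Fin (n + 1) → ℂ) (z : ℂ),
      (Matrix.of (dropCol X)).det ≠ 0 →
      ENNReal.ofReal (t ^ 2) ^ k * Ψ (dropCol X) (dropCol Y) z ≤
        F (insRow 0 (Pi.single 0 (t : ℂ)) X) (insRow 0 (z • Pi.single 0 (t : ℂ)) Y) z) (z : ℂ) :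
    (∫⁻ a, ENNReal.ofReal (nsq a) ^ (k + 1) * vecDensity (z • a) ∂gaussVec (n + 1)) *
      ∫⁻ A, ∫⁻ B, detSq (z • A - B) * Ψ A B z ∂gaussMat n n ∂gaussMat n n ≤
    ∫⁻ A, ∫⁻ C, deflIntegrand F z A C ∂gaussMat n (n + 1) ∂gaussMat (n + 1) (n + 1) := by
  have h0 := measurable_deflIntegrand hFm
  have hm1 : Measurable fun r : (Fin (n + 1) → Fin (n + 1) → ℂ) × (Fin n → Fin (n + 1) → ℂ) =>
      deflIntegrand F z r.1 r.2 := by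
    have h := h0.comp (f := fun r : (Fin (n + 1) → Fin (n + 1) → ℂ) ×
      (Fin n → Fin (n + 1) → ℂ) => (z, r)) (by fun_prop)
    exact h
  have hm2 : Measurable fun A => ∫⁻ C, deflIntegrand F z A C ∂gaussMat n (n + 1) :=
    hm1.lintegral_prod_right'
  have hΨz : Measurable fun r : (Fin n → Fin n → ℂ) × (Fin n → Fin n → ℂ) =>
      detSq (z • r.1 - r.2) * Ψ r.1 r.2 z :=
    Measurable.mul (by fun_prop) (hΨm.apply_three (by fun_prop) (by fun_prop) (by fun_prop))
  have hwm : Measurable fun a : Fin (n + 1) → ℂ =>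
      ENNReal.ofReal (nsq a) ^ (k + 1) * vecDensity (z • a) := by
    have := (continuous_nsq (ι := Fin (n + 1))).measurable
    fun_prop
  rw [lintegral_gaussMat_insRow 0 _ hm2, ← lintegral_mul_const _ hwm]
  refine lintegral_mono_ae ((ae_gaussVec_ne_zero n).mono fun a ha => ?_)
  have hpos : 0 < nsq a := lt_of_le_of_ne (nsq_nonneg a) fun h => ha (nsq_eq_zero.1 h.symm)
  set t := Real.sqrt (nsq a) with ht
  have htp : 0 < t := Real.sqrt_pos.2 hpos
  have ht2 : t ^ 2 = nsq a := Real.sq_sqrt hpos.le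
  have hrot := lintegral_rotate (k := n) (l := n)
    (fun a X Y => deflIntegrand F z (insRow 0 a X) Y)
    (fun a => measurable_apply_comp (fun X Y => deflIntegrand F z X Y) hm1 (by fun_prop)
      (by fun_prop))
    (fun W hW a X Y => by
      simp only [deflIntegrand, insRow_zero_zero, insRow_zero_succ]
      have e1 : (fun j => z • (X j ᵥ* W) - Y j ᵥ* W) = fun j => (z • X j - Y j) ᵥ* W := by
        ext1 j; rw [Matrix.sub_vecMul, Matrix.smul_vecMul]
      rw [e1, ← Matrix.smul_vecMul, insRow_vecMul, insRow_vecMul, insRow_vecMul, detSq_vecMul hW,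
        hFr W hW]
      congr 2
      simp only [vecDensity, nsq_vecMul_unitary hW]) a
  rw [hrot]
  refine mul_lintegral_le_of_measurePreserving (measurePreserving_dropCol n n)
    (fun A B => detSq (z • A - B) * Ψ A B z) hΨz _ _ ?_
  -- Singular corners are discarded: `Matrix` inversion returns 0 there, and the smaller spectrum
  -- would lose its meaning.
  filter_upwards [(measurePreserving_dropCol n n).quasiMeasurePreserving.ae (ae_det_ne_zero n)]
    with X hX Y
  simp only [deflIntegrand, insRow_zero_zero, insRow_zero_succ, detSq_insRow_single]
  have e1 : dropCol (fun j => z • X j - Y j) = z • dropCol X - dropCol Y := rfl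
  have e2 : vecDensity (z • (Pi.single 0 (t : ℂ) : Fin (n + 1) → ℂ)) = vecDensity (z • a) := by
    have : nsq (Pi.single 0 (t : ℂ) : Fin (n + 1) → ℂ) = nsq a := by
      rw [← ht2]
      simp [nsq, Fin.sum_univ_succ, Pi.single_apply]
    simp only [vecDensity, nsq_smul, this]
  rw [e1, e2, enorm_sqrt_nsq_sq, ← ht2]
  calc _ = ENNReal.ofReal (t ^ 2) * detSq (z • dropCol X - dropCol Y) *
        (vecDensity (z • a) * (ENNReal.ofReal (t ^ 2) ^ k * Ψ (dropCol X) (dropCol Y) z)) := by ring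
    _ ≤ _ := by gcongr; simpa only [Real.sqrt_sq htp.le] using hΨ t htp X Y z hX

open Matrix in
/-- Deflation: conditioning on one eigenvalue reduces the size of the matrices by one. -/
theorem deflation_le {n : ℕ}
    (F : (Fin (n + 1) → Fin (n + 1) → ℂ) → (Fin (n + 1) → Fin (n + 1) → ℂ) → ℂ → ENNReal)
    (hFm : Measurable fun r : ((Fin (n + 1) → Fin (n + 1) → ℂ) ×
      (Fin (n + 1) → Fin (n + 1) → ℂ)) × ℂ => F r.1.1 r.1.2 r.2)
    (hFl : ∀ U ∈ Matrix.unitaryGroup (Fin (n + 1)) ℂ, ∀ A B z,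
      F (lmul U A) (lmul U B) z = F A B z)
    (hFr : ∀ W ∈ Matrix.unitaryGroup (Fin (n + 1)) ℂ, ∀ A B z,
      F (fun i => A i ᵥ* W) (fun i => B i ᵥ* W) z = F A B z)
    (hR : Measurable fun r : (Fin (n + 1) → Fin (n + 1) → ℂ) × (Fin (n + 1) → Fin (n + 1) → ℂ) =>
      ((eigs r.1 r.2).map (F r.1 r.2)).sum)
    (k : ℕ) (Ψ : (Fin n → Fin n → ℂ) → (Fin n → Fin n → ℂ) → ℂ → ENNReal)
    (hΨm : Measurable fun r : ((Fin n → Fin n → ℂ) × (Fin n → Fin n → ℂ)) × ℂ =>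
      Ψ r.1.1 r.1.2 r.2)
    (hΨ : ∀ t : ℝ, 0 < t → ∀ (X Y : Fin n → Fin (n + 1) → ℂ) (z : ℂ),
      (Matrix.of (dropCol X)).det ≠ 0 →
      ENNReal.ofReal (t ^ 2) ^ k * Ψ (dropCol X) (dropCol Y) z ≤
        F (insRow 0 (Pi.single 0 (t : ℂ)) X) (insRow 0 (z • Pi.single 0 (t : ℂ)) Y) z) :
    ENNReal.ofReal (Real.pi ^ n / n.factorial) * ∫⁻ z,
      (∫⁻ a, ENNReal.ofReal (nsq a) ^ (k + 1) * vecDensity (z • a) ∂gaussVec (n + 1)) *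
        ∫⁻ A, ∫⁻ B, detSq (z • A - B) * Ψ A B z ∂gaussMat n n ∂gaussMat n n ≤
      ∫⁻ A, ∫⁻ B, ((eigs A B).map (F A B)).sum
        ∂gaussMat (n + 1) (n + 1) ∂gaussMat (n + 1) (n + 1) := by
  refine le_trans ?_ (lintegral_deflIntegrand_le F hFm hFl hR)
  gcongr with z
  exact lintegral_deflIntegrand_ge F hFm hFr k Ψ hΨm hΨ z

/-! ### Eigenvalues of a pair -/

theorem eigs_lmul {n : ℕ} {U : Matrix (Fin n) (Fin n) ℂ} (hU : U ∈ Matrix.unitaryGroup (Fin n) ℂ)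
    (A B : Fin n → Fin n → ℂ) : eigs (lmul U A) (lmul U B) = eigs A B := by
  have hd : IsUnit U.det := by
    rw [isUnit_iff_ne_zero, ← enorm_ne_zero, enorm_det_unitary hU]
    exact one_ne_zero
  rw [eigs, lmul_eq, lmul_eq, Matrix.mul_inv_rev, Matrix.mul_assoc,
    Matrix.nonsing_inv_mul_cancel_left _ _ hd, eigs]

open Matrix in
theorem eigs_vecMul {n : ℕ} {W : Matrix (Fin n) (Fin n) ℂ} (hW : W ∈ Matrix.unitaryGroup (Fin n) ℂ)
    (A B : Fin n → Fin n → ℂ) :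
    eigs (fun i => A i ᵥ* W) (fun i => B i ᵥ* W) = eigs A B := by
  have hd : IsUnit W.det := by
    rw [isUnit_iff_ne_zero, ← enorm_ne_zero, enorm_det_unitary hW]
    exact one_ne_zero
  rw [eigs, of_vecMul, of_vecMul, Matrix.mul_inv_rev, Matrix.mul_assoc, Matrix.charpoly_mul_comm,
    ← Matrix.mul_assoc, Matrix.mul_nonsing_inv_cancel_right _ _ hd, eigs]

/-- Replaces the inverse by the pencil wA - B, whose determinant can be expanded along rows and
transforms simply under unitary matrices. -/
theorem eval_charpoly_inv_mul {n : ℕ} {A : Fin n → Fin n → ℂ} (hA : (Matrix.of A).det ≠ 0)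
    (B : Fin n → Fin n → ℂ) (w : ℂ) :
    (Matrix.of A).det * ((Matrix.of A)⁻¹ * Matrix.of B).charpoly.eval w =
      (Matrix.of (w • A - B)).det := by
  have hd : IsUnit (Matrix.of A).det := isUnit_iff_ne_zero.2 hA
  rw [Matrix.eval_charpoly, ← Matrix.det_mul, Matrix.mul_sub,
    Matrix.mul_nonsing_inv_cancel_left _ _ hd]
  congr 1
  ext i j
  simp [Matrix.scalar_apply, Matrix.mul_diagonal, mul_comm]

/-- Both first rows are multiples of the first basis vector, so the determinant of the pencil at w
factors as (w - z) t times that of the corner. Comparing characteristic polynomials keeps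
multiplicities. -/
theorem eigs_insRow {n : ℕ} {t : ℂ} (ht : t ≠ 0) (z : ℂ) {X : Fin n → Fin (n + 1) → ℂ}
    (hX : (Matrix.of (dropCol X)).det ≠ 0) (Y : Fin n → Fin (n + 1) → ℂ) :
    eigs (insRow 0 (Pi.single 0 t) X) (insRow 0 (z • Pi.single 0 t) Y) =
      z ::ₘ eigs (dropCol X) (dropCol Y) := by
  have hd : (Matrix.of (insRow 0 (Pi.single 0 t) X)).det = t * (Matrix.of (dropCol X)).det := by
    rw [det_insRow_single]
    simp
  have hA : (Matrix.of (insRow 0 (Pi.single 0 t) X)).det ≠ 0 := by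
    rw [hd]
    exact mul_ne_zero ht hX
  have hp : ((Matrix.of (insRow 0 (Pi.single 0 t) X))⁻¹ *
      Matrix.of (insRow 0 (z • Pi.single 0 t) Y)).charpoly =
      (Polynomial.X - Polynomial.C z) *
        ((Matrix.of (dropCol X))⁻¹ * Matrix.of (dropCol Y)).charpoly := by
    refine Polynomial.funext fun w => ?_
    have h1 := eval_charpoly_inv_mul hA (insRow 0 (z • Pi.single 0 t) Y) w
    have h2 := eval_charpoly_inv_mul hX (dropCol Y) w
    have h3 : w • insRow 0 (Pi.single 0 t) X - insRow 0 (z • Pi.single 0 t) Y =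
        insRow 0 (Pi.single 0 ((w - z) * t)) (w • X - Y) := by
      ext1 i
      refine Fin.cases ?_ (fun i => ?_) i
      · simp only [Pi.sub_apply, Pi.smul_apply, insRow_zero_zero, ← Pi.single_smul,
          smul_eq_mul, ← Pi.single_sub, sub_mul]
      · simp only [Pi.sub_apply, Pi.smul_apply, insRow_zero_succ]
    have h4 : dropCol (w • X - Y) = w • dropCol X - dropCol Y := rfl
    rw [h3, hd, det_insRow_single, h4, ← h2] at h1
    simp only [Fin.val_zero, pow_zero, one_mul] at h1
    rw [Polynomial.eval_mul, Polynomial.eval_sub, Polynomial.eval_X, Polynomial.eval_C]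
    refine mul_left_cancel₀ (mul_ne_zero ht hX) (h1.trans ?_)
    ring
  rw [eigs, hp, Polynomial.roots_mul, Polynomial.roots_X_sub_C]
  · rfl
  · exact mul_ne_zero (Polynomial.X_sub_C_ne_zero z) (Matrix.charpoly_monic _).ne_zero

theorem card_charpoly_roots {n : ℕ} (M : Matrix (Fin n) (Fin n) ℂ) :
    Multiset.card M.charpoly.roots = n := by
  rw [Polynomial.splits_iff_card_roots.1 (IsAlgClosed.splits _),
    Matrix.charpoly_natDegree_eq_dim, Fintype.card_fin]

open Classical in
/-- The number of eigenvalues of `A⁻¹ B` in the set `S`. -/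
noncomputable def eigCount {n : ℕ} (S : Set ℂ) (A B : Fin n → Fin n → ℂ) : ℕ :=
  (eigs A B).countP (· ∈ S)

theorem card_eigs {n : ℕ} (A B : Fin n → Fin n → ℂ) : Multiset.card (eigs A B) = n := by
  exact card_charpoly_roots _

theorem eigCount_add_compl {n : ℕ} (S : Set ℂ) (A B : Fin n → Fin n → ℂ) :
    eigCount S A B + eigCount Sᶜ A B = n := by
  classical
  have h := Multiset.card_eq_countP_add_countP (· ∈ S) (eigs A B)
  rw [card_eigs] at h
  unfold eigCount
  convert h.symm

theorem eigCount_le {n : ℕ} (S : Set ℂ) (A B : Fin n → Fin n → ℂ) : eigCount S A B ≤ n :=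
  (Nat.le_add_right _ _).trans_eq (eigCount_add_compl S A B)

theorem sum_indicator_eq_countP {α R : Type*} [Semiring R] (S : Set α) (s : Multiset α)
    [DecidablePred (· ∈ S)] (c : R) :
    (s.map (S.indicator fun _ => c)).sum = (s.countP (· ∈ S) : ℕ) * c := by
  induction s using Multiset.induction_on with
  | empty => simp
  | cons a s ih =>
    rw [Multiset.map_cons, Multiset.sum_cons, ih, Multiset.countP_cons]
    by_cases h : a ∈ S <;> simp [h, add_mul, add_comm]

/-! ### Measurability of the counting functions -/

/-- List the elements with property p first. This replaces a union over subsets of indices by a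
condition on the first k entries. -/
theorem exists_fin_of_le_countP {α : Type*} (p : α → Prop) [DecidablePred p] {n k : ℕ}
    (s : Multiset α) (hs : Multiset.card s = n) (hk : k ≤ s.countP p) :
    ∃ t : Fin n → α, s = Finset.univ.val.map t ∧ ∀ i : Fin n, (i : ℕ) < k → p (t i) := by
  set l1 := (s.filter p).toList
  set l := l1 ++ (s.filter fun x => ¬ p x).toList with hldef
  have hl : (l : Multiset α) = s := by
    simp only [l, l1, ← Multiset.coe_add, Multiset.coe_toList, Multiset.filter_add_not]
  have hlen : l.length = n := by rw [← hs, ← hl, Multiset.coe_card]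
  have hl1 : l1.length = s.countP p := by
    simp [l1, Multiset.countP_eq_card_filter]
  clear_value l
  subst hlen
  refine ⟨l.get, ?_, fun i hi => ?_⟩
  · rw [Fin.univ_val_map, List.ofFn_get, hl]
  · have hi1 : (i : ℕ) < l1.length := by omega
    have : l.get i = l1[(i : ℕ)] := by
      simp [hldef, List.getElem_append_left, hi1]
    rw [this]
    have hm : l1[(i : ℕ)] ∈ s.filter p := by
      rw [← Multiset.mem_toList]
      exact List.getElem_mem hi1
    exact (Multiset.mem_filter.1 hm).2

/-- Being the list of roots is a family of polynomial identities, hence a closed condition on matrix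
and list together. -/
theorem charpoly_roots_eq_iff {n : ℕ} (M : Matrix (Fin n) (Fin n) ℂ) (t : Fin n → ℂ) :
    M.charpoly.roots = Finset.univ.val.map t ↔
      ∀ w, (Matrix.scalar (Fin n) w - M).det = ∏ i, (w - t i) := by
  have h1 : (∏ i, (Polynomial.X - Polynomial.C (t i))).roots = Finset.univ.val.map t := by
    have := Polynomial.roots_multiset_prod_X_sub_C (Finset.univ.val.map t)
    rwa [Multiset.map_map] at this
  constructor
  · intro h w
    have h2 := (IsAlgClosed.splits M.charpoly).eq_prod_roots_of_monic (Matrix.charpoly_monic M)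
    rw [h, Multiset.map_map] at h2
    rw [← Matrix.eval_charpoly, h2]
    change Polynomial.eval w (∏ i, (Polynomial.X - Polynomial.C (t i))) = _
    simp [Polynomial.eval_prod]
  · intro h
    rw [← h1]
    congr 1
    refine Polynomial.funext fun w => ?_
    rw [Matrix.eval_charpoly, h]
    simp [Polynomial.eval_prod]

theorem IsOpen.isSigmaCompact_inter {X : Type*} [PseudoEMetricSpace X] [SigmaCompactSpace X]
    {U F : Set X} (hU : IsOpen U) (hF : IsClosed F) : IsSigmaCompact (F ∩ U) := by
  obtain ⟨G, hG, -, rfl, -⟩ := hU.exists_iUnion_isClosed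
  rw [Set.inter_iUnion]
  exact isSigmaCompact_iUnion _ fun k =>
    isSigmaCompact_univ.of_isClosed_subset (hF.inter (hG k)) (Set.subset_univ _)

theorem IsSigmaCompact.measurableSet' {X : Type*} [TopologicalSpace X] [T2Space X]
    [MeasurableSpace X] [OpensMeasurableSpace X] {s : Set X} (hs : IsSigmaCompact s) :
    MeasurableSet s := by
  obtain ⟨K, hK, rfl⟩ := hs
  exact .iUnion fun k => (hK k).measurableSet

open Classical in
-- The set where the count is at least k is a projection of the triples (matrix, parameter, list of
-- roots) whose first k roots lie in O. These form the intersection of a closed and an open set in a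
-- σ-compact metric space, hence a σ-compact set, and so is the projection. No measurable choice of
-- eigenvalues is made.
theorem measurable_countP_charpoly_roots {n : ℕ} {Z : Type*} [MetricSpace Z]
    [SigmaCompactSpace Z] [SecondCountableTopology Z] [MeasurableSpace Z] [BorelSpace Z]
    {O : Set (ℂ × Z)} (hO : IsOpen O) :
    Measurable fun p : (Fin n → Fin n → ℂ) × Z =>
      (Matrix.of p.1).charpoly.roots.countP fun w => (w, p.2) ∈ O := by
  refine measurable_of_Ici fun k => ?_
  rcases lt_or_ge n k with hkn | hkn
  · convert MeasurableSet.empty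
    ext p
    have h := Multiset.countP_le_card (fun w => (w, p.2) ∈ O) (Matrix.of p.1).charpoly.roots
    rw [card_charpoly_roots] at h
    simp only [Set.mem_preimage, Set.mem_Ici, Set.mem_empty_iff_false, iff_false]
    omega
  let F : Set (((Fin n → Fin n → ℂ) × Z) × (Fin n → ℂ)) :=
    {q | ∀ w, (Matrix.scalar (Fin n) w - Matrix.of q.1.1).det = ∏ i, (w - q.2 i)}
  let U : Set (((Fin n → Fin n → ℂ) × Z) × (Fin n → ℂ)) :=
    {q | ∀ i : Fin n, (i : ℕ) < k → (q.2 i, q.1.2) ∈ O}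
  have hF : IsClosed F := by
    have : F = ⋂ w, {q | (Matrix.scalar (Fin n) w - Matrix.of q.1.1).det = ∏ i, (w - q.2 i)} := by
      ext; simp [F]
    rw [this]
    refine isClosed_iInter fun w => isClosed_eq ?_ (by fun_prop)
    exact Continuous.matrix_det (A := fun q : ((Fin n → Fin n → ℂ) × Z) × (Fin n → ℂ) =>
      Matrix.scalar (Fin n) w - Matrix.of q.1.1)
      (continuous_const.sub (continuous_fst.comp continuous_fst))
  have hU : IsOpen U := by
    have : U = ⋂ i : Fin n, ⋂ _ : (i : ℕ) < k,
        (fun q : ((Fin n → Fin n → ℂ) × Z) × (Fin n → ℂ) => (q.2 i, q.1.2)) ⁻¹' O := by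
      ext; simp [U]
    rw [this]
    exact isOpen_iInter_of_finite fun i => isOpen_iInter_of_finite fun _ =>
      hO.preimage (by fun_prop)
  have hs := ((hU.isSigmaCompact_inter hF).image continuous_fst).measurableSet'
  convert hs using 1
  ext ⟨M, z⟩
  simp only [Set.mem_preimage, Set.mem_Ici, Set.mem_image, Set.mem_inter_iff, Prod.exists,
    exists_and_right, exists_eq_right]
  constructor
  · intro hk
    obtain ⟨t, ht, hp⟩ := exists_fin_of_le_countP (fun w => (w, z) ∈ O) (n := n) _
      (card_charpoly_roots (Matrix.of M)) hk
    exact ⟨t, (charpoly_roots_eq_iff _ t).1 ht, hp⟩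
  · rintro ⟨t, ht, hp⟩
    rw [(charpoly_roots_eq_iff (Matrix.of M) t).2 ht, Multiset.countP_map, ← Finset.filter_val,
      Finset.card_val]
    have hk : k = (Finset.univ.map (Fin.castLEEmb hkn)).card := by simp
    conv_lhs => rw [hk]
    refine Finset.card_le_card fun i hi => ?_
    obtain ⟨j, -, rfl⟩ := Finset.mem_map.1 hi
    exact Finset.mem_filter.2 ⟨Finset.mem_univ _, hp _ j.2⟩

theorem measurable_inv_mul (n : ℕ) :
    Measurable fun (p : (Fin n → Fin n → ℂ) × (Fin n → Fin n → ℂ)) i j =>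
      ((Matrix.of p.1)⁻¹ * Matrix.of p.2) i j := by
  refine measurable_pi_lambda _ fun i => measurable_pi_lambda _ fun j => ?_
  have h1 : ∀ i k, Measurable fun M : Fin n → Fin n → ℂ => (Matrix.of M)⁻¹ i k := fun i k => by
    simp only [Matrix.inv_def, Ring.inverse_eq_inv', Matrix.smul_apply, smul_eq_mul]
    refine continuous_det_of.measurable.inv.mul (Continuous.measurable ?_)
    exact (continuous_id.matrix_adjugate (A := fun M : Fin n → Fin n → ℂ =>
      Matrix.of M)).matrix_elem i k
  simp only [Matrix.mul_apply]
  exact Finset.measurable_sum _ fun k _ => ((h1 i k).comp measurable_fst).mul (by fun_prop)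

theorem measurable_eigCount {n : ℕ} {Z : Type*} [MetricSpace Z]
    [SigmaCompactSpace Z] [SecondCountableTopology Z] [MeasurableSpace Z] [BorelSpace Z]
    {O : Set (ℂ × Z)} (hO : IsOpen O) :
    Measurable fun p : ((Fin n → Fin n → ℂ) × (Fin n → Fin n → ℂ)) × Z =>
      eigCount {w | (w, p.2) ∈ O} p.1.1 p.1.2 := by
  have h := (measurable_countP_charpoly_roots (n := n) hO).comp
    (((measurable_inv_mul n).comp measurable_fst).prodMk measurable_snd)
  exact h

theorem eigCount_compl {n : ℕ} (S : Set ℂ) (A B : Fin n → Fin n → ℂ) :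
    eigCount Sᶜ A B = n - eigCount S A B := by
  have := eigCount_add_compl S A B
  omega

theorem measurable_eigCount_of_isOpen {n : ℕ} {S : Set ℂ} (hS : IsOpen S) :
    Measurable fun p : (Fin n → Fin n → ℂ) × (Fin n → Fin n → ℂ) => eigCount S p.1 p.2 := by
  have h := (measurable_eigCount (n := n) (Z := Unit) (hS.preimage continuous_fst)).comp
    (f := fun p : (Fin n → Fin n → ℂ) × (Fin n → Fin n → ℂ) => (p, ())) (by fun_prop)
  exact h

theorem measurable_eigCount_compl {n : ℕ} {S : Set ℂ} (hS : IsOpen S) :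
    Measurable fun p : (Fin n → Fin n → ℂ) × (Fin n → Fin n → ℂ) => eigCount Sᶜ p.1 p.2 := by
  simp_rw [eigCount_compl]
  exact measurable_const.sub (measurable_eigCount_of_isOpen hS)

theorem eigCount_insRow {n : ℕ} (S : Set ℂ) {t : ℂ} (ht : t ≠ 0) (z : ℂ)
    {X : Fin n → Fin (n + 1) → ℂ} (hX : (Matrix.of (dropCol X)).det ≠ 0)
    (Y : Fin n → Fin (n + 1) → ℂ) :
    eigCount S (insRow 0 (Pi.single 0 t) X) (insRow 0 (z • Pi.single 0 t) Y) =
      eigCount S (dropCol X) (dropCol Y) + S.indicator 1 z := by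
  classical
  unfold eigCount
  rw [eigs_insRow ht z hX, Multiset.countP_cons]
  by_cases h : z ∈ S <;> simp [h]

theorem sum_map_indicator_mul_eigCount {n : ℕ} (S : Set ℂ) (A B : Fin n → Fin n → ℂ)
    (c : ENNReal) : ((eigs A B).map (S.indicator fun _ => c)).sum = eigCount S A B * c := by
  classical
  rw [sum_indicator_eq_countP]
  unfold eigCount
  congr

/-! ### A lower bound for the pair correlations -/

theorem vecDensity_smul {n : ℕ} (z : ℂ) (a : Fin n → ℂ) :
    vecDensity (z • a) =
      ENNReal.ofReal (1 / Real.pi ^ n) * ENNReal.ofReal (Real.exp (-(‖z‖ ^ 2 * nsq a))) := by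
  rw [vecDensity, nsq_smul, Fintype.card_fin, ← ENNReal.ofReal_mul (by positivity)]
  congr 1
  ring

theorem lintegral_nsq_mul_vecDensity (n : ℕ) (z : ℂ) :
    ∫⁻ a, ENNReal.ofReal (nsq a) ^ (0 + 1) * vecDensity (z • a) ∂gaussVec n =
      ENNReal.ofReal (1 / Real.pi ^ n * (n / (1 + ‖z‖ ^ 2) ^ (n + 1))) := by
  have h := (lintegral_gaussVec_nsq (sq_nonneg ‖z‖) n).2.1
  have hm := (continuous_nsq (ι := Fin n)).measurable
  rw [ENNReal.ofReal_mul (by positivity), ← h, ← lintegral_const_mul _ (by fun_prop)]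
  refine lintegral_congr fun a => ?_
  rw [vecDensity_smul, ENNReal.ofReal_mul (by positivity)]
  ring

theorem lintegral_nsq_sq_mul_vecDensity (n : ℕ) (z : ℂ) :
    ∫⁻ a, ENNReal.ofReal (nsq a) ^ (1 + 1) * vecDensity (z • a) ∂gaussVec n =
      ENNReal.ofReal (1 / Real.pi ^ n * (n * (n + 1) / (1 + ‖z‖ ^ 2) ^ (n + 2))) := by
  have h := (lintegral_gaussVec_nsq (sq_nonneg ‖z‖) n).2.2
  have hm := (continuous_nsq (ι := Fin n)).measurable
  rw [ENNReal.ofReal_mul (by positivity), ← h, ← lintegral_const_mul _ (by fun_prop)]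
  refine lintegral_congr fun a => ?_
  rw [vecDensity_smul, ENNReal.ofReal_mul (by positivity), ENNReal.ofReal_pow (nsq_nonneg a)]
  ring

theorem detSq_smul {n : ℕ} (c : ℂ) (M : Fin n → Fin n → ℂ) :
    detSq (c • M) = (‖c‖ₑ ^ 2) ^ n * detSq M := by
  have : Matrix.of (c • M) = c • Matrix.of M := rfl
  rw [detSq, this, Matrix.det_smul, Fintype.card_fin, enorm_mul, enorm_pow, mul_pow, ← pow_mul,
    ← pow_mul, mul_comm n 2, detSq]

theorem enorm_sq_eq_ofReal (z : ℂ) : ‖z‖ₑ ^ 2 = ENNReal.ofReal (‖z‖ ^ 2) := by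
  rw [← ofReal_norm, ENNReal.ofReal_pow (norm_nonneg z)]

/-- The joint second moment of the characteristic polynomials of a Gaussian pair. -/
theorem enorm_sq_mul_lintegral_detSq (n : ℕ) (z w : ℂ) :
    ‖z - w‖ₑ ^ 2 * ∫⁻ A, ∫⁻ B, detSq (w • A - B) * detSq (z • A - B) ∂gaussMat n n ∂gaussMat n n =
    ENNReal.ofReal ((n.factorial : ℝ) ^ 2 * (((1 + ‖z‖ ^ 2) * (1 + ‖w‖ ^ 2)) ^ (n + 1) -
      (‖1 + w * starRingEnd ℂ z‖ ^ 2) ^ (n + 1))) := by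
  set s : ℝ := Real.sqrt (1 + ‖z‖ ^ 2) with hs
  have hs2 : s ^ 2 = 1 + ‖z‖ ^ 2 := Real.sq_sqrt (by positivity)
  have hsp : 0 < s := Real.sqrt_pos.2 (by positivity)
  have hsc : (s : ℂ) ≠ 0 := by exact_mod_cast hsp.ne'
  have hsc2 : (s : ℂ) ^ 2 = 1 + z * starRingEnd ℂ z := by
    rw [← Complex.ofReal_pow, hs2, Complex.mul_conj, Complex.normSq_eq_norm_sq]
    push_cast
    ring
  set p : ℂ := (w * starRingEnd ℂ z + 1) / s with hp
  set q : ℂ := (w - z) / s with hq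
  have hns : ‖(s : ℂ)‖ ^ 2 = 1 + ‖z‖ ^ 2 := by
    rw [Complex.norm_real, Real.norm_of_nonneg hsp.le, hs2]
  -- The new independent pair is x = (zA - B)/s and b = (A + z̄B)/s. Solving for A and B gives wA -
  -- B = p x + q b.
  have hmix : ∀ a b : ℂ, ‖z / s * a + (-1 / s) * b‖ ^ 2 +
      ‖1 / s * a + starRingEnd ℂ z / s * b‖ ^ 2 = ‖a‖ ^ 2 + ‖b‖ ^ 2 := by
    intro a b
    have e1 : z / s * a + (-1 / s) * b = (z * a - b) / s := by ring
    have e2 : 1 / s * a + starRingEnd ℂ z / s * b = (a + starRingEnd ℂ z * b) / s := by ring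
    rw [e1, e2, norm_div, norm_div, div_pow, div_pow, hns, ← add_div,
      div_eq_iff (by positivity)]
    simp only [Complex.sq_norm, Complex.normSq_apply, Complex.sub_re, Complex.sub_im,
      Complex.add_re, Complex.add_im, Complex.mul_re, Complex.mul_im, Complex.conj_re,
      Complex.conj_im]
    ring
  have hnq : ‖q‖ ^ 2 = ‖z - w‖ ^ 2 / (1 + ‖z‖ ^ 2) := by
    rw [hq, norm_div, div_pow, hns, norm_sub_rev]
  have hnp : ‖p‖ ^ 2 = ‖1 + w * starRingEnd ℂ z‖ ^ 2 / (1 + ‖z‖ ^ 2) := by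
    rw [hp, norm_div, div_pow, hns, add_comm]
  have hpq : ‖p‖ ^ 2 + ‖q‖ ^ 2 = 1 + ‖w‖ ^ 2 := by
    rw [hnp, hnq, ← add_div, div_eq_iff (by positivity)]
    simp only [Complex.sq_norm, Complex.normSq_apply, Complex.sub_re, Complex.sub_im,
      Complex.add_re, Complex.add_im, Complex.mul_re, Complex.mul_im, Complex.conj_re,
      Complex.conj_im, Complex.one_re, Complex.one_im]
    ring
  have hG : Measurable fun r : (Fin n → Fin n → ℂ) × (Fin n → Fin n → ℂ) =>
      detSq r.1 * detSq (p • r.1 + q • r.2) := by fun_prop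
  have hH : Measurable fun r : (Fin n → Fin n → ℂ) × (Fin n → Fin n → ℂ) =>
      detSq (w • r.1 - r.2) * detSq (z • r.1 - r.2) := by fun_prop
  have e1 : ∫⁻ A, ∫⁻ B, detSq (w • A - B) * detSq (z • A - B) ∂gaussMat n n ∂gaussMat n n =
      (ENNReal.ofReal (1 + ‖z‖ ^ 2)) ^ n *
        ∫⁻ x, ∫⁻ b, detSq x * detSq (p • x + q • b) ∂gaussMat n n ∂gaussMat n n := by
    rw [← lintegral_prod _ hG.aemeasurable, ← lintegral_prod _ hH.aemeasurable,
      ← (measurePreserving_mix hmix).lintegral_comp hG]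
    refine Eq.trans ?_ (lintegral_const_mul _ (hG.comp (measurePreserving_mix hmix).measurable))
    refine lintegral_congr fun r => ?_
    have e2 : (z / s) • r.1 + (-1 / s : ℂ) • r.2 = (1 / s : ℂ) • (z • r.1 - r.2) := by
      rw [smul_sub, smul_smul, sub_eq_add_neg, ← neg_smul]
      congr 2 <;> ring
    have e3 : p • ((z / s) • r.1 + (-1 / s : ℂ) • r.2) +
        q • ((1 / s : ℂ) • r.1 + (starRingEnd ℂ z / s) • r.2) = w • r.1 - r.2 := by
      have c1 : p * (z / s) + q * (1 / s) = w := by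
        rw [hp, hq]
        field_simp
        rw [hsc2]
        ring
      have c2 : p * (-1 / s) + q * (starRingEnd ℂ z / s) = -1 := by
        rw [hp, hq]
        field_simp
        rw [hsc2]
        ring
      rw [smul_add, smul_add, smul_smul, smul_smul, smul_smul, smul_smul, add_add_add_comm,
        ← add_smul, ← add_smul, c1, c2, neg_one_smul, sub_eq_add_neg]
    simp only [e3]
    rw [e2, detSq_smul, enorm_sq_eq_ofReal, norm_div, norm_one, div_pow, hns, ← mul_assoc,
      ← mul_assoc, ← mul_pow, ← ENNReal.ofReal_mul (by positivity)]
    have e4 : (1 + ‖z‖ ^ 2) * (1 ^ 2 / (1 + ‖z‖ ^ 2)) = 1 := by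
      field_simp
    rw [e4, ENNReal.ofReal_one, one_pow, one_mul, mul_comm]
  have e5 : ‖z - w‖ₑ ^ 2 = ENNReal.ofReal (1 + ‖z‖ ^ 2) * ‖q‖ₑ ^ 2 := by
    rw [enorm_sq_eq_ofReal, enorm_sq_eq_ofReal, ← ENNReal.ofReal_mul (by positivity), hnq]
    congr 1
    field_simp
  calc _ = ENNReal.ofReal (1 + ‖z‖ ^ 2) ^ (n + 1) * (‖q‖ₑ ^ 2 *
        ∫⁻ x, ∫⁻ b, detSq x * detSq (p • x + q • b) ∂gaussMat n n ∂gaussMat n n) := by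
        rw [e1, e5]; ring
    _ = _ := by
        rw [enorm_sq_mul_detCorr, ← ENNReal.ofReal_pow (by positivity),
          ← ENNReal.ofReal_mul (by positivity), hpq, hnp]
        congr 1
        rw [div_pow, mul_pow]
        have : (1 + ‖z‖ ^ 2) ^ (n + 1) ≠ 0 := by positivity
        field_simp

/-! ### Pair density through two deflations -/

/-- The density of the uniform measure on the sphere in the stereographic coordinate. -/
noncomputable def stereoDensity (z : ℂ) : ℝ := 1 / (Real.pi * (1 + ‖z‖ ^ 2) ^ 2)

/-- The squared overlap of the lines in `ℂ²` that correspond to `z` and `w`. -/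
noncomputable def overlap (z w : ℂ) : ℝ :=
  ‖1 + w * starRingEnd ℂ z‖ ^ 2 / ((1 + ‖z‖ ^ 2) * (1 + ‖w‖ ^ 2))

theorem stereoDensity_nonneg (z : ℂ) : 0 ≤ stereoDensity z := by
  unfold stereoDensity; positivity

@[fun_prop]
theorem continuous_stereoDensity : Continuous stereoDensity := by
  unfold stereoDensity
  refine Continuous.div continuous_const (by fun_prop) fun z => ?_
  positivity

theorem factor_overlap (m : ℕ) (z w : ℂ) :
    ((1 + ‖z‖ ^ 2) * (1 + ‖w‖ ^ 2)) ^ (m + 1) - (‖1 + w * starRingEnd ℂ z‖ ^ 2) ^ (m + 1) =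
      ((1 + ‖z‖ ^ 2) * (1 + ‖w‖ ^ 2)) ^ (m + 1) * (1 - overlap z w ^ (m + 1)) := by
  have : ((1 + ‖z‖ ^ 2) * (1 + ‖w‖ ^ 2)) ^ (m + 1) ≠ 0 := by positivity
  rw [overlap, div_pow, mul_sub, mul_div_cancel₀ _ this, mul_one]

/-- The second deflation, with z fixed. At an eigenvalue w the block triangular form gives |det(zA -
B)|² = t² |z - w|² |det(zA' - B')|², hence k = 1. Together with the Jacobian weight |det(wA' - B')|²
this is the joint moment computed above. -/
theorem lintegral_detSq_mul_eigCount_ge {m : ℕ} {S : Set ℂ} (hS : IsOpen S) (z : ℂ) :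
    ∫⁻ w in Sᶜ, ENNReal.ofReal ((m + 2).factorial * (1 + ‖z‖ ^ 2) ^ (m + 1) *
      (stereoDensity w * (1 - overlap z w ^ (m + 1)))) ≤
    ∫⁻ A, ∫⁻ B, detSq (z • A - B) * eigCount Sᶜ A B
      ∂gaussMat (m + 1) (m + 1) ∂gaussMat (m + 1) (m + 1) := by
  let F : (Fin (m + 1) → Fin (m + 1) → ℂ) → (Fin (m + 1) → Fin (m + 1) → ℂ) → ℂ → ENNReal :=
    fun A B => Sᶜ.indicator fun _ => detSq (z • A - B)
  let Ψ : (Fin m → Fin m → ℂ) → (Fin m → Fin m → ℂ) → ℂ → ENNReal :=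
    fun A B w => Sᶜ.indicator (fun w => ‖z - w‖ₑ ^ 2 * detSq (z • A - B)) w
  have hSm : MeasurableSet Sᶜ := hS.isClosed_compl.measurableSet
  have hFm : Measurable fun r : ((Fin (m + 1) → Fin (m + 1) → ℂ) ×
      (Fin (m + 1) → Fin (m + 1) → ℂ)) × ℂ => F r.1.1 r.1.2 r.2 := by
    have h : Measurable fun r : ((Fin (m + 1) → Fin (m + 1) → ℂ) ×
      (Fin (m + 1) → Fin (m + 1) → ℂ)) × ℂ => detSq (z • r.1.1 - r.1.2) := by fun_prop
    exact h.indicator (measurable_snd hSm)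
  have hΨm : Measurable fun r : ((Fin m → Fin m → ℂ) × (Fin m → Fin m → ℂ)) × ℂ =>
      Ψ r.1.1 r.1.2 r.2 := by
    have h : Measurable fun r : ((Fin m → Fin m → ℂ) × (Fin m → Fin m → ℂ)) × ℂ =>
      ‖z - r.2‖ₑ ^ 2 * detSq (z • r.1.1 - r.1.2) := by fun_prop
    exact h.indicator (measurable_snd hSm)
  have hsum : ∀ A B, ((eigs A B).map (F A B)).sum = detSq (z • A - B) * eigCount Sᶜ A B :=
    fun A B => by rw [sum_map_indicator_mul_eigCount, mul_comm]
  have h := deflation_le F hFm (fun U hU A B w => ?_) (fun W hW A B w => ?_) ?_ 1 Ψ hΨm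
    (fun t ht X Y w hX => ?_)
  · simp_rw [hsum] at h
    refine le_trans (le_of_eq ?_) h
    rw [← lintegral_indicator hSm, ← lintegral_const_mul' _ _ ENNReal.ofReal_ne_top]
    refine lintegral_congr fun w => ?_
    by_cases hw : w ∈ Sᶜ
    · have e1 : ∀ A B, detSq (w • A - B) * Ψ A B w =
          ‖z - w‖ₑ ^ 2 * (detSq (w • A - B) * detSq (z • A - B)) := fun A B => by
        simp only [Ψ, Set.indicator_of_mem hw]
        ring
      have hne : ‖z - w‖ₑ ^ 2 ≠ ⊤ := ENNReal.pow_ne_top enorm_ne_top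
      simp_rw [e1, lintegral_const_mul' _ _ hne]
      rw [Set.indicator_of_mem hw, enorm_sq_mul_lintegral_detSq, lintegral_nsq_sq_mul_vecDensity,
        ← ENNReal.ofReal_mul (by positivity), ← ENNReal.ofReal_mul (by positivity),
        factor_overlap, stereoDensity, mul_pow, Nat.factorial_succ, Nat.factorial_succ]
      congr 1
      push_cast
      field_simp
      ring
    · have e1 : ∀ A B, Ψ A B w = 0 := fun A B => Set.indicator_of_notMem hw _
      simp [e1, Set.indicator_of_notMem hw]
  · have e : z • lmul U A - lmul U B = lmul U (z • A - B) := by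
      change z • lmulLinear _ U A - lmulLinear _ U B = lmulLinear _ U (z • A - B)
      rw [map_sub, map_smul]
    simp only [F, e, detSq, lmul_eq, Matrix.det_mul, enorm_mul, enorm_det_unitary hU, one_mul]
  · have e : (z • fun i => Matrix.vecMul (A i) W) - (fun i => Matrix.vecMul (B i) W) =
        fun i => Matrix.vecMul ((z • A - B) i) W := by
      ext1 i
      simp [Matrix.sub_vecMul, Matrix.smul_vecMul]
    simp only [F, e, detSq_vecMul hW]
  · simp_rw [hsum]
    have hd : Measurable fun r : (Fin (m + 1) → Fin (m + 1) → ℂ) ×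
      (Fin (m + 1) → Fin (m + 1) → ℂ) => detSq (z • r.1 - r.2) := by fun_prop
    exact hd.mul ((measurable_from_top (f := ((↑) : ℕ → ENNReal))).comp
      (measurable_eigCount_compl hS))
  · have e : z • insRow 0 (Pi.single 0 (t : ℂ)) X - insRow 0 (w • Pi.single 0 (t : ℂ)) Y =
        insRow 0 (Pi.single 0 ((z - w) * t)) (z • X - Y) := by
      ext1 i
      refine Fin.cases ?_ (fun i => ?_) i
      · simp only [Pi.sub_apply, Pi.smul_apply, insRow_zero_zero, ← Pi.single_smul,
          smul_eq_mul, ← Pi.single_sub, sub_mul]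
      · simp only [Pi.sub_apply, Pi.smul_apply, insRow_zero_succ]
    have e2 : dropCol (z • X - Y) = z • dropCol X - dropCol Y := rfl
    by_cases hw : w ∈ Sᶜ
    · simp only [F, Ψ, Set.indicator_of_mem hw, e, detSq_insRow_single, e2, enorm_mul, mul_pow]
      rw [enorm_sq_eq_ofReal (t : ℂ), Complex.norm_real, Real.norm_of_nonneg ht.le, pow_one]
      refine le_of_eq ?_
      ring
    · simp [F, Ψ, Set.indicator_of_notMem hw]

/-- The first deflation, with k = 0: an eigenvalue in S does not contribute to the count in the
complement, so that count is the same for the smaller pair. Its Jacobian weight is the input of the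
second deflation. -/
theorem lintegral_pair_le {m : ℕ} {S : Set ℂ} (hS : IsOpen S) :
    ∫⁻ z in S, ∫⁻ w in Sᶜ, ENNReal.ofReal (((m + 2 : ℕ) : ℝ) ^ 2 *
      (stereoDensity z * (stereoDensity w * (1 - overlap z w ^ (m + 1))))) ≤
    ∫⁻ A, ∫⁻ B, (eigCount S A B : ENNReal) * eigCount Sᶜ A B
      ∂gaussMat (m + 2) (m + 2) ∂gaussMat (m + 2) (m + 2) := by
  let F : (Fin (m + 2) → Fin (m + 2) → ℂ) → (Fin (m + 2) → Fin (m + 2) → ℂ) → ℂ → ENNReal :=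
    fun A B => S.indicator fun _ => (eigCount Sᶜ A B : ENNReal)
  let Ψ : (Fin (m + 1) → Fin (m + 1) → ℂ) → (Fin (m + 1) → Fin (m + 1) → ℂ) → ℂ → ENNReal :=
    fun A B => S.indicator fun _ => (eigCount Sᶜ A B : ENNReal)
  have hcm : ∀ k, Measurable fun r : (Fin k → Fin k → ℂ) × (Fin k → Fin k → ℂ) =>
      (eigCount Sᶜ r.1 r.2 : ENNReal) := fun k =>
    (measurable_from_top (f := ((↑) : ℕ → ENNReal))).comp (measurable_eigCount_compl hS)
  have hcm' : ∀ k, Measurable fun r : (Fin k → Fin k → ℂ) × (Fin k → Fin k → ℂ) =>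
      (eigCount S r.1 r.2 : ENNReal) := fun k =>
    (measurable_from_top (f := ((↑) : ℕ → ENNReal))).comp (measurable_eigCount_of_isOpen hS)
  have hFm : Measurable fun r : ((Fin (m + 2) → Fin (m + 2) → ℂ) ×
      (Fin (m + 2) → Fin (m + 2) → ℂ)) × ℂ => F r.1.1 r.1.2 r.2 :=
    ((hcm (m + 2)).comp measurable_fst).indicator (measurable_snd hS.measurableSet)
  have hΨm : Measurable fun r : ((Fin (m + 1) → Fin (m + 1) → ℂ) ×
      (Fin (m + 1) → Fin (m + 1) → ℂ)) × ℂ => Ψ r.1.1 r.1.2 r.2 :=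
    ((hcm (m + 1)).comp measurable_fst).indicator (measurable_snd hS.measurableSet)
  have hsum : ∀ A B, ((eigs A B).map (F A B)).sum =
      (eigCount S A B : ENNReal) * eigCount Sᶜ A B :=
    fun A B => sum_map_indicator_mul_eigCount _ _ _ _
  have h := deflation_le F hFm (fun U hU A B w => ?_) (fun W hW A B w => ?_) ?_ 0 Ψ hΨm
    (fun t ht X Y w hX => ?_)
  · simp_rw [hsum] at h
    refine le_trans ?_ h
    rw [← lintegral_indicator hS.measurableSet, ← lintegral_const_mul' _ _ ENNReal.ofReal_ne_top]
    refine lintegral_mono fun z => ?_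
    by_cases hz : z ∈ S
    · have e1 : ∀ A B, Ψ A B z = eigCount Sᶜ A B := fun A B => Set.indicator_of_mem hz _
      simp_rw [e1]
      rw [Set.indicator_of_mem hz, lintegral_nsq_mul_vecDensity, ← mul_assoc]
      refine le_trans (le_of_eq ?_)
        (mul_le_mul_right (lintegral_detSq_mul_eigCount_ge hS z) _)
      rw [← ENNReal.ofReal_mul (by positivity), ← lintegral_const_mul' _ _ ENNReal.ofReal_ne_top]
      refine lintegral_congr fun w => ?_
      rw [← ENNReal.ofReal_mul (by positivity), stereoDensity, Nat.factorial_succ (m + 1)]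
      congr 1
      have := (m + 1).factorial_ne_zero
      push_cast
      field_simp
      ring
    · rw [Set.indicator_of_notMem hz]
      exact zero_le
  · simp only [F, eigCount, eigs_lmul hU]
  · simp only [F, eigCount, eigs_vecMul hW]
  · simp_rw [hsum]
    exact (hcm' _).mul (hcm _)
  · by_cases hw : w ∈ S
    · have ht' : (t : ℂ) ≠ 0 := by exact_mod_cast ht.ne'
      have hw' : w ∉ Sᶜ := fun h => h hw
      simp only [F, Ψ, Set.indicator_of_mem hw, eigCount_insRow Sᶜ ht' w hX,
        Set.indicator_of_notMem hw', pow_zero, one_mul, add_zero, le_refl]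
    · simp [F, Ψ, Set.indicator_of_notMem hw]

/-! ### The uniform measure in the stereographic coordinate -/

/-- The measure on `ℂ` that corresponds to the uniform measure on the sphere. -/
noncomputable def stereoMeasure : Measure ℂ :=
  volume.withDensity fun z => ENNReal.ofReal (stereoDensity z)

theorem lintegral_stereoMeasure (f : ℂ → ENNReal) :
    ∫⁻ z, f z ∂stereoMeasure = ∫⁻ z, ENNReal.ofReal (stereoDensity z) * f z := by
  rw [stereoMeasure, lintegral_withDensity_eq_lintegral_mul_non_measurable _
    continuous_stereoDensity.measurable.ennreal_ofReal (.of_forall fun _ => ENNReal.ofReal_lt_top)]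
  rfl

theorem lintegral_complex_mul (a : ℂ) (ha : a ≠ 0) (f : ℂ → ENNReal) :
    ∫⁻ z, f z = ENNReal.ofReal (‖a‖ ^ 2) * ∫⁻ z, f (a * z) := by
  have h := lintegral_linear_add (volume : Measure ℂ) (LinearMap.mulLeft ℂ a)
    (by simp [LinearMap.det_ring, ha]) 0 f
  have hd : LinearMap.det (LinearMap.mulLeft ℂ a) = a := by simp [LinearMap.det_ring]
  simp only [LinearMap.mulLeft_apply, add_zero, hd] at h
  rw [h, ← enorm_sq_eq_ofReal, ← mul_assoc, ENNReal.mul_inv_cancel, one_mul]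
  · simp [ha]
  · exact ENNReal.pow_ne_top enorm_ne_top

/-- The quotient of two independent Gaussians. -/
theorem lintegral_gaussian_homogeneous (g : ℂ → ℂ → ENNReal)
    (hg : Measurable fun r : ℂ × ℂ => g r.1 r.2)
    (hhom : ∀ c a b, c ≠ 0 → g (c * a) (c * b) = g a b) :
    ∫⁻ a, ∫⁻ b, g a b ∂complexGaussian ∂complexGaussian = ∫⁻ z, g 1 z ∂stereoMeasure := by
  let ρ : ℂ → ENNReal := fun z => ENNReal.ofReal (Real.exp (-‖z‖ ^ 2) / Real.pi)
  have hρ : Measurable ρ := by fun_prop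
  have hG : ∀ f : ℂ → ENNReal, ∫⁻ a, f a ∂complexGaussian = ∫⁻ a, ρ a * f a := fun f => by
    rw [complexGaussian, lintegral_withDensity_eq_lintegral_mul_non_measurable _ hρ
      (.of_forall fun _ => ENNReal.ofReal_lt_top)]
    rfl
  have hg1 : Measurable fun z => g 1 z := hg.comp (measurable_const.prodMk measurable_id)
  have h0 : ∀ᵐ a : ℂ, a ≠ 0 := by
    rw [ae_iff]
    simp
  -- The substitution b = a z has Jacobian |a|²; the Gaussian integral over a then produces the
  -- density of the quotient.
  have e1 : ∀ a : ℂ, a ≠ 0 → ρ a * ∫⁻ b, ρ b * g a b =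
      ∫⁻ z, ρ a * (ENNReal.ofReal (‖a‖ ^ 2) * (ρ (a * z) * g 1 z)) := by
    intro a ha
    rw [lintegral_complex_mul a ha, lintegral_const_mul' _ _ ENNReal.ofReal_ne_top,
      lintegral_const_mul' _ _ ENNReal.ofReal_ne_top]
    congr 3
    ext1 z
    rw [← hhom a 1 z ha, mul_one]
  simp_rw [hG]
  rw [lintegral_congr_ae (h0.mono e1), lintegral_lintegral_swap, lintegral_stereoMeasure]
  · refine lintegral_congr fun z => ?_
    have e2 : ∀ a : ℂ, ρ a * (ENNReal.ofReal (‖a‖ ^ 2) * (ρ (a * z) * g 1 z)) =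
        ENNReal.ofReal (1 / Real.pi ^ 2) * (ENNReal.ofReal ((‖a‖ ^ 2) ^ 1 *
          Real.exp (-((1 + ‖z‖ ^ 2) * ‖a‖ ^ 2)))) * g 1 z := by
      intro a
      rw [← mul_assoc, ← mul_assoc]
      congr 1
      simp only [ρ]
      rw [← ENNReal.ofReal_mul (by positivity), ← ENNReal.ofReal_mul (by positivity),
        ← ENNReal.ofReal_mul (by positivity), norm_mul,
        show -((1 + ‖z‖ ^ 2) * ‖a‖ ^ 2) = -‖a‖ ^ 2 + -(‖a‖ * ‖z‖) ^ 2 by ring, Real.exp_add]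
      congr 1
      field_simp
    simp_rw [e2]
    rw [lintegral_mul_const _ (by fun_prop), lintegral_const_mul _ (by fun_prop),
      lintegral_normSq (fun s => ENNReal.ofReal (s ^ 1 * Real.exp (-((1 + ‖z‖ ^ 2) * s))))
        (by fun_prop), lintegral_pow_mul_exp 1 (by positivity),
      ← ENNReal.ofReal_mul (by positivity), ← ENNReal.ofReal_mul (by positivity)]
    congr 2
    rw [stereoDensity]
    simp
    field_simp
  · refine Measurable.aemeasurable ?_
    have : Measurable fun r : ℂ × ℂ => g 1 r.2 := hg1.comp measurable_snd
    unfold Function.uncurry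
    fun_prop

theorem lintegral_gaussVec_two (G : ℂ → ℂ → ENNReal)
    (hG : Measurable fun r : ℂ × ℂ => G r.1 r.2) :
    ∫⁻ x, G (x 0) (x 1) ∂gaussVec 2 = ∫⁻ a, ∫⁻ b, G a b ∂complexGaussian ∂complexGaussian := by
  have h1 : Measurable fun x : Fin 2 → ℂ => G (x 0) (x 1) :=
    hG.comp (f := fun x : Fin 2 → ℂ => (x 0, x 1)) (by fun_prop)
  rw [gaussVec, lintegral_pi_cons _ _ h1]
  refine lintegral_congr fun a => ?_
  have h2 : Measurable fun x : Fin 1 → ℂ => G a (x 0) :=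
    hG.comp (f := fun x : Fin 1 → ℂ => (a, x 0)) (by fun_prop)
  refine (lintegral_pi_cons complexGaussian _ h2).trans ?_
  simp

/-- The squared overlap with a fixed line is uniformly distributed. -/
theorem lintegral_stereoMeasure_overlap (f : ℝ → ENNReal) (hf : Measurable f) {p q : ℂ}
    (hpq : ‖p‖ ^ 2 + ‖q‖ ^ 2 = 1) :
    ∫⁻ z, f (‖p + q * z‖ ^ 2 / (1 + ‖z‖ ^ 2)) ∂stereoMeasure = ∫⁻ r in Set.Ioo 0 1, f r := by
  have hom : ∀ p q : ℂ, ∫⁻ a, ∫⁻ b, f (‖p * a + q * b‖ ^ 2 / (‖a‖ ^ 2 + ‖b‖ ^ 2)) ∂complexGaussian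
      ∂complexGaussian = ∫⁻ z, f (‖p + q * z‖ ^ 2 / (1 + ‖z‖ ^ 2)) ∂stereoMeasure := by
    intro p q
    rw [lintegral_gaussian_homogeneous _ (by fun_prop)]
    · simp
    · intro c a b hc
      congr 1
      have h1 : p * (c * a) + q * (c * b) = c * (p * a + q * b) := by ring
      rw [h1, norm_mul, norm_mul, norm_mul, mul_pow, mul_pow, mul_pow, ← mul_add,
        mul_div_mul_left _ _ (by positivity)]
  -- Lifted to a Gaussian vector in ℂ², the quantity is the squared length of the component along a
  -- unit vector. Rotating by W reduces it to p = 1, q = 0.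
  let W : Matrix (Fin 2) (Fin 2) ℂ := !![p, -starRingEnd ℂ q; q, starRingEnd ℂ p]
  have hpq' : p * starRingEnd ℂ p + q * starRingEnd ℂ q = 1 := by
    rw [Complex.mul_conj, Complex.mul_conj, Complex.normSq_eq_norm_sq, Complex.normSq_eq_norm_sq]
    exact_mod_cast hpq
  have hW : W ∈ Matrix.unitaryGroup (Fin 2) ℂ := by
    rw [Matrix.mem_unitaryGroup_iff']
    ext i j
    fin_cases i <;> fin_cases j <;>
      simp [W, Matrix.mul_apply, Fin.sum_univ_two, Matrix.star_apply]
    · linear_combination hpq'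
    · ring
    · ring
    · linear_combination hpq'
  have hrot : ∫⁻ a, ∫⁻ b, f (‖p * a + q * b‖ ^ 2 / (‖a‖ ^ 2 + ‖b‖ ^ 2)) ∂complexGaussian
      ∂complexGaussian = ∫⁻ a, ∫⁻ b, f (‖1 * a + 0 * b‖ ^ 2 / (‖a‖ ^ 2 + ‖b‖ ^ 2)) ∂complexGaussian
      ∂complexGaussian := by
    rw [← lintegral_gaussVec_two _ (by fun_prop), ← lintegral_gaussVec_two _ (by fun_prop),
      eq_comm, ← (measurePreserving_vecMul hW).lintegral_comp (by fun_prop)]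
    refine lintegral_congr fun x => ?_
    have h := nsq_vecMul_unitary hW x
    simp only [nsq, Fin.sum_univ_two] at h
    rw [h]
    congr 4
    simp [W, Matrix.vecMul, dotProduct, Fin.sum_univ_two]
    ring
  rw [← hom, hrot, hom, lintegral_stereoMeasure]
  have e1 := lintegral_normSq (fun s => ENNReal.ofReal (1 / (Real.pi * (1 + s) ^ 2)) *
    f (1 / (1 + s))) (by fun_prop)
  simp only [stereoDensity, zero_mul, add_zero, norm_one, one_pow]
  rw [e1, ← lintegral_const_mul _ (by fun_prop)]
  -- With s = |z|² the radial density is 1/(1 + s)², minus the derivative of r = 1/(1 + s); hence r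
  -- is uniform.
  have himg : (fun s : ℝ => 1 / (1 + s)) '' Set.Ioi 0 = Set.Ioo 0 1 := by
    ext r
    constructor
    · rintro ⟨s, hs, rfl⟩
      have hs' : 0 < s := hs
      exact ⟨by positivity, by rw [div_lt_one (by positivity)]; linarith⟩
    · rintro ⟨h0, h1⟩
      refine ⟨1 / r - 1, ?_, ?_⟩
      · rw [Set.mem_Ioi, sub_pos, lt_div_iff₀ h0]
        linarith
      · simp
  rw [← himg, lintegral_image_eq_lintegral_abs_deriv_mul measurableSet_Ioi
    (f' := fun s => -1 / (1 + s) ^ 2)]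
  · refine setLIntegral_congr_fun measurableSet_Ioi fun s hs => ?_
    have hs' : 0 < s := hs
    rw [← mul_assoc, ← ENNReal.ofReal_mul (by positivity)]
    congr 2
    rw [abs_div, abs_neg, abs_one, abs_of_pos (by positivity)]
    field_simp
  · intro s hs
    have hs' : 0 < s := hs
    have h : HasDerivAt (fun s : ℝ => 1 + s) 1 s := (hasDerivAt_id s).const_add 1
    have := (h.fun_inv (by positivity)).hasDerivWithinAt (s := Set.Ioi 0)
    simpa [one_div] using this
  · intro s hs t ht h
    have hs' : 0 < s := hs
    have ht' : 0 < t := ht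
    simp only [one_div, inv_inj] at h
    linarith

/-! ### Spherical caps -/

theorem continuous_invStereo : Continuous invStereo := by
  refine Continuous.subtype_mk ?_ _
  refine (PiLp.continuous_toLp 2 _).comp (continuous_pi fun i => ?_)
  have h : ∀ z : ℂ, ‖z‖ ^ 2 + 1 ≠ 0 := fun z => by positivity
  fin_cases i
  · exact Continuous.div (f := fun z : ℂ => 2 * z.re) (by fun_prop) (by fun_prop) h
  · exact Continuous.div (f := fun z : ℂ => 2 * z.im) (by fun_prop) (by fun_prop) h
  · exact Continuous.div (f := fun z : ℂ => ‖z‖ ^ 2 - 1) (by fun_prop) (by fun_prop) h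

theorem inner_sph_eq (x y : Sph 2) : inner ℝ (x : EuclideanSpace ℝ (Fin 3)) y =
    (x : EuclideanSpace ℝ (Fin 3)) 0 * (y : EuclideanSpace ℝ (Fin 3)) 0 +
    (x : EuclideanSpace ℝ (Fin 3)) 1 * (y : EuclideanSpace ℝ (Fin 3)) 1 +
    (x : EuclideanSpace ℝ (Fin 3)) 2 * (y : EuclideanSpace ℝ (Fin 3)) 2 := by
  simp only [PiLp.inner_apply, RCLike.inner_apply, conj_trivial]
  refine (Fin.sum_univ_three _).trans ?_
  ring

theorem sum_sq_sph (x : Sph 2) : (x : EuclideanSpace ℝ (Fin 3)) 0 ^ 2 +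
    (x : EuclideanSpace ℝ (Fin 3)) 1 ^ 2 + (x : EuclideanSpace ℝ (Fin 3)) 2 ^ 2 = 1 := by
  have h := real_inner_self_eq_norm_sq (x : EuclideanSpace ℝ (Fin 3))
  rw [inner_sph_eq x x, norm_eq_of_mem_sphere x] at h
  linarith

theorem inner_invStereo (x : Sph 2) (z : ℂ) :
    inner ℝ (x : EuclideanSpace ℝ (Fin 3)) (invStereo z) =
    (2 * (x : EuclideanSpace ℝ (Fin 3)) 0 * z.re + 2 * (x : EuclideanSpace ℝ (Fin 3)) 1 * z.im +
      (x : EuclideanSpace ℝ (Fin 3)) 2 * (‖z‖ ^ 2 - 1)) / (‖z‖ ^ 2 + 1) := by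
  rw [inner_sph_eq]
  simp only [invStereo, PiLp.toLp_apply, Matrix.cons_val_zero, Matrix.cons_val_one, Matrix.cons_val]
  ring

/-- A point of the sphere is a line in ℂ², and (1 + ⟨x, y⟩)/2 is the squared overlap of two lines.
This form also covers the north pole, which has no stereographic coordinate and corresponds to p =
0, q = 1. -/
theorem exists_overlap_eq (x : Sph 2) : ∃ p q : ℂ, ‖p‖ ^ 2 + ‖q‖ ^ 2 = 1 ∧ ∀ z : ℂ,
    (1 + inner ℝ (x : EuclideanSpace ℝ (Fin 3)) (invStereo z)) / 2 =
      ‖p + q * z‖ ^ 2 / (1 + ‖z‖ ^ 2) := by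
  have hx := sum_sq_sph x
  simp_rw [inner_invStereo]
  set a := (x : EuclideanSpace ℝ (Fin 3)) 0
  set b := (x : EuclideanSpace ℝ (Fin 3)) 1
  set c := (x : EuclideanSpace ℝ (Fin 3)) 2
  have hz : ∀ z : ℂ, ‖z‖ ^ 2 = z.re ^ 2 + z.im ^ 2 := fun z => by
    rw [Complex.sq_norm, Complex.normSq_apply]; ring
  have hc : c ≤ 1 := by nlinarith [sq_nonneg a, sq_nonneg b]
  rcases hc.eq_or_lt with hc | hc
  · have ha : a = 0 := by nlinarith [sq_nonneg a, sq_nonneg b]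
    have hb : b = 0 := by nlinarith [sq_nonneg a, sq_nonneg b]
    refine ⟨0, 1, by simp, fun z => ?_⟩
    have : 1 + ‖z‖ ^ 2 ≠ 0 := by positivity
    rw [ha, hb, hc, add_comm (‖z‖ ^ 2) 1]
    field_simp
    simp only [zero_add]
    ring
  · set s := Real.sqrt ((1 - c) / 2)
    have hs2 : s ^ 2 = (1 - c) / 2 := Real.sq_sqrt (by linarith)
    have hs : s ≠ 0 := (Real.sqrt_pos.2 (by linarith)).ne'
    refine ⟨s, ⟨a / (2 * s), -b / (2 * s)⟩, ?_, fun z => ?_⟩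
    · rw [hz, hz]
      simp only [Complex.ofReal_re, Complex.ofReal_im, div_pow, mul_pow, hs2]
      have : 1 - c ≠ 0 := by linarith
      field_simp
      linear_combination hx
    · have h1 : 1 + ‖z‖ ^ 2 ≠ 0 := by positivity
      rw [hz (_ + _), add_comm (‖z‖ ^ 2) 1, hz z] at *
      simp only [Complex.add_re, Complex.add_im, Complex.mul_re, Complex.mul_im,
        Complex.ofReal_re, Complex.ofReal_im]
      have e1 : (s + (a / (2 * s) * z.re - -b / (2 * s) * z.im)) ^ 2 +
          (0 + (a / (2 * s) * z.im + -b / (2 * s) * z.re)) ^ 2 =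
          s ^ 2 + a * z.re + b * z.im + (a ^ 2 + b ^ 2) / (4 * s ^ 2) * (z.re ^ 2 + z.im ^ 2) := by
        field_simp
        ring
      have e2 : (a ^ 2 + b ^ 2) / (4 * s ^ 2) = (1 + c) / 2 := by
        have : 1 - c ≠ 0 := by linarith
        rw [hs2]
        field_simp
        linear_combination 4 * hx
      rw [e1, e2, hs2]
      field_simp
      ring

theorem overlap_eq (z w : ℂ) : overlap z w =
    (1 + inner ℝ (invStereo z : EuclideanSpace ℝ (Fin 3)) (invStereo w)) / 2 := by
  have hz : ∀ z : ℂ, ‖z‖ ^ 2 = z.re ^ 2 + z.im ^ 2 := fun z => by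
    rw [Complex.sq_norm, Complex.normSq_apply]; ring
  have h1 : 1 + ‖z‖ ^ 2 ≠ 0 := by positivity
  have h2 : 1 + ‖w‖ ^ 2 ≠ 0 := by positivity
  rw [inner_invStereo, overlap]
  simp only [invStereo, PiLp.toLp_apply, Matrix.cons_val_zero, Matrix.cons_val_one, Matrix.cons_val]
  rw [add_comm (‖z‖ ^ 2) 1, add_comm (‖w‖ ^ 2) 1]
  field_simp
  rw [hz (_ + _), hz z, hz w]
  simp only [Complex.add_re, Complex.add_im, Complex.mul_re, Complex.mul_im, Complex.conj_re,
    Complex.conj_im, Complex.one_re, Complex.one_im]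
  ring

theorem mem_cap_comm {d : ℕ} (x y : Sph d) (φ : ℝ) : y ∈ cap x φ ↔ x ∈ cap y φ := by
  simp only [cap, Set.mem_ofPred_eq, real_inner_comm]

theorem isOpen_mem_cap {d : ℕ} (φ : ℝ) : IsOpen {p : Sph d × Sph d | p.2 ∈ cap p.1 φ} :=
  isOpen_lt (f := fun _ : Sph d × Sph d => Real.cos φ)
    (g := fun p : Sph d × Sph d => inner ℝ (p.1 : EuclideanSpace ℝ (Fin (d + 1))) p.2)
    continuous_const (by fun_prop)

theorem stereoMeasure_cap (x : Sph 2) (φ : ℝ) :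
    stereoMeasure {z | invStereo z ∈ cap x φ} = ENNReal.ofReal ((1 - Real.cos φ) / 2) := by
  obtain ⟨p, q, hpq, h⟩ := exists_overlap_eq x
  have hm : MeasurableSet {z | invStereo z ∈ cap x φ} :=
    continuous_invStereo.measurable (measurableSet_cap x φ)
  have hE := lintegral_stereoMeasure_overlap ((Set.Ioi ((1 + Real.cos φ) / 2)).indicator 1)
    (measurable_one.indicator measurableSet_Ioi) hpq
  have e1 : ∀ z, (Set.Ioi ((1 + Real.cos φ) / 2)).indicator (1 : ℝ → ENNReal)
      (‖p + q * z‖ ^ 2 / (1 + ‖z‖ ^ 2)) = {z | invStereo z ∈ cap x φ}.indicator 1 z := by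
    intro z
    rw [← h]
    have : (1 + inner ℝ (x : EuclideanSpace ℝ (Fin 3)) (invStereo z)) / 2 ∈
        Set.Ioi ((1 + Real.cos φ) / 2) ↔ z ∈ {z | invStereo z ∈ cap x φ} := by
      simp only [Set.mem_Ioi, cap, Set.mem_ofPred_eq]
      constructor <;> intro h <;> linarith
    by_cases hz : z ∈ {z | invStereo z ∈ cap x φ}
    · rw [Set.indicator_of_mem hz, Set.indicator_of_mem (this.2 hz)]
      rfl
    · rw [Set.indicator_of_notMem hz, Set.indicator_of_notMem fun h => hz (this.1 h)]
  simp_rw [e1] at hE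
  rw [lintegral_indicator_one hm, lintegral_indicator_one measurableSet_Ioi,
    Measure.restrict_apply measurableSet_Ioi] at hE
  have h0 := Real.neg_one_le_cos φ
  have e2 : Set.Ioi ((1 + Real.cos φ) / 2) ∩ Set.Ioo 0 1 = Set.Ioo ((1 + Real.cos φ) / 2) 1 := by
    ext r
    simp only [Set.mem_inter_iff, Set.mem_Ioi, Set.mem_Ioo]
    constructor
    · rintro ⟨h1, h2, h3⟩
      exact ⟨h1, h3⟩
    · rintro ⟨h1, h2⟩
      exact ⟨h1, by linarith, h2⟩
  rw [hE, e2, Real.volume_Ioo]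
  congr 1
  ring

instance isProbabilityMeasure_stereoMeasure : IsProbabilityMeasure stereoMeasure := by
  refine ⟨?_⟩
  have h := lintegral_stereoMeasure_overlap (fun _ => 1) measurable_const (p := 1) (q := 0)
    (by simp)
  simpa using h

/-- Compute the probability that a uniform centre and an independent point with law `stereoMeasure`
are within angle φ, by fixing either of them. The surface measure itself is never parametrised; only
the independence of the cap area from the centre is used. -/
theorem capArea_eq (φ : ℝ) : capArea 2 φ = (1 - Real.cos φ) / 2 := by
  have h0 := Real.cos_le_one φ
  have hm : MeasurableSet {p : Sph 2 × ℂ | invStereo p.2 ∈ cap p.1 φ} :=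
    ((isOpen_mem_cap φ).preimage
      (continuous_fst.prodMk (continuous_invStereo.comp continuous_snd))).measurableSet
  have h1 := Measure.prod_apply (μ := sphMeasure 2) (ν := stereoMeasure) hm
  have h2 := Measure.prod_apply_symm (μ := sphMeasure 2) (ν := stereoMeasure) hm
  rw [h1] at h2
  have e1 : ∀ x : Sph 2, stereoMeasure (Prod.mk x ⁻¹' {p : Sph 2 × ℂ | invStereo p.2 ∈ cap p.1 φ}) =
      ENNReal.ofReal ((1 - Real.cos φ) / 2) := fun x => stereoMeasure_cap x φ
  have e2 : ∀ z : ℂ, sphMeasure 2 ((fun x => (x, z)) ⁻¹'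
      {p : Sph 2 × ℂ | invStereo p.2 ∈ cap p.1 φ}) = ENNReal.ofReal (capArea 2 φ) := by
    intro z
    rw [← sphMeasure_cap (invStereo z) φ, Measure.real, ENNReal.ofReal_toReal (measure_ne_top _ _)]
    congr 1
    ext x
    exact mem_cap_comm x (invStereo z) φ
  simp_rw [e1, e2] at h2
  rw [lintegral_const, lintegral_const, measure_univ, measure_univ, mul_one, mul_one] at h2
  exact ((ENNReal.ofReal_eq_ofReal_iff (by linarith) measureReal_nonneg).1 h2).symm

open InnerProductGeometry in
/-- The area of the difference of two caps. -/
theorem sphMeasure_cap_diff_le {φ : ℝ} (h0 : 0 ≤ φ) (hφ : φ ≤ Real.pi / 2) (x y : Sph 2) :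
    (sphMeasure 2).real (cap x φ \ cap y φ) ≤ Real.sin φ *
      Real.sqrt (1 - (1 + inner ℝ (x : EuclideanSpace ℝ (Fin 3)) y) / 2) := by
  have hpi := Real.pi_pos
  have hcos : ∀ u v : Sph 2, inner ℝ (u : EuclideanSpace ℝ (Fin 3)) v =
      Real.cos (angle (u : EuclideanSpace ℝ (Fin 3)) v) := fun u v => by
    rw [cos_angle, norm_eq_of_mem_sphere u, norm_eq_of_mem_sphere v]
    simp
  have hmem : ∀ (u v : Sph 2) (ψ : ℝ), 0 ≤ ψ → ψ ≤ Real.pi / 2 → (v ∈ cap u ψ ↔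
      angle (u : EuclideanSpace ℝ (Fin 3)) v < ψ) := fun u v ψ h1 h2 => by
    simp only [cap, Set.mem_ofPred_eq, hcos]
    exact Real.strictAntiOn_cos.lt_iff_gt ⟨h1, by linarith⟩ ⟨angle_nonneg _ _, angle_le_pi _ _⟩
  set θ := angle (x : EuclideanSpace ℝ (Fin 3)) y with hθ
  have hθ0 : 0 ≤ θ := angle_nonneg _ _
  have hθpi : θ ≤ Real.pi := angle_le_pi _ _
  have hs0 : 0 ≤ Real.sin (θ / 2) := Real.sin_nonneg_of_nonneg_of_le_pi (by linarith) (by linarith)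
  have hsφ : 0 ≤ Real.sin φ := Real.sin_nonneg_of_nonneg_of_le_pi h0 (by linarith)
  have hsqrt : Real.sqrt (1 - (1 + inner ℝ (x : EuclideanSpace ℝ (Fin 3)) y) / 2) =
      Real.sin (θ / 2) := by
    rw [hcos, ← hθ, ← Real.sqrt_sq hs0]
    congr 1
    have h1 := Real.cos_sq_add_sin_sq (θ / 2)
    have h2 := Real.cos_two_mul (θ / 2)
    rw [show 2 * (θ / 2) = θ by ring] at h2
    rw [h2]
    linarith
  have hsin2 : ∀ ψ : ℝ, Real.sin ψ = 2 * Real.sin (ψ / 2) * Real.cos (ψ / 2) := fun ψ => by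
    rw [← Real.sin_two_mul]
    ring_nf
  rw [hsqrt]
  rcases le_or_gt θ φ with h | h
  -- By the triangle inequality for angles, the cap of angle φ - θ around x lies in the cap around
  -- y, so the difference lies in an annulus of area (cos(φ - θ) - cos φ)/2.
  · have hsub : cap x φ \ cap y φ ⊆ cap x φ \ cap x (φ - θ) := by
      rintro z ⟨hz1, hz2⟩
      refine ⟨hz1, fun hz3 => hz2 ?_⟩
      rw [hmem _ _ _ (by linarith) (by linarith)] at hz3 ⊢
      have := angle_le_angle_add_angle (y : EuclideanSpace ℝ (Fin 3)) x z
      rw [angle_comm (y : EuclideanSpace ℝ (Fin 3)) x] at this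
      linarith
    have hsub2 : cap x (φ - θ) ⊆ cap x φ := by
      intro z hz
      rw [hmem _ _ _ (by linarith) (by linarith)] at hz ⊢
      linarith
    refine (measureReal_mono hsub).trans ?_
    rw [measureReal_sdiff hsub2 (measurableSet_cap _ _), sphMeasure_cap, sphMeasure_cap, capArea_eq,
      capArea_eq, Real.cos_sub]
    have h1 : 0 ≤ Real.cos φ := Real.cos_nonneg_of_mem_Icc ⟨by linarith, hφ⟩
    have h2 := Real.cos_le_one θ
    have h3 := Real.cos_le_one (θ / 2)
    have h4 : Real.sin θ ≤ 2 * Real.sin (θ / 2) := by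
      rw [hsin2 θ]
      nlinarith
    nlinarith
  -- For θ > φ the full cap area sin²(φ/2) suffices: one factor is at most sin(θ/2), the other at
  -- most sin φ because cos(φ/2) ≥ 1/2.
  · refine (measureReal_mono Set.sdiff_subset).trans ?_
    rw [sphMeasure_cap, capArea_eq]
    have h1 := Real.cos_sq_add_sin_sq (φ / 2)
    have h2 := Real.cos_two_mul (φ / 2)
    rw [show 2 * (φ / 2) = φ by ring] at h2
    have h3 : Real.sin (φ / 2) ≤ Real.sin (θ / 2) :=
      Real.sin_le_sin_of_le_of_le_pi_div_two (by linarith) (by linarith) (by linarith)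
    have h4 : 0 ≤ Real.sin (φ / 2) := Real.sin_nonneg_of_nonneg_of_le_pi (by linarith) (by linarith)
    have h5 : 1 / 2 ≤ Real.cos (φ / 2) := by
      rw [← Real.cos_pi_div_three]
      exact Real.cos_le_cos_of_nonneg_of_le_pi (by linarith) (by linarith) (by linarith)
    have h6 : Real.sin (φ / 2) ≤ Real.sin φ := by
      rw [hsin2 φ]
      nlinarith
    calc (1 - Real.cos φ) / 2 = Real.sin (φ / 2) * Real.sin (φ / 2) := by rw [h2]; linarith
      _ ≤ _ := mul_le_mul h6 h3 h4 hsφ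

/-! ### The expected number of pairs separated by a cap -/

/-- The stereographic image of the cap `C(x, φ)`. -/
def planeCap (φ : ℝ) (x : Sph 2) : Set ℂ := {z | invStereo z ∈ cap x φ}

theorem isOpen_planeCap_prod (φ : ℝ) : IsOpen {p : ℂ × Sph 2 | p.1 ∈ planeCap φ p.2} :=
  (isOpen_mem_cap φ).preimage (continuous_snd.prodMk (continuous_invStereo.comp continuous_fst))

theorem isOpen_planeCap (φ : ℝ) (x : Sph 2) : IsOpen (planeCap φ x) :=
  (isOpen_planeCap_prod φ).preimage (f := fun z : ℂ => (z, x)) (by fun_prop)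

theorem setLIntegral_stereoMeasure {S : Set ℂ} (hS : MeasurableSet S) (f : ℂ → ENNReal) :
    ∫⁻ z in S, f z ∂stereoMeasure = ∫⁻ z in S, ENNReal.ofReal (stereoDensity z) * f z := by
  rw [stereoMeasure, setLIntegral_withDensity_eq_setLIntegral_mul_non_measurable _
    continuous_stereoDensity.measurable.ennreal_ofReal f hS
    (.of_forall fun _ => ENNReal.ofReal_lt_top)]
  rfl

@[fun_prop]
theorem Measurable.overlap {α : Type*} [MeasurableSpace α] {f g : α → ℂ} (hf : Measurable f)
    (hg : Measurable g) : Measurable fun x => overlap (f x) (g x) := by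
  unfold _root_.overlap
  fun_prop

theorem overlap_nonneg (z w : ℂ) : 0 ≤ overlap z w := by
  unfold overlap; positivity

theorem overlap_le_one (z w : ℂ) : overlap z w ≤ 1 := by
  have h := real_inner_le_norm (invStereo z : EuclideanSpace ℝ (Fin 3)) (invStereo w)
  rw [norm_eq_of_mem_sphere, norm_eq_of_mem_sphere] at h
  rw [overlap_eq]
  linarith

/-- The negative part of the pair density is moved to the other side, which avoids subtraction in
`ENNReal`. -/
theorem lintegral_pair_ge {m : ℕ} {S : Set ℂ} (hS : IsOpen S) :
    ENNReal.ofReal (((m + 2 : ℕ) : ℝ) ^ 2) * (stereoMeasure S * stereoMeasure Sᶜ) ≤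
    ∫⁻ A, ∫⁻ B, (eigCount S A B : ENNReal) * eigCount Sᶜ A B
      ∂gaussMat (m + 2) (m + 2) ∂gaussMat (m + 2) (m + 2) +
    ENNReal.ofReal (((m + 2 : ℕ) : ℝ) ^ 2) * ∫⁻ z in S, ∫⁻ w in Sᶜ,
      ENNReal.ofReal (overlap z w ^ (m + 1)) ∂stereoMeasure ∂stereoMeasure := by
  have hSm := hS.measurableSet
  refine le_trans ?_ (add_le_add_left (lintegral_pair_le (m := m) hS) _)
  have e1 : ∫⁻ z in S, ∫⁻ w in Sᶜ, ENNReal.ofReal (((m + 2 : ℕ) : ℝ) ^ 2 *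
      (stereoDensity z * (stereoDensity w * (1 - overlap z w ^ (m + 1))))) =
      ENNReal.ofReal (((m + 2 : ℕ) : ℝ) ^ 2) * ∫⁻ z in S, ∫⁻ w in Sᶜ,
      ENNReal.ofReal (1 - overlap z w ^ (m + 1)) ∂stereoMeasure ∂stereoMeasure := by
    rw [setLIntegral_stereoMeasure hSm, ← lintegral_const_mul' _ _ ENNReal.ofReal_ne_top]
    refine lintegral_congr fun z => ?_
    rw [setLIntegral_stereoMeasure hSm.compl, ← lintegral_const_mul' _ _ ENNReal.ofReal_ne_top,
      ← lintegral_const_mul' _ _ ENNReal.ofReal_ne_top]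
    refine lintegral_congr fun w => ?_
    rw [← ENNReal.ofReal_mul (stereoDensity_nonneg w), ← ENNReal.ofReal_mul (stereoDensity_nonneg z),
      ← ENNReal.ofReal_mul (by positivity)]
  rw [e1, ← mul_add]
  gcongr
  have hm : Measurable fun r : ℂ × ℂ => ENNReal.ofReal (overlap r.1 r.2 ^ (m + 1)) := by fun_prop
  have hm2 : Measurable fun z => ∫⁻ w in Sᶜ, ENNReal.ofReal (overlap z w ^ (m + 1))
      ∂stereoMeasure := hm.lintegral_prod_right'
  rw [← lintegral_add_right _ hm2]
  have e2 : ∀ z, ∫⁻ w in Sᶜ, ENNReal.ofReal (1 - overlap z w ^ (m + 1)) ∂stereoMeasure +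
      ∫⁻ w in Sᶜ, ENNReal.ofReal (overlap z w ^ (m + 1)) ∂stereoMeasure = stereoMeasure Sᶜ := by
    intro z
    have hmz : Measurable fun w => ENNReal.ofReal (overlap z w ^ (m + 1)) := by fun_prop
    rw [← lintegral_add_right _ hmz]
    have e3 : ∀ w, ENNReal.ofReal (1 - overlap z w ^ (m + 1)) +
        ENNReal.ofReal (overlap z w ^ (m + 1)) = 1 := fun w => by
      have h1 := pow_le_one₀ (n := m + 1) (overlap_nonneg z w) (overlap_le_one z w)
      rw [← ENNReal.ofReal_add (by linarith) (pow_nonneg (overlap_nonneg z w) _),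
        sub_add_cancel, ENNReal.ofReal_one]
    simp_rw [e3]
    simp
  simp_rw [e2]
  simp [mul_comm]

/-- The arithmetic-geometric mean inequality √(1 - r) ≤ (1/s + s(1 - r))/2 makes the integrand
polynomial. The typical size of 1 - r is 1/(k + 1), which suggests s = √(k + 1). -/
theorem lintegral_sqrt_mul_pow_le (k : ℕ) :
    ∫⁻ r in Set.Ioo (0 : ℝ) 1, ENNReal.ofReal (Real.sqrt (1 - r) * r ^ k) ≤
      ENNReal.ofReal (1 / ((k + 1) * Real.sqrt (k + 1))) := by
  set s := Real.sqrt (k + 1) with hs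
  have hs2 : s ^ 2 = k + 1 := Real.sq_sqrt (by positivity)
  have hsp : 0 < s := Real.sqrt_pos.2 (by positivity)
  let f : ℝ → ℝ := fun r => (1 / s + s) / 2 * r ^ k - s / 2 * r ^ (k + 1)
  have hf : ∀ r ∈ Set.Ioo (0 : ℝ) 1, Real.sqrt (1 - r) * r ^ k ≤ f r := by
    rintro r ⟨h0, h1⟩
    set q := Real.sqrt (1 - r)
    have hq : q ^ 2 = 1 - r := Real.sq_sqrt (by linarith)
    have h2 : q ≤ (1 / s + s * (1 - r)) / 2 := by
      rw [← hq]
      have : 0 ≤ (1 / s) * (1 - s * q) ^ 2 := by positivity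
      have e : (1 / s) * (1 - s * q) ^ 2 = 1 / s + s * q ^ 2 - 2 * q := by
        field_simp
        ring
      linarith
    have h3 := mul_le_mul_of_nonneg_right h2 (pow_nonneg h0.le k)
    refine h3.trans_eq ?_
    simp only [f, pow_succ]
    ring
  have hfi : IntervalIntegrable f volume 0 1 := by
    apply Continuous.intervalIntegrable
    fun_prop
  have hI : ∫ r in (0 : ℝ)..1, f r = (1 / s + s) / 2 * (1 / (k + 1)) - s / 2 * (1 / (k + 2)) := by
    simp only [f]
    rw [intervalIntegral.integral_sub, intervalIntegral.integral_const_mul,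
      intervalIntegral.integral_const_mul, integral_pow, integral_pow,
      one_pow, one_pow, zero_pow (by omega), zero_pow (by omega)]
    · push_cast
      ring
    · apply Continuous.intervalIntegrable; fun_prop
    · apply Continuous.intervalIntegrable; fun_prop
  calc _ ≤ ∫⁻ r in Set.Ioo (0 : ℝ) 1, ENNReal.ofReal (f r) :=
        setLIntegral_mono' measurableSet_Ioo fun r hr => ENNReal.ofReal_le_ofReal (hf r hr)
    _ = ENNReal.ofReal (∫ r in Set.Ioo (0 : ℝ) 1, f r) := by
        rw [ofReal_integral_eq_lintegral_ofReal]
        · exact ((intervalIntegrable_iff_integrableOn_Ioc_of_le zero_le_one).1 hfi).mono_set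
            Set.Ioo_subset_Ioc_self
        · refine (ae_restrict_iff' measurableSet_Ioo).2 (.of_forall fun r hr => ?_)
          exact le_trans (mul_nonneg (Real.sqrt_nonneg _) (pow_nonneg hr.1.le _)) (hf r hr)
    _ ≤ _ := by
        apply ENNReal.ofReal_le_ofReal
        rw [← integral_Ioc_eq_integral_Ioo, ← intervalIntegral.integral_of_le zero_le_one, hI]
        have h1 : (1 / s + s) / 2 * (1 / (k + 1)) - s / 2 * (1 / (k + 2)) =
            1 / ((k + 1) * s) * ((1 + (k + 1 : ℝ) / (k + 2)) / 2) := by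
          rw [← hs2]
          have : (k + 2 : ℝ) = s ^ 2 + 1 := by linarith
          rw [this]
          field_simp
          ring
        rw [h1]
        have h2 : (k + 1 : ℝ) / (k + 2) ≤ 1 := by
          rw [div_le_one (by positivity)]
          linarith
        have h3 : 0 ≤ 1 / ((k + 1) * s) := by positivity
        nlinarith

/-- Integrate over the centre first: the centres whose cap contains z but not w form a difference of
two caps, whose area is controlled by the overlap. The integral over w is then one over a uniform
variable in (0, 1). -/
theorem lintegral_overlap_cap_le {φ : ℝ} (h0 : 0 ≤ φ) (hφ : φ ≤ Real.pi / 2) (k : ℕ) :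
    ∫⁻ x, ∫⁻ z in planeCap φ x, ∫⁻ w in (planeCap φ x)ᶜ, ENNReal.ofReal (overlap z w ^ k)
      ∂stereoMeasure ∂stereoMeasure ∂sphMeasure 2 ≤
    ENNReal.ofReal (Real.sin φ * (1 / ((k + 1) * Real.sqrt (k + 1)))) := by
  have hsφ : 0 ≤ Real.sin φ :=
    Real.sin_nonneg_of_nonneg_of_le_pi h0 (by linarith [Real.pi_pos])
  let O : Set (ℂ × Sph 2) := {p | p.1 ∈ planeCap φ p.2}
  have hO : MeasurableSet O := (isOpen_planeCap_prod φ).measurableSet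
  obtain ⟨u, hum, hu⟩ : ∃ u : ℂ × Sph 2 → ENNReal, Measurable u ∧ ∀ p, u p = O.indicator 1 p :=
    ⟨_, measurable_one.indicator hO, fun _ => rfl⟩
  obtain ⟨v, hvm, hv⟩ : ∃ v : ℂ × Sph 2 → ENNReal, Measurable v ∧ ∀ p, v p = Oᶜ.indicator 1 p :=
    ⟨_, measurable_one.indicator hO.compl, fun _ => rfl⟩
  let G : ℂ → ℂ → Sph 2 → ENNReal := fun z w x => ENNReal.ofReal (overlap z w ^ k) *
    (u (z, x) * v (w, x))
  have hG : Measurable fun r : ℂ × ℂ × Sph 2 => G r.1 r.2.1 r.2.2 := by fun_prop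
  have e1 : ∀ x, ∫⁻ z in planeCap φ x, ∫⁻ w in (planeCap φ x)ᶜ, ENNReal.ofReal (overlap z w ^ k)
      ∂stereoMeasure ∂stereoMeasure = ∫⁻ z, ∫⁻ w, G z w x ∂stereoMeasure ∂stereoMeasure := by
    intro x
    have hP := (isOpen_planeCap φ x).measurableSet
    rw [← lintegral_indicator hP]
    refine lintegral_congr fun z => ?_
    by_cases hz : z ∈ planeCap φ x
    · rw [Set.indicator_of_mem hz, ← lintegral_indicator hP.compl]
      refine lintegral_congr fun w => ?_
      have hz' : (z, x) ∈ O := hz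
      simp only [G, hu, hv, Set.indicator_of_mem hz', Pi.one_apply, one_mul]
      by_cases hw : w ∈ planeCap φ x
      · have hw' : (w, x) ∉ Oᶜ := fun h => h hw
        rw [Set.indicator_of_notMem hw', 
          Set.indicator_of_notMem (show w ∉ (planeCap φ x)ᶜ from fun h => h hw), mul_zero]
      · have hw' : (w, x) ∈ Oᶜ := hw
        rw [Set.indicator_of_mem hw', Set.indicator_of_mem (show w ∈ (planeCap φ x)ᶜ from hw)]
        simp
    · have hz' : (z, x) ∉ O := hz
      simp [G, hu, Set.indicator_of_notMem hz, Set.indicator_of_notMem hz']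
  simp_rw [e1]
  rw [lintegral_rotate_three G hG]
  have e2 : ∀ z w, ∫⁻ x, G z w x ∂sphMeasure 2 ≤ ENNReal.ofReal
      (Real.sin φ * (Real.sqrt (1 - overlap z w) * overlap z w ^ k)) := by
    intro z w
    simp only [G]
    rw [lintegral_const_mul' _ _ ENNReal.ofReal_ne_top]
    have e3 : ∀ x, u (z, x) * v (w, x) =
        (cap (invStereo z) φ \ cap (invStereo w) φ).indicator 1 x := by
      intro x
      rw [hu, hv]
      have h1 : (z, x) ∈ O ↔ x ∈ cap (invStereo z) φ := mem_cap_comm _ _ _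
      have h2 : (w, x) ∈ O ↔ x ∈ cap (invStereo w) φ := mem_cap_comm _ _ _
      by_cases hz : x ∈ cap (invStereo z) φ <;> by_cases hw : x ∈ cap (invStereo w) φ <;>
        simp [h1, h2, hz, hw]
    simp_rw [e3]
    rw [lintegral_indicator_one ((measurableSet_cap _ _).diff (measurableSet_cap _ _)),
      ← ENNReal.ofReal_toReal (measure_ne_top (sphMeasure 2) _),
      ← ENNReal.ofReal_mul (pow_nonneg (overlap_nonneg z w) k)]
    refine ENNReal.ofReal_le_ofReal ?_
    have h := sphMeasure_cap_diff_le h0 hφ (invStereo z) (invStereo w)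
    rw [← overlap_eq] at h
    have := mul_le_mul_of_nonneg_left h (pow_nonneg (overlap_nonneg z w) k)
    refine this.trans_eq ?_
    ring
  have e4 : ∀ z, ∫⁻ w, ∫⁻ x, G z w x ∂sphMeasure 2 ∂stereoMeasure ≤
      ENNReal.ofReal (Real.sin φ * (1 / ((k + 1) * Real.sqrt (k + 1)))) := by
    intro z
    refine (lintegral_mono (e2 z)).trans ?_
    obtain ⟨p, q, hpq, h⟩ := exists_overlap_eq (invStereo z)
    have h' : ∀ w, overlap z w = ‖p + q * w‖ ^ 2 / (1 + ‖w‖ ^ 2) := fun w => by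
      rw [overlap_eq, h]
    simp_rw [h']
    rw [lintegral_stereoMeasure_overlap (fun r => ENNReal.ofReal
      (Real.sin φ * (Real.sqrt (1 - r) * r ^ k))) (by fun_prop) hpq]
    simp_rw [ENNReal.ofReal_mul hsφ]
    rw [lintegral_const_mul' _ _ ENNReal.ofReal_ne_top]
    gcongr
    exact lintegral_sqrt_mul_pow_le k
  refine (lintegral_mono e4).trans ?_
  simp

theorem measurable_eigCount_planeCap (N : ℕ) (φ : ℝ) :
    Measurable fun p : ((Fin N → Fin N → ℂ) × (Fin N → Fin N → ℂ)) × Sph 2 =>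
      eigCount (planeCap φ p.2) p.1.1 p.1.2 :=
  measurable_eigCount (isOpen_planeCap_prod φ)

theorem measurable_eigCount_mul (N : ℕ) (φ : ℝ) :
    Measurable fun p : ((Fin N → Fin N → ℂ) × (Fin N → Fin N → ℂ)) × Sph 2 =>
      (eigCount (planeCap φ p.2) p.1.1 p.1.2 : ENNReal) *
        eigCount (planeCap φ p.2)ᶜ p.1.1 p.1.2 := by
  have h := measurable_eigCount_planeCap N φ
  have hc : Measurable fun k : ℕ => (k : ENNReal) * ((N - k : ℕ) : ENNReal) := measurable_from_top
  simp_rw [eigCount_compl]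
  exact hc.comp h

/-- The expected number of pairs of points that are separated by a random cap. -/
theorem le_lintegral_eigCount_mul {φ : ℝ} (h0 : 0 ≤ φ) (hφ : φ ≤ Real.pi / 2) (m : ℕ) :
    ENNReal.ofReal (((m + 2 : ℕ) : ℝ) ^ 2 * (capArea 2 φ * (1 - capArea 2 φ))) ≤
    ∫⁻ x, ∫⁻ A, ∫⁻ B, (eigCount (planeCap φ x) A B : ENNReal) * eigCount (planeCap φ x)ᶜ A B
      ∂gaussMat (m + 2) (m + 2) ∂gaussMat (m + 2) (m + 2) ∂sphMeasure 2 +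
    ENNReal.ofReal (Real.sqrt (m + 2 : ℕ) * Real.sin φ) := by
  have hc0 : 0 ≤ capArea 2 φ := measureReal_nonneg
  have e1 : ∀ x, stereoMeasure (planeCap φ x) = ENNReal.ofReal (capArea 2 φ) := fun x => by
    rw [capArea_eq]
    exact stereoMeasure_cap x φ
  have e2 : ∀ x, stereoMeasure (planeCap φ x)ᶜ = ENNReal.ofReal (1 - capArea 2 φ) := fun x => by
    rw [prob_compl_eq_one_sub (isOpen_planeCap φ x).measurableSet, e1,
      ENNReal.ofReal_sub _ hc0, ENNReal.ofReal_one]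
  have h := lintegral_mono (μ := sphMeasure 2) fun x =>
    lintegral_pair_ge (m := m) (isOpen_planeCap φ x)
  simp_rw [e1, e2] at h
  rw [lintegral_const, measure_univ, mul_one, ← ENNReal.ofReal_mul hc0,
    ← ENNReal.ofReal_mul (by positivity)] at h
  have hm : Measurable fun x => ∫⁻ A, ∫⁻ B, (eigCount (planeCap φ x) A B : ENNReal) *
      eigCount (planeCap φ x)ᶜ A B ∂gaussMat (m + 2) (m + 2) ∂gaussMat (m + 2) (m + 2) := by
    refine measurable_lintegral_lintegral (fun x A B => (eigCount (planeCap φ x) A B : ENNReal) *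
      eigCount (planeCap φ x)ᶜ A B) ?_ _ _
    have h := (measurable_eigCount_mul (m + 2) φ).comp (f := fun r : Sph 2 ×
      (Fin (m + 2) → Fin (m + 2) → ℂ) × (Fin (m + 2) → Fin (m + 2) → ℂ) => (r.2, r.1))
      (by fun_prop)
    exact h
  rw [lintegral_add_left hm, lintegral_const_mul' _ _ ENNReal.ofReal_ne_top] at h
  refine h.trans ?_
  gcongr
  refine (mul_le_mul_right (lintegral_overlap_cap_le h0 hφ (m + 1)) _).trans_eq ?_
  rw [← ENNReal.ofReal_mul (by positivity)]
  congr 1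
  push_cast
  have e3 : ((m : ℝ) + 1 + 1) = m + 2 := by ring
  rw [e3]
  set s := Real.sqrt ((m : ℝ) + 2)
  have hs2 : s ^ 2 = m + 2 := Real.sq_sqrt (by positivity)
  have hsp : 0 < s := Real.sqrt_pos.2 (by positivity)
  rw [← hs2]
  field_simp

/-! ### The number variance -/

open Classical in
-- Each point lies in the random cap with probability equal to the cap area, so the mean over the
-- centre is the same for every configuration.
theorem integral_countP_planeCap (φ : ℝ) (s : Multiset ℂ) :
    Integrable (fun x => ((s.countP (· ∈ planeCap φ x) : ℕ) : ℝ)) (sphMeasure 2) ∧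
    ∫ x, ((s.countP (· ∈ planeCap φ x) : ℕ) : ℝ) ∂sphMeasure 2 =
      Multiset.card s * capArea 2 φ := by
  induction s using Multiset.induction_on with
  | empty => simp
  | cons z s ih =>
    have h1 : ∀ x, (((z ::ₘ s).countP (· ∈ planeCap φ x) : ℕ) : ℝ) =
        ((s.countP (· ∈ planeCap φ x) : ℕ) : ℝ) + (cap (invStereo z) φ).indicator 1 x := by
      intro x
      have h : z ∈ planeCap φ x ↔ x ∈ cap (invStereo z) φ := mem_cap_comm _ _ _
      rw [Multiset.countP_cons]
      by_cases hx : x ∈ cap (invStereo z) φ <;> simp [h, hx]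
    have hm := measurableSet_cap (invStereo z) φ
    have h2 : Integrable ((cap (invStereo z) φ).indicator (1 : Sph 2 → ℝ)) (sphMeasure 2) :=
      (integrable_const (1 : ℝ)).indicator hm
    simp_rw [h1]
    refine ⟨ih.1.add h2, ?_⟩
    rw [integral_add ih.1 h2, ih.2, integral_indicator_one hm, sphMeasure_cap, Multiset.card_cons]
    push_cast
    ring

theorem integral_eigCount_planeCap {N : ℕ} (φ : ℝ) (A B : Fin N → Fin N → ℂ) :
    ∫ x, (eigCount (planeCap φ x) A B : ℝ) ∂sphMeasure 2 = N * capArea 2 φ := by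
  have h := (integral_countP_planeCap φ (eigs A B)).2
  rw [card_eigs] at h
  exact h

/-- With Y = X (N - X) one has X² = N X - Y and E X = N σ, so the variance is N²σ(1 - σ) - E Y, and
the lower bound for separated pairs applies. -/
theorem variance_eigCount_le {φ : ℝ} (h0 : 0 ≤ φ) (hφ : φ ≤ Real.pi / 2) (m : ℕ) :
    variance (fun p : ((Fin (m + 2) → Fin (m + 2) → ℂ) × (Fin (m + 2) → Fin (m + 2) → ℂ)) × Sph 2 =>
      (eigCount (planeCap φ p.2) p.1.1 p.1.2 : ℝ))
      (((gaussMat (m + 2) (m + 2)).prod (gaussMat (m + 2) (m + 2))).prod (sphMeasure 2)) ≤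
    Real.sqrt (m + 2 : ℕ) * Real.sin φ := by
  set N := m + 2 with hN
  set μ := ((gaussMat N N).prod (gaussMat N N)).prod (sphMeasure 2) with hμ
  let X : ((Fin N → Fin N → ℂ) × (Fin N → Fin N → ℂ)) × Sph 2 → ℝ := fun p =>
    (eigCount (planeCap φ p.2) p.1.1 p.1.2 : ℝ)
  have hXm : Measurable X :=
    (measurable_from_top (f := ((↑) : ℕ → ℝ))).comp (measurable_eigCount_planeCap N φ)
  have hX0 : ∀ p, 0 ≤ X p := fun p => Nat.cast_nonneg _
  have hXN : ∀ p, X p ≤ N := fun p => Nat.cast_le.2 (eigCount_le _ _ _)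
  have hXb : ∀ p, ‖X p‖ ≤ N := fun p => by rw [Real.norm_of_nonneg (hX0 p)]; exact hXN p
  have hX2 : MemLp X 2 μ := MemLp.of_bound hXm.aestronglyMeasurable N (.of_forall hXb)
  have hXi : Integrable X μ := hX2.integrable one_le_two
  let Y : ((Fin N → Fin N → ℂ) × (Fin N → Fin N → ℂ)) × Sph 2 → ℝ := fun p => X p * (N - X p)
  have hYm : Measurable Y := hXm.mul (measurable_const.sub hXm)
  have hY0 : ∀ p, 0 ≤ Y p := fun p => mul_nonneg (hX0 p) (sub_nonneg.2 (hXN p))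
  have hYi : Integrable Y μ := by
    have : Y = fun p => N * X p - (X ^ 2) p := by
      ext p
      simp only [Y, Pi.pow_apply]
      ring
    rw [this]
    exact (hXi.const_mul _).sub hX2.integrable_sq
  have hEX : ∫ p, X p ∂μ = N * capArea 2 φ := by
    rw [hμ, integral_prod _ hXi]
    simp only [X, integral_eigCount_planeCap]
    simp
  have hEY : ENNReal.ofReal (∫ p, Y p ∂μ) =
      ∫⁻ x, ∫⁻ A, ∫⁻ B, (eigCount (planeCap φ x) A B : ENNReal) * eigCount (planeCap φ x)ᶜ A B
      ∂gaussMat N N ∂gaussMat N N ∂sphMeasure 2 := by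
    have hm := measurable_eigCount_mul N φ
    have e1 : ∀ p, ENNReal.ofReal (Y p) = (eigCount (planeCap φ p.2) p.1.1 p.1.2 : ENNReal) *
        eigCount (planeCap φ p.2)ᶜ p.1.1 p.1.2 := fun p => by
      have e : (N : ℝ) - X p = (eigCount (planeCap φ p.2)ᶜ p.1.1 p.1.2 : ℝ) := by
        rw [sub_eq_iff_eq_add', ← Nat.cast_add, eigCount_add_compl]
      simp only [Y]
      rw [e, ENNReal.ofReal_mul (hX0 p), ENNReal.ofReal_natCast, ENNReal.ofReal_natCast]
    rw [ofReal_integral_eq_lintegral_ofReal hYi (.of_forall hY0)]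
    simp_rw [e1]
    rw [hμ, lintegral_prod_symm _ hm.aemeasurable]
    refine lintegral_congr fun x => ?_
    have hmx := hm.comp (f := fun r : (Fin N → Fin N → ℂ) × (Fin N → Fin N → ℂ) => (r, x))
      (by fun_prop)
    exact lintegral_prod _ hmx.aemeasurable
  have hc0 : 0 ≤ capArea 2 φ := measureReal_nonneg
  have hsφ : 0 ≤ Real.sin φ :=
    Real.sin_nonneg_of_nonneg_of_le_pi h0 (by linarith [Real.pi_pos])
  have key := le_lintegral_eigCount_mul h0 hφ m
  rw [← hEY, ← ENNReal.ofReal_add (integral_nonneg hY0) (by positivity),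
    ENNReal.ofReal_le_ofReal_iff (add_nonneg (integral_nonneg hY0) (by positivity))] at key
  have hEX2 : ∫ p, (X ^ 2) p ∂μ = N * (N * capArea 2 φ) - ∫ p, Y p ∂μ := by
    rw [← hEX, ← integral_const_mul, ← integral_sub (hXi.const_mul _) hYi]
    congr 1
    ext p
    simp only [Y, Pi.pow_apply]
    ring
  rw [variance_eq_sub hX2, hEX2, hEX]
  linarith

theorem numPoints_sphericalConfig {N : ℕ} (A B : Matrix (Fin N) (Fin N) ℂ) (x : Sph 2) (φ : ℝ) :
    numPoints (sphericalConfig A B) (cap x φ) = (eigCount (planeCap φ x) A B : ℝ) := by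
  classical
  rw [numPoints, sum_indicator_eq_countP, mul_one, sphericalConfig, Multiset.countP_map,
    ← Multiset.countP_eq_card_filter]
  unfold eigCount eigs
  congr

theorem measurable_sumElim_uncurry (N : ℕ) :
    Measurable fun p : (Fin N → Fin N → ℂ) × (Fin N → Fin N → ℂ) =>
      (Sum.elim (fun ij => p.1 ij.1 ij.2)
        (fun ij => p.2 ij.1 ij.2) : (Fin N × Fin N) ⊕ (Fin N × Fin N) → ℂ) := by
  refine measurable_pi_lambda _ fun i => ?_
  rcases i with ij | ij
  · simp only [Sum.elim_inl]; fun_prop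
  · simp only [Sum.elim_inr]; fun_prop

theorem map_gaussMat_prod_uncurry (N : ℕ) :
    ((gaussMat N N).prod (gaussMat N N)).map (fun p => (Sum.elim (fun ij => p.1 ij.1 ij.2)
      (fun ij => p.2 ij.1 ij.2) : (Fin N × Fin N) ⊕ (Fin N × Fin N) → ℂ)) =
    Measure.pi fun _ => complexGaussian := by
  symm
  refine Measure.pi_eq fun s hs => ?_
  rw [Measure.map_apply (measurable_sumElim_uncurry N)
    (MeasurableSet.univ_pi hs)]
  have e : (fun p : (Fin N → Fin N → ℂ) × (Fin N → Fin N → ℂ) =>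
      (Sum.elim (fun ij => p.1 ij.1 ij.2)
      (fun ij => p.2 ij.1 ij.2) : (Fin N × Fin N) ⊕ (Fin N × Fin N) → ℂ)) ⁻¹' Set.univ.pi s =
      (Set.univ.pi fun i => Set.univ.pi fun j => s (Sum.inl (i, j))) ×ˢ
      (Set.univ.pi fun i => Set.univ.pi fun j => s (Sum.inr (i, j))) := by
    ext p
    simp [Set.mem_pi]
  rw [e, Measure.prod_prod, Measure.pi_pi, Measure.pi_pi]
  simp_rw [Measure.pi_pi]
  rw [Fintype.prod_sum_type, Fintype.prod_prod_type, Fintype.prod_prod_type]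

/-- The variance depends only on the joint law of the entries, a product of Gaussians by
independence. The entries are only almost everywhere measurable, so a measurable version `hF.mk` is
used for the transfer. -/
theorem numberVariance_sphericalConfig {N : ℕ} {Ω : Type*} [MeasurableSpace Ω] (P : Measure Ω)
    [IsProbabilityMeasure P] (A B : Ω → Matrix (Fin N) (Fin N) ℂ) (hAB : IsGaussianPair P A B)
    (φ : ℝ) :
    numberVariance P (fun ω => sphericalConfig (A ω) (B ω)) φ =
    variance (fun p : ((Fin N → Fin N → ℂ) × (Fin N → Fin N → ℂ)) × Sph 2 =>
      (eigCount (planeCap φ p.2) p.1.1 p.1.2 : ℝ))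
      (((gaussMat N N).prod (gaussMat N N)).prod (sphMeasure 2)) := by
  let f : (Fin N × Fin N) ⊕ (Fin N × Fin N) → Ω → ℂ :=
    Sum.elim (fun (ij : Fin N × Fin N) ω => A ω ij.1 ij.2) fun ij ω => B ω ij.1 ij.2
  have hlaw : ∀ i, HasLaw (f i) complexGaussian P := by
    rintro (ij | ij)
    · exact hAB.hasLaw_left ij.1 ij.2
    · exact hAB.hasLaw_right ij.1 ij.2
  have hf : ∀ i, AEMeasurable (f i) P := fun i => (hlaw i).aemeasurable
  have hmap := (iIndepFun_iff_map_fun_eq_pi_map hf).1 hAB.indep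
  simp_rw [(hlaw _).map_eq] at hmap
  have hF : AEMeasurable (fun ω i => f i ω) P := aemeasurable_pi_iff.2 hf
  let v : ((Fin N × Fin N) ⊕ (Fin N × Fin N) → ℂ) → (Fin N → Fin N → ℂ) × (Fin N → Fin N → ℂ) :=
    fun x => (fun i j => x (Sum.inl (i, j)), fun i j => x (Sum.inr (i, j)))
  have hv : Measurable v := by fun_prop
  have hmp : MeasurePreserving (fun ω => v (hF.mk _ ω)) P
      ((gaussMat N N).prod (gaussMat N N)) := by
    refine ⟨hv.comp hF.measurable_mk, ?_⟩
    have h1 : Measure.map (hF.mk _) P = Measure.pi fun _ => complexGaussian := by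
      rw [← hmap, Measure.map_congr hF.ae_eq_mk]
    refine (Measure.map_map hv hF.measurable_mk).symm.trans ?_
    rw [h1, ← map_gaussMat_prod_uncurry, Measure.map_map hv (measurable_sumElim_uncurry N)]
    exact Measure.map_id
  have hmp2 := hmp.prod (MeasurePreserving.id (sphMeasure 2))
  have hXm : Measurable fun p : ((Fin N → Fin N → ℂ) × (Fin N → Fin N → ℂ)) × Sph 2 =>
      (eigCount (planeCap φ p.2) p.1.1 p.1.2 : ℝ) :=
    (measurable_from_top (f := ((↑) : ℕ → ℝ))).comp (measurable_eigCount_planeCap N φ)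
  rw [← hmp2.map_eq, variance_map hXm.aemeasurable hmp2.measurable.aemeasurable, numberVariance]
  refine variance_congr ?_
  filter_upwards [Measure.quasiMeasurePreserving_fst.ae hF.ae_eq_mk] with p hp
  rw [numPoints_sphericalConfig]
  simp only [Function.comp_apply, Prod.map_fst, Prod.map_snd, ← hp]
  rfl

/-- Negative angles are admitted since a cap depends on φ only through cos φ. Two deflations require
N ≥ 2, which is harmless in the limits. -/
theorem numberVariance_le {N : ℕ} (hN : 2 ≤ N) {Ω : Type*} [MeasurableSpace Ω] (P : Measure Ω)
    [IsProbabilityMeasure P] (A B : Ω → Matrix (Fin N) (Fin N) ℂ) (hAB : IsGaussianPair P A B)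
    {φ : ℝ} (hφ : |φ| ≤ Real.pi / 2) :
    numberVariance P (fun ω => sphericalConfig (A ω) (B ω)) φ ≤ Real.sqrt N * Real.sin |φ| := by
  obtain ⟨m, rfl⟩ := Nat.exists_eq_add_of_le' hN
  have h : planeCap φ = planeCap |φ| := by
    ext x z
    simp [planeCap, cap]
  rw [numberVariance_sphericalConfig P A B hAB, h]
  exact variance_eigCount_le (abs_nonneg φ) hφ m

theorem numberVariance_nonneg {d : ℕ} {Ω : Type*} [MeasurableSpace Ω] (P : Measure Ω)
    (X : Ω → Multiset (Sph d)) (φ : ℝ) : 0 ≤ numberVariance P X φ := variance_nonneg _ _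

/-! ### The three regimes -/

theorem mainTheorem2 {Ω : ℕ → Type*} [∀ N, MeasurableSpace (Ω N)] (P : ∀ N, Measure (Ω N))
    [∀ N, IsProbabilityMeasure (P N)] (A B : ∀ N, Ω N → Matrix (Fin N) (Fin N) ℂ)
    (hAB : ∀ N, IsGaussianPair (P N) (A N) (B N)) :
    HyperuniformLargeCaps P (fun N ω => sphericalConfig (A N ω) (B N ω)) ∧
    HyperuniformSmallCaps P (fun N ω => sphericalConfig (A N ω) (B N ω)) ∧
    HyperuniformThreshold P (fun N ω => sphericalConfig (A N ω) (B N ω)) := by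
  have hsq : Tendsto (fun N : ℕ => Real.sqrt N) atTop atTop :=
    Real.tendsto_sqrt_atTop.comp tendsto_natCast_atTop_atTop
  have hpi := Real.pi_pos
  refine ⟨fun φ hφ => ?_, fun φ hφ hN => ?_, 1, ?_⟩
  · rw [Asymptotics.isLittleO_iff]
    intro c hc
    filter_upwards [eventually_ge_atTop 2, hsq.eventually_ge_atTop (1 / c)] with N h2 hN
    have h := numberVariance_le h2 (P N) (A N) (B N) (hAB N) (φ := φ)
      (by rw [abs_of_pos hφ.1]; exact hφ.2.le)
    rw [Real.norm_of_nonneg (numberVariance_nonneg _ _ _), Real.norm_of_nonneg (Nat.cast_nonneg N)]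
    have h3 := Real.sin_le_one |φ|
    have h4 : Real.sqrt N ^ 2 = N := Real.sq_sqrt (Nat.cast_nonneg N)
    have h5 := Real.sqrt_nonneg (N : ℝ)
    rw [div_le_iff₀ hc] at hN
    nlinarith
  · rw [Asymptotics.isLittleO_iff]
    intro c hc
    have hφ' : ∀ᶠ N in atTop, |φ N| ≤ Real.pi / 2 := by
      have := hφ.abs
      rw [abs_zero] at this
      exact this.eventually_le_const (by linarith)
    filter_upwards [eventually_ge_atTop 2, hφ', hN.eventually_ge_atTop ((2 / c) ^ 2)]
      with N h2 hφN hNc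
    have h := numberVariance_le h2 (P N) (A N) (B N) (hAB N) hφN
    have hc0 : 0 ≤ capArea 2 (φ N) := measureReal_nonneg
    rw [Real.norm_of_nonneg (numberVariance_nonneg _ _ _),
      Real.norm_of_nonneg (mul_nonneg (Nat.cast_nonneg N) hc0)]
    refine h.trans ?_
    -- sin² φ = (1 - cos φ)(1 + cos φ), where the first factor is twice the cap area and the second
    -- is at most 2.
    have h3 : Real.sin |φ N| ≤ 2 * Real.sqrt (capArea 2 (φ N)) := by
      apply le_of_sq_le_sq _ (by positivity)
      rw [mul_pow, Real.sq_sqrt hc0, capArea_eq, Real.sin_sq, Real.cos_abs]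
      nlinarith [Real.cos_le_one (φ N), Real.neg_one_le_cos (φ N)]
    set q := Real.sqrt (N * capArea 2 (φ N)) with hq
    have hq2 : q ^ 2 = N * capArea 2 (φ N) := Real.sq_sqrt (by positivity)
    have h4 : 2 / c ≤ q := Real.le_sqrt_of_sq_le hNc
    rw [div_le_iff₀ hc] at h4
    have hq0 : 0 ≤ q := Real.sqrt_nonneg _
    calc Real.sqrt N * Real.sin |φ N| ≤ Real.sqrt N * (2 * Real.sqrt (capArea 2 (φ N))) := by gcongr
      _ = 2 * q := by rw [hq, Real.sqrt_mul (Nat.cast_nonneg N)]; ring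
      _ ≤ c * (N * capArea 2 (φ N)) := by rw [← hq2]; nlinarith
  · filter_upwards [eventually_gt_atTop 0] with t ht
    refine limsup_le_of_le (by isBoundedDefault) ?_
    have hlim : Tendsto (fun N : ℕ => t * (N : ℝ) ^ (-(1 / ((2 : ℕ) : ℝ)))) atTop (𝓝 0) := by
      have := ((tendsto_rpow_neg_atTop (y := 1 / ((2 : ℕ) : ℝ)) (by norm_num)).comp
        tendsto_natCast_atTop_atTop).const_mul t
      simpa using this
    filter_upwards [eventually_ge_atTop 2, hlim.eventually_le_const (half_pos hpi)] with N h2 hN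
    have hNp : (0 : ℝ) < N := by exact_mod_cast (by omega : 0 < N)
    have hpos : 0 < t * (N : ℝ) ^ (-(1 / ((2 : ℕ) : ℝ))) := by positivity
    have h := numberVariance_le h2 (P N) (A N) (B N) (hAB N)
      (φ := t * (N : ℝ) ^ (-(1 / ((2 : ℕ) : ℝ)))) (by rwa [abs_of_pos hpos])
    rw [abs_of_pos hpos] at h
    refine EReal.coe_le_coe_iff.2 (h.trans ?_)
    have h3 := Real.sin_le hpos.le
    have h4 : Real.sqrt N * (t * (N : ℝ) ^ (-(1 / ((2 : ℕ) : ℝ)))) = t := by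
      rw [Real.rpow_neg hNp.le, Nat.cast_ofNat, ← Real.sqrt_eq_rpow]
      have : Real.sqrt N ≠ 0 := (Real.sqrt_pos.2 hNp).ne'
      field_simp
    calc _ ≤ Real.sqrt N * (t * (N : ℝ) ^ (-(1 / ((2 : ℕ) : ℝ)))) := by gcongr
      _ = 1 * t ^ (2 - 1) := by rw [h4]; simp
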